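/- Let $n\ge 2$, let $I\subset\mathbb R$ be an open interval with $0\in I$, let $\Omega\subset\mathbb C$ be an open set containing $I$, and consider the system $y'=A(x;\lambda)y$, $x\in\mathbb R$, under the following assumptions. (A) $A:\mathbb R\times\Omega\to\mathbb C^{n\times n}$ is continuous, $A(x;\lambda)$ is a real matrix for $\lambda\in I$, and $\lambda\mapsto A(x;\lambda)$ is analytic on $\Omega$ for every $x\in\mathbb{R}$. (B) The limits $A_\pm(\lambda)=\lim_{x\to\pm\infty}A(x;\lambda)$ exist for each $\lambda\in\Omega$, uniformly on compact subsets of $\Omega$. (C) For each $\lambda\in\Omega$, each of the matrices $A_\pm(\lambda)$ has a unique eigenvalue $\mu_\pm(\lambda)$ of largest real part, which is simple; $\mu_\pm$ is analytic on $\Omega$; and $v^\pm(\lambda)$, $w^\pm(\lambda)$ are right and left eigenvectors of $A_\pm(\lambda)$ for $\mu_\pm(\lambda)$, analytic on $\Omega$, with $w^\pm(\lambda)v^\pm(\lambda)=1$. (D) With $E(x;\lambda)=A(x;\lambda)-A_-(\lambda)$ for $x<0$ and $E(x;\lambda)=A(x;\lambda)-A_+(\lambda)$ for $x>0$, the integral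 $\int_{\mathbb R}|E(x;\lambda)|\,dx$ is finite for each $\lambda\in\Omega$ and converges uniformly on compact subsets of $\Omega$. For $v,\mathcal V\in\mathbb C^n$ write $v\wedge\mathcal V:=\sum_{i=1}^n(-1)^{i+1}v_i\mathcal V_{n+1-i}$ (the wedge product of the 1-form with coefficients $v_i$ and the $(n-1)$-form $\mathcal V_1e_1\wedge\dots\wedge e_{n-1}+\mathcal V_2e_1\wedge\dots\wedge e_{n-2}\wedge e_n+\dots+\mathcal V_ne_2\wedge\dots\wedge e_n$), and let $\tilde A$ be the matrix with entries $\tilde a_{ij}=(-1)^{i+j+1}a_{(n+1-j)(n+1-i)}$. Let $\eta^-(\cdot;\lambda)$ be the solution of $y'=A(x;\lambda)y$ with $\lim_{x\to-\infty}e^{-\mu_-(\lambda)x}\eta^-(x;\lambda)=v^-(\lambda)$, and let $\tilde{\mathcal Y}^+(\cdot;\lambda)$ be the solution of $\mathcal Y'=\tilde A(x;\lambda)\mathcal Y$ with $\lim_{x\to+\infty}e^{\mu_+(\lambda)x}\tilde{\mathcal Y}^+(x;\lambda)=\tilde{\mathcal V}^+(\lambda)$, where $\tilde{\mathcal V}^+_j(\lambda)=(-1)^{n-j}w^+_{n+1-j}(\lambda)$.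 These two solutions exist and are unique for every $\lambda\in\Omega$, and for each fixed $x\in\mathbb{R}$ they are analytic in $\lambda\in\Omega$; the Evans function $D(\lambda):=\eta^-(x;\lambda)\wedge\tilde{\mathcal Y}^+(x;\lambda)$ does not depend on $x$ and is analytic on $\Omega$. Assume in addition that $A_{\lambda\lambda}(x;0)=0$ for all $x\in\mathbb R$. If $D(0)=0$, then $$D'(0)=\int_{-\infty}^{+\infty}\big(A_\lambda(x;0)\,\eta^-(x;0)\big)\wedge\tilde{\mathcal Y}^+(x;0)\,dx .$$ If moreover $D'(0)=0$, then $$D''(0)=\int_{-\infty}^{+\infty}\big(A_\lambda(x;0)\,\eta^-_\lambda(x;0)\big)\wedge\tilde{\mathcal Y}^+(x;0)\,dx+\int_{-\infty}^{+\infty}\big(A_\lambda(x;0)\,\eta^-(x;0)\big)\wedge\tilde{\mathcal Y}^+_\lambda(x;0)\,dx .$$ In each case the integrals converge absolutely. -/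

import Mathlib

open Set Filter Topology MeasureTheory

namespace EvansODE

/-- The number `v ∧ 𝒱`, for a vector `v` read as a 1-form `∑ vᵢ eᵢ` and a vector `𝒱` read as the
`(n-1)`-form `𝒱₁ e₁ ∧ ⋯ ∧ eₙ₋₁ + 𝒱₂ e₁ ∧ ⋯ ∧ eₙ₋₂ ∧ eₙ + ⋯ + 𝒱ₙ e₂ ∧ ⋯ ∧ eₙ`: the coefficient
`∑ᵢ (-1)^(i+1) vᵢ 𝒱ₙ₊₁₋ᵢ` of `e₁ ∧ ⋯ ∧ eₙ` (here the indices start at `0`). -/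
def wedge {n : ℕ} (v V : Fin n → ℂ) : ℂ :=
  ∑ i : Fin n, (-1 : ℂ) ^ (i : ℕ) * v i * V i.rev

/-- The matrix `Ã` with entries `ãᵢⱼ = (-1)^(i+j+1) a₍ₙ₊₁₋ⱼ₎₍ₙ₊₁₋ᵢ₎`. -/
def tildeMatrix {n : ℕ} (M : Matrix (Fin n) (Fin n) ℂ) : Matrix (Fin n) (Fin n) ℂ :=
  Matrix.of fun i j => (-1 : ℂ) ^ ((i : ℕ) + (j : ℕ) + 1) * M j.rev i.rev

/-- The vector `𝒱` with entries `𝒱ⱼ = (-1)^(n-j) wₙ₊₁₋ⱼ` (for `j = 1, …, n`). -/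
def tildeVector {n : ℕ} (w : Fin n → ℂ) : Fin n → ℂ :=
  fun j => (-1 : ℂ) ^ (j.rev : ℕ) * w j.rev

/-- The entrywise `λ`-derivative of a matrix family. -/
noncomputable def dLam {n : ℕ} (A : ℝ → ℂ → Matrix (Fin n) (Fin n) ℂ) :
    ℝ → ℂ → Matrix (Fin n) (Fin n) ℂ :=
  fun x lam => Matrix.of fun i j => deriv (fun l : ℂ => A x l i j) lam

/-- A matrix norm (all of them are equivalent): the sum of the absolute values of the entries. -/
noncomputable def entrySum {n : ℕ} (M : Matrix (Fin n) (Fin n) ℂ) : ℝ :=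
  ∑ i : Fin n, ∑ j : Fin n, ‖M i j‖

/-- Assumption (A). -/
structure AssumptionA {n : ℕ} (I : Set ℝ) (Ω : Set ℂ)
    (A : ℝ → ℂ → Matrix (Fin n) (Fin n) ℂ) : Prop where
  interval_open : IsOpen I
  interval : I.OrdConnected
  domain_open : IsOpen Ω
  interval_subset : ∀ t ∈ I, (t : ℂ) ∈ Ω
  continuous : ContinuousOn (fun p : ℝ × ℂ => A p.1 p.2) (univ ×ˢ Ω)
  real : ∀ x : ℝ, ∀ t ∈ I, ∀ i j, (A x (t : ℂ) i j).im = 0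
  analytic : ∀ x : ℝ, ∀ i j, AnalyticOnNhd ℂ (fun lam => A x lam i j) Ω

/-- Assumption (B): `A(x;λ) → A₋(λ)` as `x → -∞` and `A(x;λ) → A₊(λ)` as `x → +∞`, uniformly for
`λ` in compact subsets of `Ω`. -/
structure AssumptionB {n : ℕ} (Ω : Set ℂ) (A : ℝ → ℂ → Matrix (Fin n) (Fin n) ℂ)
    (Am Ap : ℂ → Matrix (Fin n) (Fin n) ℂ) : Prop where
  atMinus : ∀ K ⊆ Ω, IsCompact K → ∀ i j,
    TendstoUniformlyOn (fun x lam => A x lam i j) (fun lam => Am lam i j) atBot K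
  atPlus : ∀ K ⊆ Ω, IsCompact K → ∀ i j,
    TendstoUniformlyOn (fun x lam => A x lam i j) (fun lam => Ap lam i j) atTop K

/-- Assumption (C) for one of the two limit matrices, here called `M`: for each `λ ∈ Ω` the number
`μ(λ)` is an algebraically simple eigenvalue of `M(λ)`, and its real part is strictly larger than
that of every other eigenvalue; `μ` is analytic on `Ω`; and `v`, `w` are analytic right and left
eigenvectors for `μ`, normalized by `w v = 1`. -/
structure AssumptionC {n : ℕ} (Ω : Set ℂ) (M : ℂ → Matrix (Fin n) (Fin n) ℂ)
    (μ : ℂ → ℂ) (v w : ℂ → Fin n → ℂ) : Prop where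
  simple : ∀ lam ∈ Ω, (M lam).charpoly.rootMultiplicity (μ lam) = 1
  dominant : ∀ lam ∈ Ω, ∀ ν ∈ spectrum ℂ (M lam), ν ≠ μ lam → ν.re < (μ lam).re
  analytic_eigenvalue : AnalyticOnNhd ℂ μ Ω
  analytic_right : AnalyticOnNhd ℂ v Ω
  analytic_left : AnalyticOnNhd ℂ w Ω
  right_eigenvector : ∀ lam ∈ Ω, (M lam).mulVec (v lam) = μ lam • v lam
  left_eigenvector : ∀ lam ∈ Ω, Matrix.vecMul (w lam) (M lam) = μ lam • w lam
  normalized : ∀ lam ∈ Ω, w lam ⬝ᵥ v lam = 1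

/-- `E(x;λ)`, equal to `A(x;λ) - A₋(λ)` for `x < 0` and to `A(x;λ) - A₊(λ)` for `x > 0`. -/
noncomputable def deviation {n : ℕ} (A : ℝ → ℂ → Matrix (Fin n) (Fin n) ℂ)
    (Am Ap : ℂ → Matrix (Fin n) (Fin n) ℂ) (x : ℝ) (lam : ℂ) : Matrix (Fin n) (Fin n) ℂ :=
  if x < 0 then A x lam - Am lam else A x lam - Ap lam

/-- Assumption (D): `∫ |E(x;λ)| dx` is finite for each `λ ∈ Ω` and converges uniformly for `λ` in
compact subsets of `Ω`. -/
structure AssumptionD {n : ℕ} (Ω : Set ℂ) (A : ℝ → ℂ → Matrix (Fin n) (Fin n) ℂ)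
    (Am Ap : ℂ → Matrix (Fin n) (Fin n) ℂ) : Prop where
  finite : ∀ lam ∈ Ω, Integrable (fun x : ℝ => entrySum (deviation A Am Ap x lam))
  uniform : ∀ K ⊆ Ω, IsCompact K → ∀ ε > 0, ∃ R : ℝ, ∀ lam ∈ K,
    ∫ x in {x : ℝ | R < |x|}, entrySum (deviation A Am Ap x lam) < ε

/-- `y` solves `y' = A(x;λ) y` on `ℝ` and `e^{-μ₋(λ) x} y(x) → v⁻(λ)` as `x → -∞`. -/
def IsEtaMinus {n : ℕ} (A : ℝ → ℂ → Matrix (Fin n) (Fin n) ℂ) (μm : ℂ → ℂ)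
    (vm : ℂ → Fin n → ℂ) (lam : ℂ) (y : ℝ → Fin n → ℂ) : Prop :=
  (∀ x : ℝ, HasDerivAt y ((A x lam).mulVec (y x)) x) ∧
    Tendsto (fun x : ℝ => Complex.exp (-(μm lam * x)) • y x) atBot (𝓝 (vm lam))

/-- `Y` solves `Y' = Ã(x;λ) Y` on `ℝ` and `e^{μ₊(λ) x} Y(x) → 𝒱̃⁺(λ)` as `x → +∞`, where `𝒱̃⁺(λ)` is
the eigenvector of `Ã₊(λ)` for the eigenvalue `-μ₊(λ)` that comes from the left eigenvector
`w⁺(λ)`. -/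
def IsYTildePlus {n : ℕ} (A : ℝ → ℂ → Matrix (Fin n) (Fin n) ℂ) (μp : ℂ → ℂ)
    (wp : ℂ → Fin n → ℂ) (lam : ℂ) (Y : ℝ → Fin n → ℂ) : Prop :=
  (∀ x : ℝ, HasDerivAt Y ((tildeMatrix (A x lam)).mulVec (Y x)) x) ∧
    Tendsto (fun x : ℝ => Complex.exp (μp lam * x) • Y x) atTop (𝓝 (tildeVector (wp lam)))

/-- `η⁻(x;λ)`: the solution singled out by `IsEtaMinus`. -/
noncomputable def etaMinus {n : ℕ} (A : ℝ → ℂ → Matrix (Fin n) (Fin n) ℂ) (μm : ℂ → ℂ)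
    (vm : ℂ → Fin n → ℂ) (x : ℝ) (lam : ℂ) : Fin n → ℂ :=
  Classical.epsilon (IsEtaMinus A μm vm lam) x

/-- `𝒴̃⁺(x;λ)`: the solution singled out by `IsYTildePlus`. -/
noncomputable def yTildePlus {n : ℕ} (A : ℝ → ℂ → Matrix (Fin n) (Fin n) ℂ) (μp : ℂ → ℂ)
    (wp : ℂ → Fin n → ℂ) (x : ℝ) (lam : ℂ) : Fin n → ℂ :=
  Classical.epsilon (IsYTildePlus A μp wp lam) x

/-- The Evans function `D(λ) = η⁻(x;λ) ∧ 𝒴̃⁺(x;λ)`, which does not depend on `x`; here `x = 0`. -/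
noncomputable def evans {n : ℕ} (A : ℝ → ℂ → Matrix (Fin n) (Fin n) ℂ) (μm μp : ℂ → ℂ)
    (vm wp : ℂ → Fin n → ℂ) (lam : ℂ) : ℂ :=
  wedge (etaMinus A μm vm 0 lam) (yTildePlus A μp wp 0 lam)

end EvansODE

/-!
The solution `η⁻` and the row vector form of `𝒴̃⁺` are constructed by the same argument: on row
vectors the matrix `Ã` acts as `-Aᵀ`, so the substitution `x ↦ -x` turns the solution selected at
`+∞` into the solution of the system with matrix `A(-x)ᵀ` that is selected at `-∞` by the
eigenvector `w⁺` (`isYTildePlus_iff`). It therefore suffices to treat the end `-∞`, and the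
bilinear form `v ∧ 𝒱` becomes the pairing of a row with a column.

*Existence, uniqueness, analyticity.* Write `η⁻ = e^{μx} u`. Then `u → v` at `-∞` if and only if `u`
is bounded there and `u(x) = v + ∫_{-∞}^x e^{(x-t)(A₋-μ)} E(t) u(t) dt`, a Volterra equation. The
flow of `A₋ - μ` is bounded in positive time: after subtraction of the spectral projection `v w` all
eigenvalues have negative real part, so by Gelfand's formula the remaining flow decays
exponentially (`exists_norm_expFlow_lt_one`, `AssumptionC.exists_flow_le`). Hence the Volterra
operator is a contraction for a suitable weight, and its Neumann series `volterraSol` converges.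
Local uniformity in `λ` comes from Cauchy's formula: a holomorphic family whose `L¹` norms are
locally bounded is locally dominated by one integrable function (`exists_dominating`). So every
term of the series, and its sum, are holomorphic in `λ`.

*The derivatives.* Again by Cauchy's formula `∂_λ` and `∂_x` commute (`HolFamily.hasDerivAt_deriv`),
and bounds that are locally uniform in `λ` pass to `λ`-derivatives. Differentiation in `x` gives
`(η_λ ∧ 𝒴̃)' = (A_λ η) ∧ 𝒴̃`, and, if `A_λλ = 0`, `(η_λλ ∧ 𝒴̃)' = 2 (A_λ η_λ) ∧ 𝒴̃` and
`(η_λ ∧ 𝒴̃_λ)' = (A_λ η) ∧ 𝒴̃_λ - (A_λ η_λ) ∧ 𝒴̃`. These are integrated over `(-∞, 0]`, and the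
mirror identities, with the roles of `η` and `𝒴̃` interchanged, over `[0, ∞)`; the terms at `0` add
up to `D'(0)` and to `D''(0)`.

The terms at infinity vanish, and the integrals converge absolutely, by the following gain. At `-∞`
the functions `η, η_λ, η_λλ` are of size `e^{(μ-ε)x}` for every `ε > 0`, and `D(0) = 0` makes
`Z = e^{μx} 𝒴̃` decay exponentially: the only component of `Z` that need not decay is `v · Z`, and
as `u · Z = D(0) = 0` it equals `(v - u) · Z`, which is small compared with `Z` since `u → v`. Thus
`Z` solves a small perturbation of an exponentially stable system (`exists_exp_decay`). The same
reasoning applies to `𝒴̃_λ` when also `D'(0) = 0`, because then `η ∧ 𝒴̃_λ = -η_λ ∧ 𝒴̃` decays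
(`AdjointFamily.exists_decay`, `AdjointFamily.integral_first`, `AdjointFamily.integral_second`).
-/

namespace EvansODE

/-! ### The exponential flow of an operator -/

section ExpFlow

variable {𝔸 : Type*} [NormedRing 𝔸] [NormedAlgebra ℂ 𝔸]

/-- The one-parameter group `e^{tB}`, with real time `t`. -/
noncomputable def expFlow (B : 𝔸) (t : ℝ) : 𝔸 :=
  NormedSpace.exp ((t : ℂ) • B)

@[simp]
lemma expFlow_zero (B : 𝔸) : expFlow B 0 = 1 := by
  simp [expFlow]

lemma commute_expFlow (B : 𝔸) (t : ℝ) : Commute B (expFlow B t) :=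
  ((Commute.refl B).smul_right _).exp_right

variable [CompleteSpace 𝔸]

lemma expFlow_add (B : 𝔸) (s t : ℝ) : expFlow B (s + t) = expFlow B s * expFlow B t := by
  let : NormedAlgebra ℚ 𝔸 := NormedAlgebra.restrictScalars ℚ ℂ 𝔸
  rw [expFlow, expFlow, expFlow, ← NormedSpace.exp_add_of_commute]
  · rw [← add_smul]; push_cast; rfl
  · exact ((Commute.refl B).smul_left _).smul_right _

lemma expFlow_sub (B : 𝔸) (s t : ℝ) : expFlow B (s - t) = expFlow B s * expFlow B (-t) := by
  rw [sub_eq_add_neg, expFlow_add]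

lemma expFlow_mul_neg (B : 𝔸) (t : ℝ) : expFlow B t * expFlow B (-t) = 1 := by
  rw [← expFlow_add]; simp

lemma expFlow_nat_mul (B : 𝔸) (k : ℝ) (j : ℕ) : expFlow B (j * k) = expFlow B k ^ j := by
  induction j with
  | zero => simp
  | succ j ih => rw [pow_succ, ← ih, ← expFlow_add]; congr 1; push_cast; ring

lemma hasDerivAt_expFlow (B : 𝔸) (t : ℝ) :
    HasDerivAt (expFlow B) (B * expFlow B t) t := by
  have h := (hasDerivAt_exp_smul_const' (𝕂 := ℂ) B (t : ℂ)).scomp t Complex.ofRealCLM.hasDerivAt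
  simpa using! h

lemma continuous_uncurry_expFlow : Continuous fun p : 𝔸 × ℝ => expFlow p.1 p.2 := by
  let : NormedAlgebra ℚ 𝔸 := NormedAlgebra.restrictScalars ℚ ℂ 𝔸
  unfold expFlow
  exact NormedSpace.exp_continuous.comp (by fun_prop)

lemma continuous_expFlow (B : 𝔸) : Continuous (expFlow B) :=
  continuous_uncurry_expFlow.comp (by fun_prop : Continuous fun t : ℝ => (B, t))

lemma differentiableOn_expFlow {B : ℂ → 𝔸} {U : Set ℂ} (hB : DifferentiableOn ℂ B U) (t : ℝ) :
    DifferentiableOn ℂ (fun lam => expFlow (B lam) t) U := by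
  intro lam hlam
  have h := (NormedSpace.exp_analytic (𝕂 := ℂ) ((t : ℂ) • B lam)).differentiableAt
  exact h.comp_differentiableWithinAt lam ((hB lam hlam).const_smul (t : ℂ))

/-- If `a` and `b` agree on the range of `q`, and that range is invariant under `b`, then so do
their flows. -/
lemma expFlow_mul_eq_of_mul_eq {a b q : 𝔸} (h : a * q = b * q) (hq : Commute b q) (t : ℝ) :
    expFlow a t * q = expFlow b t * q := by
  have hpow : ∀ k : ℕ, a ^ k * q = b ^ k * q := by
    intro k
    induction k with
    | zero => simp
    | succ k ih =>
      rw [pow_succ, pow_succ, mul_assoc, mul_assoc, h, hq.eq, ← mul_assoc, ← mul_assoc, ih]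
  have ha := (NormedSpace.exp_series_hasSum_exp' (𝕂 := ℂ) ((t : ℂ) • a)).mul_right q
  have hb := (NormedSpace.exp_series_hasSum_exp' (𝕂 := ℂ) ((t : ℂ) • b)).mul_right q
  refine ha.unique ?_
  convert! hb using 2 with k
  simp only [smul_pow, smul_mul_assoc, hpow]

/-- If the time-`k` map of a flow is a strict contraction for some `k > 0`, the flow decays
exponentially, with the same constants for all nearby generators. -/
lemma eventually_norm_expFlow_le {N₀ : 𝔸} {k : ℝ} (hk : 0 < k) (h : ‖expFlow N₀ k‖ < 1) :
    ∃ C α : ℝ, 0 < α ∧ ∀ᶠ N in 𝓝 N₀, ∀ t : ℝ, 0 ≤ t →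
      ‖expFlow N t‖ ≤ C * Real.exp (-(α * t)) := by
  obtain ⟨q, hq0, hq1⟩ : ∃ q, max ‖expFlow N₀ k‖ 0 < q ∧ q < 1 := exists_between (by simp [h])
  have hqn : ‖expFlow N₀ k‖ < q := (le_max_left _ _).trans_lt hq0
  have hqp : 0 < q := (le_max_right _ _).trans_lt hq0
  have hlog : Real.log q < 0 := Real.log_neg hqp hq1
  obtain ⟨C, hC⟩ := (isCompact_Icc (a := (0 : ℝ)) (b := k)).exists_bound_of_continuousOn
    (continuous_expFlow N₀).continuousOn
  have hcpt : ∀ᶠ N in 𝓝 N₀, ∀ t ∈ Icc (0 : ℝ) k, ‖expFlow N t‖ < C + 1 := by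
    refine isCompact_Icc.eventually_forall_of_forall_eventually fun t ht => ?_
    have hcont : ContinuousAt (fun p : 𝔸 × ℝ => ‖expFlow p.1 p.2‖) (N₀, t) :=
      continuous_uncurry_expFlow.norm.continuousAt
    exact hcont.eventually_lt_const (by have := hC t ht; simp only; linarith)
  have hk' : ∀ᶠ N in 𝓝 N₀, ‖expFlow N k‖ < q := by
    have hcont : ContinuousAt (fun N : 𝔸 => ‖expFlow N k‖) N₀ :=
      (continuous_uncurry_expFlow.comp
        (by fun_prop : Continuous fun N : 𝔸 => (N, k))).norm.continuousAt
    exact hcont.eventually_lt_const hqn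
  refine ⟨(C + 1) * Real.exp (-Real.log q), -Real.log q / k, div_pos (by linarith) hk, ?_⟩
  filter_upwards [hcpt, hk'] with N hN hNk t ht
  -- `t` is `j` periods of length `k` and a remainder in `[0, k)`
  set j := ⌊t / k⌋₊ with hj
  have hj1 : (j : ℝ) * k ≤ t := by
    have := Nat.floor_le (div_nonneg ht hk.le)
    rwa [le_div_iff₀ hk] at this
  have hj2 : t / k < j + 1 := Nat.lt_floor_add_one _
  have hsplit : expFlow N t = expFlow N (t - j * k) * expFlow N k ^ j := by
    rw [← expFlow_nat_mul, ← expFlow_add]; congr 1; ring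
  have hpow : ∀ (a b : 𝔸) (m : ℕ), ‖a * b ^ m‖ ≤ ‖a‖ * ‖b‖ ^ m := by
    intro a b m
    induction m with
    | zero => simp
    | succ m ih =>
      rw [pow_succ, pow_succ, ← mul_assoc, ← mul_assoc]
      exact (norm_mul_le _ _).trans (mul_le_mul_of_nonneg_right ih (norm_nonneg _))
  have hs : ‖expFlow N (t - j * k)‖ < C + 1 := by
    refine hN _ ⟨by linarith, ?_⟩
    rw [div_lt_iff₀ hk] at hj2
    linarith
  have hqj : q ^ j ≤ Real.exp (-Real.log q) * Real.exp (-(-Real.log q / k * t)) := by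
    rw [← Real.exp_add, ← Real.exp_log (pow_pos hqp j), Real.log_pow, Real.exp_le_exp]
    have : -(-Real.log q / k * t) = Real.log q * (t / k) := by ring
    rw [this]
    nlinarith
  calc ‖expFlow N t‖ ≤ ‖expFlow N (t - j * k)‖ * ‖expFlow N k‖ ^ j := hsplit ▸ hpow _ _ _
    _ ≤ (C + 1) * q ^ j := by
        have := (norm_nonneg (expFlow N (t - j * k))).trans hs.le
        gcongr
    _ ≤ (C + 1) * (Real.exp (-Real.log q) * Real.exp (-(-Real.log q / k * t))) := by
        have := (norm_nonneg (expFlow N (t - j * k))).trans hs.le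
        gcongr
    _ = _ := by ring

end ExpFlow

/-! ### Operators whose eigenvalues have negative real part -/

section Hurwitz

variable {V : Type*} [NormedAddCommGroup V] [NormedSpace ℂ V]

lemma exp_apply_of_eigenvector [CompleteSpace V] {N : V →L[ℂ] V} {ν : ℂ} {y : V}
    (h : N y = ν • y) : NormedSpace.exp N y = Complex.exp ν • y := by
  have hpow : ∀ k : ℕ, (N ^ k) y = ν ^ k • y := by
    intro k
    induction k with
    | zero => simp
    | succ k ih =>
      rw [pow_succ, mul_apply_eq_comp, h, map_smul, ih, smul_smul, pow_succ, mul_comm]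
  have h1 := (NormedSpace.exp_series_hasSum_exp' (𝕂 := ℂ) N).mapL
    (ContinuousLinearMap.apply ℂ V y)
  have h2 := (NormedSpace.exp_series_hasSum_exp' (𝕂 := ℂ) ν).smul_const y
  rw [← Complex.exp_eq_exp_ℂ] at h2
  refine h1.unique ?_
  convert! h2 using 2 with k
  simp [hpow, smul_smul]

/-- By Gelfand's formula, the flow of an operator whose eigenvalues all have negative real part is
a strict contraction at some positive time. -/
lemma exists_norm_expFlow_lt_one [FiniteDimensional ℂ V] [Nontrivial V] {N : V →L[ℂ] V}
    (h : ∀ (ν : ℂ) (y : V), y ≠ 0 → N y = ν • y → ν.re < 0) :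
    ∃ k : ℝ, 0 < k ∧ ‖expFlow N k‖ < 1 := by
  have : CompleteSpace V := FiniteDimensional.complete ℂ V
  set E : V →L[ℂ] V := NormedSpace.exp N with hE
  have hcomm : Commute N E := (Commute.refl N).exp_right
  have hspec : ∀ z ∈ spectrum ℂ E, ‖z‖₊ < 1 := by
    intro z hz
    -- an eigenspace of `e^N` is invariant under `N`, hence contains an eigenvector of `N`
    obtain ⟨y, hy0, hy⟩ : ∃ y : V, y ≠ 0 ∧ E y = z • y := by
      by_contra! hne
      refine hz ?_
      change IsUnit (algebraMap ℂ (V →L[ℂ] V) z - E)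
      rw [ContinuousLinearMap.isUnit_iff_bijective]
      have hinj : Function.Injective (algebraMap ℂ (V →L[ℂ] V) z - E) := by
        rw [injective_iff_map_eq_zero]
        intro y hy
        by_contra hy0
        refine hne y hy0 ?_
        simp only [sub_apply, Algebra.algebraMap_eq_smul_one,
          smul_apply, one_apply_eq_self, sub_eq_zero] at hy
        exact hy.symm
      exact ⟨hinj, (LinearMap.injective_iff_surjective
        (f := ((algebraMap ℂ (V →L[ℂ] V) z - E : V →L[ℂ] V) : V →ₗ[ℂ] V))).1 hinj⟩
    let S : Submodule ℂ V := LinearMap.ker ((E - z • 1 : V →L[ℂ] V) : V →ₗ[ℂ] V)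
    have hS : ∀ p : V, p ∈ S ↔ E p = z • p := by
      intro p
      simp [S, sub_eq_zero]
    have hmaps : ∀ p ∈ S, (N : V →ₗ[ℂ] V) p ∈ S := by
      intro p hp
      rw [hS] at hp ⊢
      have : E (N p) = N (E p) := by
        rw [← mul_apply_eq_comp, ← hcomm.eq, mul_apply_eq_comp]
      simp only [ContinuousLinearMap.coe_coe]
      rw [this, hp, map_smul]
    have : Nontrivial S := ⟨⟨y, (hS y).2 hy⟩, 0, fun he => hy0 (congrArg Subtype.val he)⟩
    obtain ⟨τ, hτ⟩ := Module.End.exists_eigenvalue ((N : V →ₗ[ℂ] V).restrict hmaps)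
    obtain ⟨p, hp⟩ := hτ.exists_hasEigenvector
    have hp0 : (p : V) ≠ 0 := fun h0 => hp.2 (Subtype.ext h0)
    have hNp : N p = τ • (p : V) := congrArg Subtype.val hp.apply_eq_smul
    have hEp : Complex.exp τ • (p : V) = z • (p : V) :=
      (exp_apply_of_eigenvector hNp).symm.trans ((hS p).1 p.2)
    have hz' : z = Complex.exp τ := (smul_left_injective ℂ hp0 hEp).symm
    have hre := h τ p hp0 hNp
    rw [← NNReal.coe_lt_coe, coe_nnnorm, hz', Complex.norm_exp]
    simpa using hre
  have hrad := spectrum.spectralRadius_lt_of_forall_lt E (r := 1) hspec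
  have hlim := spectrum.pow_nnnorm_pow_one_div_tendsto_nhds_spectralRadius E
  obtain ⟨k, hk, hk1⟩ := ((hlim.eventually_lt_const hrad).and (eventually_ge_atTop 1)).exists
  have hkpos : (0 : ℝ) < k := by exact_mod_cast hk1
  refine ⟨k, hkpos, ?_⟩
  have hflow : expFlow N k = E ^ k := by
    rw [← mul_one (k : ℝ), expFlow_nat_mul]
    simp [expFlow, hE]
  rw [hflow]
  by_contra! hge
  refine absurd hk (not_lt.2 ?_)
  have : (1 : ENNReal) ≤ (‖E ^ k‖₊ : ENNReal) := by exact_mod_cast hge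
  simpa using ENNReal.one_le_rpow this (one_div_pos.2 hkpos)

end Hurwitz

/-! ### Holomorphic dependence of integrals on a parameter -/

section Parametric

variable {α V : Type*} [MeasurableSpace α] {ρ : Measure α}
  [NormedAddCommGroup V] [NormedSpace ℂ V]

/-- An integral of functions that are holomorphic in a parameter and dominated by one integrable
function is holomorphic in that parameter. -/
lemma differentiableOn_integral_of_dominated {F : ℂ → α → V} {U : Set ℂ} (hU : IsOpen U)
    {bound : α → ℝ} (hmeas : ∀ lam ∈ U, AEStronglyMeasurable (F lam) ρ)
    (hdiff : ∀ᵐ a ∂ρ, DifferentiableOn ℂ (fun lam => F lam a) U)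
    (hle : ∀ᵐ a ∂ρ, ∀ lam ∈ U, ‖F lam a‖ ≤ bound a) (hbound : Integrable bound ρ) :
    DifferentiableOn ℂ (fun lam => ∫ a, F lam a ∂ρ) U := by
  intro c hc
  obtain ⟨R, hR, hball⟩ := Metric.isOpen_iff.1 hU c hc
  set r := R / 3 with hr
  have hr0 : 0 < r := by positivity
  have hsub : ∀ z ∈ Metric.ball c r, Metric.closedBall z r ⊆ U := by
    intro z hz w hw
    refine hball ?_
    rw [Metric.mem_ball] at hz ⊢
    rw [Metric.mem_closedBall] at hw
    calc dist w c ≤ dist w z + dist z c := dist_triangle _ _ _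
      _ < R := by linarith
  -- the derivative is measurable as a limit of difference quotients along a sequence
  have hmeas' : AEStronglyMeasurable (fun a => deriv (fun lam => F lam a) c) ρ := by
    have hpos : ∀ m : ℕ, (0 : ℝ) < r / (m + 2) := fun m => by positivity
    have hlt : ∀ m : ℕ, r / ((m : ℝ) + 2) < R := by
      intro m
      rw [div_lt_iff₀ (by positivity)]
      nlinarith [(Nat.cast_nonneg m : (0 : ℝ) ≤ m)]
    let h : ℕ → ℂ := fun m => ((r / (m + 2) : ℝ) : ℂ)
    have hh : Tendsto h atTop (𝓝[≠] 0) := by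
      refine tendsto_nhdsWithin_iff.2 ⟨?_, Eventually.of_forall fun m => ?_⟩
      · have h0 : Tendsto (fun m : ℕ => r / ((m : ℝ) + 2)) atTop (𝓝 0) :=
          tendsto_const_nhds.div_atTop
            (tendsto_natCast_atTop_atTop.atTop_add tendsto_const_nhds)
        have := (Complex.continuous_ofReal.tendsto 0).comp h0
        simpa using! this
      · exact Complex.ofReal_ne_zero.2 (hpos m).ne'
    refine aestronglyMeasurable_of_tendsto_ae atTop
      (f := fun (m : ℕ) a => (h m)⁻¹ • (F (c + h m) a - F c a)) (fun m => ?_) ?_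
    · refine ((hmeas _ (hball ?_)).sub (hmeas c hc)).const_smul _
      simp only [h, Metric.mem_ball, dist_self_add_left, Complex.norm_real, Real.norm_eq_abs,
        abs_of_pos (hpos m)]
      exact hlt m
    · filter_upwards [hdiff] with a ha
      have := ((ha.differentiableAt (hU.mem_nhds hc)).hasDerivAt)
      exact (hasDerivAt_iff_tendsto_slope_zero.1 this).comp hh
  have key := hasDerivAt_integral_of_dominated_loc_of_deriv_le (μ := ρ) (F := F) (x₀ := c)
    (bound := fun a => bound a / r) (F' := fun lam a => deriv (fun l => F l a) lam)
    (Metric.ball_mem_nhds c hr0)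
    (by filter_upwards [hU.mem_nhds hc] with z hz using hmeas z hz)
    (hbound.mono' (hmeas c hc) (by filter_upwards [hle] with a ha using ha c hc)) hmeas'
    (by
      filter_upwards [hle, hdiff] with a ha hd z hz
      refine Complex.norm_deriv_le_of_forall_mem_sphere_norm_le hr0 ?_ fun w hw =>
        ha w (hsub z hz (Metric.sphere_subset_closedBall hw))
      refine (hd.mono ?_).diffContOnCl
      rw [closure_ball z hr0.ne']
      exact hsub z hz)
    (hbound.div_const r)
    (by
      filter_upwards [hdiff] with a hd z hz
      exact (hd.differentiableAt
        (hU.mem_nhds (hsub z hz (Metric.mem_closedBall_self hr0.le)))).hasDerivAt)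
  exact key.2.differentiableAt.differentiableWithinAt

end Parametric

/-! ### Volterra equations on left half-lines -/

section Tail

variable {V : Type*} [NormedAddCommGroup V]

lemma integrableOn_Iic_of_continuous {k : ℝ → V} (hk : Continuous k) {x₀ : ℝ}
    (h : IntegrableOn k (Iic x₀)) (x : ℝ) : IntegrableOn k (Iic x) := by
  rcases le_total x x₀ with hx | hx
  · exact h.mono_set (Iic_subset_Iic.2 hx)
  · rw [← Iic_union_Icc_eq_Iic hx]
    exact h.union (hk.continuousOn.integrableOn_Icc)

variable [NormedSpace ℝ V]

lemma hasDerivAt_integral_Iic [CompleteSpace V] {k : ℝ → V} (hk : Continuous k)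
    (h : ∀ x, IntegrableOn k (Iic x)) (x : ℝ) :
    HasDerivAt (fun y => ∫ t in Iic y, k t) (k x) x := by
  have h1 : (fun y => ∫ t in Iic y, k t) = fun y => (∫ t in Iic x, k t) + ∫ t in x..y, k t := by
    funext y
    rw [← intervalIntegral.integral_Iic_sub_Iic (h x) (h y)]
    abel
  rw [h1]
  exact (intervalIntegral.integral_hasDerivAt_right (hk.intervalIntegrable _ _)
    (hk.stronglyMeasurableAtFilter _ _) hk.continuousAt).const_add _

lemma tendsto_integral_Iic_atBot {k : ℝ → V} {x₀ : ℝ} (h : IntegrableOn k (Iic x₀)) :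
    Tendsto (fun y => ∫ t in Iic y, k t) atBot (𝓝 0) := by
  have h1 := intervalIntegral_tendsto_integral_Iic x₀ h tendsto_id
  have h2 := (tendsto_const_nhds (x := ∫ t in Iic x₀, k t)).sub h1
  rw [sub_self] at h2
  refine h2.congr' ?_
  filter_upwards [eventually_le_atBot x₀] with y hy
  rw [id, ← intervalIntegral.integral_Iic_sub_Iic (h.mono_set (Iic_subset_Iic.2 hy)) h]
  exact sub_sub_cancel _ _

/-- The weight `exp (2C ∫_{-∞}^x g)`, for which a Volterra operator with kernel of size `C g(t)`
has norm at most `1/2`. -/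
noncomputable def weight (C : ℝ) (g : ℝ → ℝ) (x : ℝ) : ℝ :=
  Real.exp (2 * C * ∫ t in Iic x, g t)

variable {C : ℝ} {g : ℝ → ℝ}

lemma weight_pos (x : ℝ) : 0 < weight C g x := Real.exp_pos _

lemma hasDerivAt_weight (hg : Continuous g) (hi : ∀ x, IntegrableOn g (Iic x)) (x : ℝ) :
    HasDerivAt (weight C g) (2 * (C * g x * weight C g x)) x := by
  have h := ((hasDerivAt_integral_Iic hg hi x).const_mul (2 * C)).exp
  refine h.congr_deriv ?_
  rw [weight]; ring

lemma continuous_weight (hg : Continuous g) (hi : ∀ x, IntegrableOn g (Iic x)) :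
    Continuous (weight C g) :=
  continuous_iff_continuousAt.2 fun x => (hasDerivAt_weight hg hi x).continuousAt

lemma tendsto_weight_atBot (hi : ∀ x, IntegrableOn g (Iic x)) :
    Tendsto (weight C g) atBot (𝓝 1) := by
  have h := ((tendsto_integral_Iic_atBot (hi 0)).const_mul (2 * C)).rexp
  simpa [weight] using! h

lemma weight_mono (hC : 0 ≤ C) (hg0 : ∀ t, 0 ≤ g t) (hi : ∀ x, IntegrableOn g (Iic x)) :
    Monotone (weight C g) := by
  intro x y hxy
  refine Real.exp_le_exp.2 (mul_le_mul_of_nonneg_left ?_ (by positivity))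
  exact setIntegral_mono_set (hi y) (Eventually.of_forall hg0)
    (Iic_subset_Iic.2 hxy).eventuallyLE

lemma integrableOn_mul_weight (hC : 0 ≤ C) (hg : Continuous g) (hg0 : ∀ t, 0 ≤ g t)
    (hi : ∀ x, IntegrableOn g (Iic x)) (x : ℝ) :
    IntegrableOn (fun t => C * g t * weight C g t) (Iic x) := by
  refine Integrable.mono' (((hi x).const_mul C).mul_const (weight C g x))
    ((continuous_const.mul hg).mul (continuous_weight hg hi)).aestronglyMeasurable ?_
  filter_upwards [ae_restrict_mem measurableSet_Iic] with t ht
  have h1 := hg0 t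
  have h2 := weight_pos (C := C) (g := g) t
  rw [Real.norm_of_nonneg (by positivity)]
  have := weight_mono hC hg0 hi ht
  gcongr

lemma integral_mul_weight (hC : 0 ≤ C) (hg : Continuous g) (hg0 : ∀ t, 0 ≤ g t)
    (hi : ∀ x, IntegrableOn g (Iic x)) (x : ℝ) :
    ∫ t in Iic x, C * g t * weight C g t = (weight C g x - 1) / 2 := by
  have h := integral_Iic_of_hasDerivAt_of_tendsto' (a := x) (fun t _ => hasDerivAt_weight hg hi t)
    ((integrableOn_mul_weight hC hg hg0 hi x).const_mul 2) (tendsto_weight_atBot hi)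
  rw [integral_const_mul] at h
  linarith

end Tail

section Volterra

variable {V : Type*} [NormedAddCommGroup V] [NormedSpace ℂ V]

lemma hasDerivAt_real_clm_apply {W : Type*} [NormedAddCommGroup W] [NormedSpace ℂ W]
    {c : ℝ → V →L[ℂ] W} {c' : V →L[ℂ] W} {u : ℝ → V} {u' : V} {x : ℝ}
    (hc : HasDerivAt c c' x) (hu : HasDerivAt u u' x) :
    HasDerivAt (fun y => c y (u y)) (c x u' + c' (u x)) x :=
  ((ContinuousLinearMap.id ℂ (V →L[ℂ] W)).bilinearRestrictScalars ℝ).hasDerivAt_of_bilinear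
    (fun _ => hc) fun _ => hu

/-- The Volterra operator `f ↦ ∫_{-∞}^x e^{(x-t)B} E(t) f(t) dt`. -/
noncomputable def volterra (B : V →L[ℂ] V) (E : ℝ → V →L[ℂ] V) (f : ℝ → V) (x : ℝ) : V :=
  ∫ t in Iic x, expFlow B (x - t) (E t (f t))

/-- The standing bounds on a Volterra operator: the flow `e^{tB}` is bounded by `C` for `t ≥ 0`, and
the continuous family `E` is dominated by a continuous `g` that is integrable at `-∞`. -/
structure VolterraData (B : V →L[ℂ] V) (E : ℝ → V →L[ℂ] V) (C : ℝ) (g : ℝ → ℝ) : Prop where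
  flow_le : ∀ t, 0 ≤ t → ‖expFlow B t‖ ≤ C
  cont_E : Continuous E
  cont_g : Continuous g
  norm_le : ∀ t, ‖E t‖ ≤ g t
  integrable : ∀ x, IntegrableOn g (Iic x)

variable {B : V →L[ℂ] V} {E : ℝ → V →L[ℂ] V} {C : ℝ} {g : ℝ → ℝ}

namespace VolterraData

lemma C_nonneg (h : VolterraData B E C g) : 0 ≤ C := (norm_nonneg _).trans (h.flow_le 0 le_rfl)

lemma g_nonneg (h : VolterraData B E C g) (t : ℝ) : 0 ≤ g t := (norm_nonneg _).trans (h.norm_le t)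

lemma norm_kernel_le (h : VolterraData B E C g) {x t : ℝ} (ht : t ≤ x) (y : V) :
    ‖expFlow B (x - t) (E t y)‖ ≤ C * g t * ‖y‖ := by
  have h1 := h.flow_le (x - t) (by linarith)
  have h2 := h.norm_le t
  have h3 := h.C_nonneg
  calc ‖expFlow B (x - t) (E t y)‖ ≤ ‖expFlow B (x - t)‖ * (‖E t‖ * ‖y‖) :=
        (ContinuousLinearMap.le_opNorm _ _).trans
          (mul_le_mul_of_nonneg_left (ContinuousLinearMap.le_opNorm _ _) (norm_nonneg _))
    _ ≤ C * (g t * ‖y‖) := by gcongr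
    _ = _ := by ring

lemma continuous_kernel [CompleteSpace V] (h : VolterraData B E C g) {f : ℝ → V}
    (hf : Continuous f) (x : ℝ) :
    Continuous fun t => expFlow B (x - t) (E t (f t)) :=
  ((continuous_expFlow B).comp (continuous_const.sub continuous_id)).clm_apply
    (h.cont_E.clm_apply hf)

lemma integrableOn_kernel [CompleteSpace V] (h : VolterraData B E C g) {f : ℝ → V}
    (hf : Continuous f) {x b : ℝ}
    (hb : ∀ t ≤ x, ‖f t‖ ≤ b) :
    IntegrableOn (fun t => expFlow B (x - t) (E t (f t))) (Iic x) := by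
  refine Integrable.mono' (((h.integrable x).const_mul C).mul_const b)
    (h.continuous_kernel hf x).aestronglyMeasurable ?_
  filter_upwards [ae_restrict_mem measurableSet_Iic] with t ht
  have h1 := h.g_nonneg t
  have h3 := h.C_nonneg
  exact (h.norm_kernel_le ht _).trans (by have := hb t ht; gcongr)

/-- The weighted bound that makes the Volterra operator a contraction by `1/2`. -/
lemma norm_volterra_le (h : VolterraData B E C g) {f : ℝ → V} {x b : ℝ}
    (hb : ∀ t ≤ x, ‖f t‖ ≤ b * weight C g t) :
    ‖volterra B E f x‖ ≤ b * ((weight C g x - 1) / 2) := by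
  rw [← integral_mul_weight h.C_nonneg h.cont_g h.g_nonneg h.integrable x, ← integral_const_mul]
  refine norm_integral_le_of_norm_le
    ((integrableOn_mul_weight h.C_nonneg h.cont_g h.g_nonneg h.integrable x).const_mul b) ?_
  filter_upwards [ae_restrict_mem measurableSet_Iic] with t ht
  have h1 := h.g_nonneg t
  have h3 := h.C_nonneg
  calc _ ≤ C * g t * ‖f t‖ := h.norm_kernel_le ht _
    _ ≤ C * g t * (b * weight C g t) := by have := hb t ht; gcongr
    _ = _ := by ring

lemma hasDerivAt_volterra [CompleteSpace V] (h : VolterraData B E C g) {f : ℝ → V}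
    (hf : Continuous f) (hb : ∀ x, ∃ b, ∀ t ≤ x, ‖f t‖ ≤ b) (x : ℝ) :
    HasDerivAt (volterra B E f) (B (volterra B E f x) + E x (f x)) x := by
  set k : ℝ → V := fun t => expFlow B (-t) (E t (f t)) with hk
  have hkc : Continuous k :=
    ((continuous_expFlow B).comp continuous_neg).clm_apply (h.cont_E.clm_apply hf)
  have hker : ∀ y t, expFlow B (y - t) (E t (f t)) = expFlow B y (k t) := by
    intro y t
    rw [expFlow_sub, mul_apply_eq_comp]
  have hki : ∀ y, IntegrableOn k (Iic y) := by
    intro y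
    obtain ⟨b, hb⟩ := hb y
    have := (expFlow B (-y)).integrable_comp (h.integrableOn_kernel hf hb)
    refine this.congr (Eventually.of_forall fun t => ?_)
    simp only [hker]
    rw [← mul_apply_eq_comp, ← expFlow_add, neg_add_cancel, expFlow_zero, one_apply_eq_self]
  have hfac : volterra B E f = fun y => expFlow B y (∫ t in Iic y, k t) := by
    funext y
    rw [volterra, ← ContinuousLinearMap.integral_comp_comm _ (hki y)]
    simp only [hker]
  have hd := hasDerivAt_real_clm_apply (hasDerivAt_expFlow B x) (hasDerivAt_integral_Iic hkc hki x)
  rw [hfac]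
  refine hd.congr_deriv ?_
  have : expFlow B x (k x) = E x (f x) := by rw [← hker, sub_self, expFlow_zero, one_apply_eq_self]
  rw [this, mul_apply_eq_comp, add_comm]

lemma one_le_weight (h : VolterraData B E C g) (t : ℝ) : 1 ≤ weight C g t :=
  (weight_mono h.C_nonneg h.g_nonneg h.integrable).le_of_tendsto
    (tendsto_weight_atBot h.integrable) t

/-- A solution of `r' = (B + E) r` that tends to `0` at `-∞` is a fixed point of the Volterra
operator, hence vanishes. -/
lemma eq_zero_of_tendsto [CompleteSpace V] (h : VolterraData B E C g) {r : ℝ → V}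
    (hr : ∀ x, HasDerivAt r (B (r x) + E x (r x)) x) (hlim : Tendsto r atBot (𝓝 0)) : r = 0 := by
  have hrc : Continuous r := continuous_iff_continuousAt.2 fun x => (hr x).continuousAt
  have hbdd : ∀ x, ∃ b, 0 ≤ b ∧ ∀ t ≤ x, ‖r t‖ ≤ b := by
    intro x
    have hev : ∀ᶠ t in atBot, ‖r t‖ < 1 := by
      have := hlim.norm
      rw [norm_zero] at this
      exact this.eventually_lt_const one_pos
    obtain ⟨a, ha⟩ := eventually_atBot.1 hev
    obtain ⟨b, hb⟩ := (isCompact_Icc (a := a) (b := x)).exists_bound_of_continuousOn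
      hrc.continuousOn
    refine ⟨max 1 b, le_max_of_le_left zero_le_one, fun t ht => ?_⟩
    rcases le_total t a with hta | hta
    · exact (ha t hta).le.trans (le_max_left _ _)
    · exact (hb t ⟨hta, ht⟩).trans (le_max_right _ _)
  have hfix : ∀ x, r x = volterra B E r x := by
    intro x
    obtain ⟨b, -, hb⟩ := hbdd x
    set k : ℝ → V := fun t => expFlow B (-t) (E t (r t)) with hk
    have hker : ∀ t, expFlow B (x - t) (E t (r t)) = expFlow B x (k t) := by
      intro t
      rw [expFlow_sub, mul_apply_eq_comp]
    have hki : IntegrableOn k (Iic x) := by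
      have := (expFlow B (-x)).integrable_comp (h.integrableOn_kernel hrc hb)
      refine this.congr (Eventually.of_forall fun t => ?_)
      simp only [hker]
      rw [← mul_apply_eq_comp, ← expFlow_add, neg_add_cancel, expFlow_zero, one_apply_eq_self]
    have hder : ∀ t, HasDerivAt (fun s => expFlow B (-s) (r s)) (k t) t := by
      intro t
      have h1 : HasDerivAt (fun s => expFlow B (-s)) (-(B * expFlow B (-t))) t := by
        have := (hasDerivAt_expFlow B (-t)).scomp t (hasDerivAt_neg t)
        simpa using! this
      refine (hasDerivAt_real_clm_apply h1 (hr t)).congr_deriv ?_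
      rw [map_add, (commute_expFlow B (-t)).eq]
      simp [hk]
    have hl : Tendsto (fun s => expFlow B (-s) (r s)) atBot (𝓝 0) := by
      have h2 : Tendsto (fun s => C * ‖r s‖) atBot (𝓝 0) := by
        simpa using hlim.norm.const_mul C
      refine squeeze_zero_norm' ?_ h2
      filter_upwards [eventually_le_atBot 0] with s hs
      refine (ContinuousLinearMap.le_opNorm _ _).trans ?_
      exact mul_le_mul_of_nonneg_right (h.flow_le _ (by linarith)) (norm_nonneg _)
    have hint := integral_Iic_of_hasDerivAt_of_tendsto' (a := x) (fun t _ => hder t) hki hl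
    rw [volterra]
    simp only [hker]
    rw [ContinuousLinearMap.integral_comp_comm _ hki, hint, sub_zero, ← mul_apply_eq_comp,
      expFlow_mul_neg, one_apply_eq_self]
  funext x
  obtain ⟨b, hb0, hb⟩ := hbdd x
  have hiter : ∀ k : ℕ, ∀ t ≤ x, ‖r t‖ ≤ b * (1 / 2) ^ k * weight C g t := by
    intro k
    induction k with
    | zero =>
      intro t ht
      have := h.one_le_weight t
      have := hb t ht
      simp only [pow_zero, mul_one]
      nlinarith
    | succ k ih =>
      intro t ht
      rw [hfix t]
      refine (h.norm_volterra_le fun s hs => ih s (hs.trans ht)).trans ?_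
      have h0 : 0 ≤ b * (1 / 2) ^ k := by positivity
      rw [pow_succ]
      nlinarith
  have hz : Tendsto (fun k : ℕ => b * (1 / 2 : ℝ) ^ k * weight C g x) atTop (𝓝 0) := by
    have := (tendsto_pow_atTop_nhds_zero_of_lt_one (r := (1 / 2 : ℝ)) (by norm_num)
      (by norm_num)).const_mul b |>.mul_const (weight C g x)
    simpa using this
  have := ge_of_tendsto' hz fun k => hiter k x le_rfl
  simpa using this

end VolterraData

end Volterra

/-! ### Neumann series -/

section Neumann

variable {V : Type*} [NormedAddCommGroup V] [NormedSpace ℂ V]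

/-- The terms of the Neumann series that solves `u = v + volterra B E u`. -/
noncomputable def neumannTerm (B : V →L[ℂ] V) (E : ℝ → V →L[ℂ] V) (v : V) : ℕ → ℝ → V
  | 0 => fun _ => v
  | k + 1 => volterra B E (neumannTerm B E v k)

/-- The sum of the Neumann series, that is, the bounded solution at `-∞` of
`u = v + volterra B E u`. -/
noncomputable def volterraSol (B : V →L[ℂ] V) (E : ℝ → V →L[ℂ] V) (v : V) (x : ℝ) : V :=
  ∑' k, neumannTerm B E v k x

variable {B : V →L[ℂ] V} {E : ℝ → V →L[ℂ] V} {C : ℝ} {g : ℝ → ℝ}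

namespace VolterraData

lemma norm_neumannTerm_le (h : VolterraData B E C g) (v : V) (k : ℕ) (x : ℝ) :
    ‖neumannTerm B E v k x‖ ≤ ‖v‖ * (1 / 2) ^ k * weight C g x := by
  induction k generalizing x with
  | zero =>
    have := h.one_le_weight x
    simp only [neumannTerm, pow_zero, mul_one]
    exact le_mul_of_one_le_right (norm_nonneg _) this
  | succ k ih =>
    refine (h.norm_volterra_le fun t _ => ih t).trans ?_
    have h0 : 0 ≤ ‖v‖ * (1 / 2) ^ k := by positivity
    rw [pow_succ]
    nlinarith

lemma exists_bound_Iic (h : VolterraData B E C g) {f : ℝ → V} {b : ℝ} (hb0 : 0 ≤ b)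
    (hb : ∀ t, ‖f t‖ ≤ b * weight C g t) (x : ℝ) : ∃ b', ∀ t ≤ x, ‖f t‖ ≤ b' :=
  ⟨b * weight C g x, fun t ht => (hb t).trans
    (mul_le_mul_of_nonneg_left (weight_mono h.C_nonneg h.g_nonneg h.integrable ht) hb0)⟩

lemma continuous_neumannTerm [CompleteSpace V] (h : VolterraData B E C g) (v : V) (k : ℕ) :
    Continuous (neumannTerm B E v k) := by
  induction k with
  | zero => exact continuous_const
  | succ k ih =>
    exact continuous_iff_continuousAt.2 fun x => (h.hasDerivAt_volterra ih
      (h.exists_bound_Iic (by positivity) (h.norm_neumannTerm_le v k)) x).continuousAt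

lemma summable_bound (c : ℝ) (w : ℝ) : Summable fun k : ℕ => c * (1 / 2 : ℝ) ^ k * w :=
  (summable_geometric_two.mul_left c).mul_right w

lemma tsum_bound (c : ℝ) (w : ℝ) : ∑' k : ℕ, c * (1 / 2 : ℝ) ^ k * w = 2 * c * w := by
  rw [tsum_mul_right, tsum_mul_left, tsum_geometric_two]; ring

lemma hasSum_neumannTerm [CompleteSpace V] (h : VolterraData B E C g) (v : V) (x : ℝ) :
    HasSum (fun k => neumannTerm B E v k x) (volterraSol B E v x) :=
  (Summable.of_norm_bounded (summable_bound _ _) fun k => h.norm_neumannTerm_le v k x).hasSum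

lemma norm_volterraSol_le (h : VolterraData B E C g) (v : V) (x : ℝ) :
    ‖volterraSol B E v x‖ ≤ 2 * ‖v‖ * weight C g x := by
  rw [← tsum_bound]
  exact tsum_of_norm_bounded (summable_bound _ _).hasSum fun k => h.norm_neumannTerm_le v k x

lemma continuous_volterraSol [CompleteSpace V] (h : VolterraData B E C g) (v : V) :
    Continuous (volterraSol B E v) := by
  refine continuous_iff_continuousAt.2 fun x => ?_
  have hon : ContinuousOn (volterraSol B E v) (Iic (x + 1)) := by
    refine continuousOn_tsum (fun k => (h.continuous_neumannTerm v k).continuousOn)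
      (summable_bound ‖v‖ (weight C g (x + 1))) fun k t ht => ?_
    refine (h.norm_neumannTerm_le v k t).trans ?_
    have := weight_mono h.C_nonneg h.g_nonneg h.integrable ht
    gcongr
  exact hon.continuousAt (Iic_mem_nhds (by linarith))

lemma volterraSol_eq [CompleteSpace V] (h : VolterraData B E C g) (v : V) (x : ℝ) :
    volterraSol B E v x = v + volterra B E (volterraSol B E v) x := by
  have hs : HasSum (fun k => neumannTerm B E v (k + 1) x)
      (volterra B E (volterraSol B E v) x) := by
    refine hasSum_integral_of_dominated_convergence
      (fun k t => ‖v‖ * (1 / 2) ^ k * (C * g t * weight C g t)) (fun k => ?_) (fun k => ?_)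
      (Eventually.of_forall fun t => summable_bound _ _) ?_ (Eventually.of_forall fun t => ?_)
    · exact (h.continuous_kernel (h.continuous_neumannTerm v k) x).aestronglyMeasurable
    · filter_upwards [ae_restrict_mem measurableSet_Iic] with t ht
      have h1 := h.g_nonneg t
      have h3 := h.C_nonneg
      have := h.norm_neumannTerm_le v k t
      calc _ ≤ C * g t * ‖neumannTerm B E v k t‖ := h.norm_kernel_le ht _
        _ ≤ C * g t * (‖v‖ * (1 / 2) ^ k * weight C g t) := by gcongr
        _ = _ := by ring
    · simp_rw [tsum_bound]
      exact (integrableOn_mul_weight h.C_nonneg h.cont_g h.g_nonneg h.integrable x).const_mul _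
    · exact ((h.hasSum_neumannTerm v t).mapL (E t)).mapL (expFlow B (x - t))
  have h0 := (h.hasSum_neumannTerm v x).summable.tsum_eq_zero_add
  rw [hs.tsum_eq] at h0
  exact h0

/-- If `v` is in the kernel of `B`, then the solution of the Volterra equation solves
`u' = (B + E) u`. -/
lemma hasDerivAt_volterraSol [CompleteSpace V] (h : VolterraData B E C g) {v : V} (hv : B v = 0)
    (x : ℝ) : HasDerivAt (volterraSol B E v)
      (B (volterraSol B E v x) + E x (volterraSol B E v x)) x := by
  have hd := (h.hasDerivAt_volterra (h.continuous_volterraSol v)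
    (h.exists_bound_Iic (by positivity) (h.norm_volterraSol_le v)) x).const_add v
  have heq : (fun y => v + volterra B E (volterraSol B E v) y) = volterraSol B E v :=
    funext fun y => (h.volterraSol_eq v y).symm
  rw [heq] at hd
  refine hd.congr_deriv ?_
  conv_rhs => rw [h.volterraSol_eq v x]
  rw [map_add B, hv, zero_add, ← h.volterraSol_eq v x]

lemma tendsto_volterraSol [CompleteSpace V] (h : VolterraData B E C g) (v : V) :
    Tendsto (volterraSol B E v) atBot (𝓝 v) := by
  rw [tendsto_iff_norm_sub_tendsto_zero]
  have hb : Tendsto (fun x => 2 * ‖v‖ * ((weight C g x - 1) / 2)) atBot (𝓝 0) := by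
    have := (((tendsto_weight_atBot (C := C) h.integrable).sub_const 1).div_const 2).const_mul
      (2 * ‖v‖)
    simpa using this
  refine squeeze_zero (fun _ => norm_nonneg _) (fun x => ?_) hb
  rw [h.volterraSol_eq v x, add_sub_cancel_left]
  exact h.norm_volterra_le fun t _ => h.norm_volterraSol_le v t

end VolterraData

variable [CompleteSpace V] {U : Set ℂ} {B : ℂ → V →L[ℂ] V} {E : ℝ → ℂ → V →L[ℂ] V} {v : ℂ → V}
  {b : ℝ}

lemma differentiableOn_neumannTerm (hU : IsOpen U)
    (h : ∀ lam ∈ U, VolterraData (B lam) (fun t => E t lam) C g)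
    (hB : DifferentiableOn ℂ B U) (hE : ∀ t, DifferentiableOn ℂ (E t) U)
    (hv : DifferentiableOn ℂ v U) (hb : ∀ lam ∈ U, ‖v lam‖ ≤ b) (k : ℕ) (x : ℝ) :
    DifferentiableOn ℂ (fun lam => neumannTerm (B lam) (fun t => E t lam) (v lam) k x) U := by
  induction k generalizing x with
  | zero => exact hv
  | succ k ih =>
    rcases U.eq_empty_or_nonempty with rfl | ⟨c, hc⟩
    · exact differentiableOn_empty
    have hdat := h c hc
    refine differentiableOn_integral_of_dominated hU
      (bound := fun t => b * (1 / 2) ^ k * (C * g t * weight C g t)) (fun lam hlam => ?_)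
      (Eventually.of_forall fun t => ?_) ?_ ?_
    · exact ((h lam hlam).continuous_kernel
        ((h lam hlam).continuous_neumannTerm _ k) x).aestronglyMeasurable
    · exact (differentiableOn_expFlow hB (x - t)).clm_apply ((hE t).clm_apply (ih t))
    · filter_upwards [ae_restrict_mem measurableSet_Iic] with t ht lam hlam
      have h1 := hdat.g_nonneg t
      have h3 := hdat.C_nonneg
      have h4 := (h lam hlam).norm_neumannTerm_le (v lam) k t
      have h5 := hb lam hlam
      have h6 := weight_pos (C := C) (g := g) t
      calc _ ≤ C * g t * ‖neumannTerm (B lam) (fun t => E t lam) (v lam) k t‖ :=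
            (h lam hlam).norm_kernel_le ht _
        _ ≤ C * g t * (b * (1 / 2) ^ k * weight C g t) := by
            refine mul_le_mul_of_nonneg_left (h4.trans ?_) (by positivity)
            gcongr
        _ = _ := by ring
    · exact (integrableOn_mul_weight hdat.C_nonneg hdat.cont_g hdat.g_nonneg
        hdat.integrable x).const_mul _

lemma differentiableOn_volterraSol (hU : IsOpen U)
    (h : ∀ lam ∈ U, VolterraData (B lam) (fun t => E t lam) C g)
    (hB : DifferentiableOn ℂ B U) (hE : ∀ t, DifferentiableOn ℂ (E t) U)
    (hv : DifferentiableOn ℂ v U) (hb : ∀ lam ∈ U, ‖v lam‖ ≤ b) (x : ℝ) :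
    DifferentiableOn ℂ (fun lam => volterraSol (B lam) (fun t => E t lam) (v lam) x) U := by
  refine Complex.differentiableOn_tsum_of_summable_norm
    (VolterraData.summable_bound b (weight C g x))
    (fun k => differentiableOn_neumannTerm hU h hB hE hv hb k x) hU fun k lam hlam => ?_
  refine ((h lam hlam).norm_neumannTerm_le (v lam) k x).trans ?_
  have h5 := hb lam hlam
  have h6 := weight_pos (C := C) (g := g) x
  gcongr

end Neumann

/-! ### Dominating a holomorphic family by one integrable function -/

section Domination

variable {W : Type*} [NormedAddCommGroup W] [NormedSpace ℂ W] [CompleteSpace W]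

/-- By Cauchy's formula, on the concentric disc of half the radius a holomorphic function is bounded
by twice its mean absolute value on the boundary circle. -/
lemma norm_le_integral_circle {f : ℂ → W} {c w : ℂ} {R : ℝ} (hR : 0 < R)
    (hf : DifferentiableOn ℂ f (Metric.closedBall c R)) (hw : w ∈ Metric.ball c (R / 2)) :
    ‖f w‖ ≤ Real.pi⁻¹ * ∫ θ in (0 : ℝ)..2 * Real.pi, ‖f (circleMap c R θ)‖ := by
  have hwR : w ∈ Metric.ball c R := Metric.ball_subset_ball (by linarith) hw
  have hcauchy :=
    Complex.two_pi_I_inv_smul_circleIntegral_sub_inv_smul_of_differentiable_on_off_countable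
      countable_empty hwR hf.continuousOn fun x hx => hf.differentiableAt
        (mem_of_superset (Metric.isOpen_ball.mem_nhds hx.1) Metric.ball_subset_closedBall)
  have hcont : Continuous fun θ : ℝ => f (circleMap c R θ) :=
    hf.continuousOn.comp_continuous (continuous_circleMap c R)
      fun θ => circleMap_mem_closedBall c hR.le θ
  have hint : ‖∮ z in C(c, R), (z - w)⁻¹ • f z‖
      ≤ ∫ θ in (0 : ℝ)..2 * Real.pi, 2 * ‖f (circleMap c R θ)‖ := by
    refine intervalIntegral.norm_integral_le_of_norm_le (by positivity)
      (Eventually.of_forall fun θ _ => ?_) ((hcont.norm.const_mul 2).intervalIntegrable _ _)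
    have hdist : R / 2 ≤ ‖circleMap c R θ - w‖ := by
      have h1 : ‖circleMap c R θ - c‖ = R := by simp [abs_of_pos hR]
      have h2 : ‖w - c‖ < R / 2 := by simpa [dist_eq_norm] using hw
      have h3 : ‖circleMap c R θ - c‖ ≤ ‖circleMap c R θ - w‖ + ‖w - c‖ := by
        simpa using norm_add_le (circleMap c R θ - w) (w - c)
      linarith
    rw [norm_smul, norm_smul, norm_inv, deriv_circleMap, norm_mul, Complex.norm_I, mul_one,
      ← mul_assoc]
    refine mul_le_mul_of_nonneg_right ?_ (norm_nonneg _)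
    rw [norm_circleMap_zero, abs_of_pos hR, ← div_eq_mul_inv, div_le_iff₀ (by linarith)]
    linarith
  rw [← hcauchy, norm_smul]
  have hpi : ‖(2 * (Real.pi : ℂ) * Complex.I)⁻¹‖ = (2 * Real.pi)⁻¹ := by
    simp [abs_of_pos Real.pi_pos]
  rw [hpi]
  calc _ ≤ (2 * Real.pi)⁻¹ * ∫ θ in (0 : ℝ)..2 * Real.pi, 2 * ‖f (circleMap c R θ)‖ := by gcongr
    _ = _ := by rw [intervalIntegral.integral_const_mul]; field_simp

/-- If the `L¹` norms on `(-∞, 0]` of a holomorphic family are bounded on compact sets of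
parameters, then the family is locally dominated by one continuous function that is integrable on
left half-lines: the circle mean of the norms, by Fubini. -/
lemma exists_dominating {Ω : Set ℂ} (hΩ : IsOpen Ω) {f : ℝ → ℂ → W}
    (hcont : ContinuousOn (fun p : ℝ × ℂ => f p.1 p.2) (univ ×ˢ Ω))
    (hdiff : ∀ t, DifferentiableOn ℂ (f t) Ω)
    (hint : ∀ lam ∈ Ω, IntegrableOn (fun t => f t lam) (Iic 0))
    (hbdd : ∀ K ⊆ Ω, IsCompact K → ∃ M, ∀ lam ∈ K, ∫ t in Iic (0 : ℝ), ‖f t lam‖ ≤ M)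
    {c : ℂ} (hc : c ∈ Ω) :
    ∃ r > 0, Metric.ball c r ⊆ Ω ∧ ∃ g : ℝ → ℝ, Continuous g ∧
      (∀ x, IntegrableOn g (Iic x)) ∧ ∀ t, ∀ lam ∈ Metric.ball c r, ‖f t lam‖ ≤ g t := by
  obtain ⟨R, hR, hsub⟩ := Metric.nhds_basis_closedBall.mem_iff.1 (hΩ.mem_nhds hc)
  have hmem : ∀ θ : ℝ, circleMap c R θ ∈ Ω := fun θ => hsub (circleMap_mem_closedBall c hR.le θ)
  let F : ℝ × ℝ → ℝ := fun p => ‖f p.1 (circleMap c R p.2)‖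
  have hF : Continuous F :=
    (hcont.comp_continuous (continuous_fst.prodMk ((continuous_circleMap c R).comp continuous_snd))
      fun p => ⟨mem_univ _, hmem p.2⟩).norm
  let g : ℝ → ℝ := fun t => Real.pi⁻¹ * ∫ θ in (0 : ℝ)..2 * Real.pi, F (t, θ)
  have hg : Continuous g := continuous_const.mul
    (intervalIntegral.continuous_parametric_intervalIntegral_of_continuous'
      (f := fun t θ => F (t, θ)) hF 0 (2 * Real.pi))
  have hFint : Integrable F ((volume.restrict (Iic (0 : ℝ))).prod
      (volume.restrict (Ioc 0 (2 * Real.pi)))) := by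
    rw [integrable_prod_iff' hF.aestronglyMeasurable]
    refine ⟨Eventually.of_forall fun θ => (hint _ (hmem θ)).norm, ?_⟩
    obtain ⟨M, hM⟩ := hbdd _ hsub (isCompact_closedBall c R)
    refine Integrable.mono' (integrable_const M) ?_ (Eventually.of_forall fun θ => ?_)
    · exact (hF.norm.stronglyMeasurable.integral_prod_left'
        (μ := volume.restrict (Iic (0 : ℝ)))).aestronglyMeasurable
    · rw [Real.norm_of_nonneg (integral_nonneg fun _ => norm_nonneg _)]
      simpa [F] using hM _ (circleMap_mem_closedBall c hR.le θ)
  have hgint : IntegrableOn g (Iic 0) := by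
    have h1 := hFint.integral_prod_left.const_mul Real.pi⁻¹
    refine h1.congr (Eventually.of_forall fun t => ?_)
    simp only [g]
    rw [intervalIntegral.integral_of_le (by positivity)]
  refine ⟨R / 2, by positivity,
    ((Metric.ball_subset_ball (by linarith)).trans Metric.ball_subset_closedBall).trans hsub,
    g, hg, integrableOn_Iic_of_continuous hg hgint, fun t lam hlam => ?_⟩
  exact norm_le_integral_circle hR ((hdiff t).mono hsub) hlam

end Domination

/-! ### The solutions selected at the left end -/

section LeftEnd

variable {V : Type*} [NormedAddCommGroup V] [NormedSpace ℂ V]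

/-- The operator form, at the end `x = -∞` only, of the hypotheses on a system `y' = a(x;λ) y`: the
limit `aₘ(λ)` has the eigenvector `v(λ)` for `μ(λ)`, and `e^{t(aₘ - μ)}` is bounded for `t ≥ 0`,
locally uniformly in `λ`. -/
structure LeftEnd (Ω : Set ℂ) (a : ℝ → ℂ → V →L[ℂ] V) (am : ℂ → V →L[ℂ] V) (μ : ℂ → ℂ)
    (v : ℂ → V) : Prop where
  isOpen : IsOpen Ω
  cont : ContinuousOn (fun p : ℝ × ℂ => a p.1 p.2) (univ ×ˢ Ω)
  diff : ∀ x, DifferentiableOn ℂ (a x) Ω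
  lim : TendstoLocallyUniformlyOn a am atBot Ω
  integrable : ∀ lam ∈ Ω, IntegrableOn (fun x => a x lam - am lam) (Iic 0)
  bounded : ∀ K ⊆ Ω, IsCompact K → ∃ M, ∀ lam ∈ K, ∫ x in Iic (0 : ℝ), ‖a x lam - am lam‖ ≤ M
  diff_mu : DifferentiableOn ℂ μ Ω
  diff_v : DifferentiableOn ℂ v Ω
  eigen : ∀ lam ∈ Ω, am lam (v lam) = μ lam • v lam
  flow : ∀ c ∈ Ω, ∃ C, ∀ᶠ lam in 𝓝 c, ∀ t, 0 ≤ t → ‖expFlow (am lam - μ lam • 1) t‖ ≤ C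

/-- `y` solves `y' = a(x;λ) y` on `ℝ` and `e^{-μ(λ) x} y(x) → v(λ)` as `x → -∞`. -/
def IsLeftSol (a : ℝ → ℂ → V →L[ℂ] V) (μ : ℂ → ℂ) (v : ℂ → V) (lam : ℂ) (y : ℝ → V) : Prop :=
  (∀ x : ℝ, HasDerivAt y (a x lam (y x)) x) ∧
    Tendsto (fun x : ℝ => Complex.exp (-(μ lam * x)) • y x) atBot (𝓝 (v lam))

/-- The solution singled out by `IsLeftSol`, as `e^{μ x}` times the sum of a Neumann series. -/
noncomputable def leftSol (a : ℝ → ℂ → V →L[ℂ] V) (am : ℂ → V →L[ℂ] V) (μ : ℂ → ℂ) (v : ℂ → V)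
    (x : ℝ) (lam : ℂ) : V :=
  Complex.exp (μ lam * x) •
    volterraSol (am lam - μ lam • 1) (fun t => a t lam - am lam) (v lam) x

lemma hasDerivAt_exp_mul (m : ℂ) (x : ℝ) :
    HasDerivAt (fun y : ℝ => Complex.exp (m * y)) (m * Complex.exp (m * x)) x := by
  have h : HasDerivAt (fun z : ℂ => Complex.exp (m * z)) (Complex.exp (m * x) * (m * 1)) (x : ℂ) :=
    ((hasDerivAt_id (x : ℂ)).const_mul m).cexp
  refine h.comp_ofReal.congr_deriv ?_
  ring

lemma norm_exp_mul (m : ℂ) (x : ℝ) : ‖Complex.exp (m * x)‖ = Real.exp (m.re * x) := by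
  simp [Complex.norm_exp]

namespace LeftEnd

variable {Ω : Set ℂ} {a : ℝ → ℂ → V →L[ℂ] V} {am : ℂ → V →L[ℂ] V} {μ : ℂ → ℂ} {v : ℂ → V}

lemma eigen_sub (h : LeftEnd Ω a am μ v) {lam : ℂ} (hlam : lam ∈ Ω) :
    (am lam - μ lam • 1) (v lam) = 0 := by
  simp [h.eigen lam hlam]

variable [CompleteSpace V]

lemma diff_am (h : LeftEnd Ω a am μ v) : DifferentiableOn ℂ am Ω :=
  h.lim.differentiableOn (Eventually.of_forall h.diff) h.isOpen

/-- Near each point of `Ω` the Volterra equations for all parameters share their bounds. -/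
lemma exists_volterraData (h : LeftEnd Ω a am μ v) {c : ℂ} (hc : c ∈ Ω) :
    ∃ r > 0, Metric.ball c r ⊆ Ω ∧ ∃ (C : ℝ) (g : ℝ → ℝ) (b : ℝ), ∀ lam ∈ Metric.ball c r,
      VolterraData (am lam - μ lam • 1) (fun t => a t lam - am lam) C g ∧ ‖v lam‖ ≤ b := by
  have hcont : ContinuousOn (fun p : ℝ × ℂ => a p.1 p.2 - am p.2) (univ ×ˢ Ω) :=
    h.cont.sub (h.diff_am.continuousOn.comp continuousOn_snd fun p hp => hp.2)
  obtain ⟨r₁, hr₁, hsub, g, hg, hgi, hle⟩ := exists_dominating h.isOpen hcont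
    (fun t => (h.diff t).sub h.diff_am) h.integrable h.bounded hc
  obtain ⟨C, hC⟩ := h.flow c hc
  have hv : ∀ᶠ lam in 𝓝 c, ‖v lam‖ < ‖v c‖ + 1 :=
    ((h.diff_v.continuousOn.continuousAt (h.isOpen.mem_nhds hc)).norm).eventually_lt_const
      (by simp)
  obtain ⟨r₂, hr₂, hball⟩ := Metric.eventually_nhds_iff_ball.1 (hC.and hv)
  refine ⟨min r₁ r₂, lt_min hr₁ hr₂, (Metric.ball_subset_ball (min_le_left _ _)).trans hsub, C, g,
    ‖v c‖ + 1, fun lam hlam => ?_⟩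
  have h1 : lam ∈ Metric.ball c r₁ := Metric.ball_subset_ball (min_le_left _ _) hlam
  have h2 := hball lam (Metric.ball_subset_ball (min_le_right _ _) hlam)
  refine ⟨⟨h2.1, ?_, hg, fun t => hle t lam h1, hgi⟩, h2.2.le⟩
  exact hcont.comp_continuous (continuous_id.prodMk continuous_const)
    fun t => ⟨mem_univ _, hsub h1⟩

lemma isLeftSol_leftSol (h : LeftEnd Ω a am μ v) {lam : ℂ} (hlam : lam ∈ Ω) :
    IsLeftSol a μ v lam (fun x => leftSol a am μ v x lam) := by
  obtain ⟨r, hr, -, C, g, b, hdat⟩ := h.exists_volterraData hlam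
  have hd := (hdat lam (Metric.mem_ball_self hr)).1
  refine ⟨fun x => ?_, ?_⟩
  · refine ((hasDerivAt_exp_mul (μ lam) x).smul
      (hd.hasDerivAt_volterraSol (h.eigen_sub hlam) x)).congr_deriv ?_
    simp only [leftSol, sub_apply, smul_apply, one_apply_eq_self, map_smul, mul_smul]
    module
  · refine (hd.tendsto_volterraSol (v lam)).congr fun x => ?_
    simp only [leftSol]
    rw [smul_smul, ← Complex.exp_add, neg_add_cancel, Complex.exp_zero, one_smul]

lemma eq_leftSol (h : LeftEnd Ω a am μ v) {lam : ℂ} (hlam : lam ∈ Ω) {y : ℝ → V}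
    (hy : IsLeftSol a μ v lam y) : y = fun x => leftSol a am μ v x lam := by
  obtain ⟨r, hr, -, C, g, b, hdat⟩ := h.exists_volterraData hlam
  have hd := (hdat lam (Metric.mem_ball_self hr)).1
  have hs := h.isLeftSol_leftSol hlam
  have hzero : (fun x : ℝ => Complex.exp (-μ lam * x) • (y x - leftSol a am μ v x lam)) = 0 := by
    refine hd.eq_zero_of_tendsto (fun x => ?_) ?_
    · refine ((hasDerivAt_exp_mul (-μ lam) x).smul ((hy.1 x).fun_sub (hs.1 x))).congr_deriv ?_
      simp only [sub_apply, smul_apply, one_apply_eq_self, map_smul, mul_smul, map_sub]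
      module
    · have := hy.2.sub hs.2
      rw [sub_self] at this
      refine this.congr fun x => ?_
      rw [neg_mul, smul_sub]
  funext x
  have := congrFun hzero x
  simpa [sub_eq_zero] using this

lemma differentiableOn_leftSol (h : LeftEnd Ω a am μ v) (x : ℝ) :
    DifferentiableOn ℂ (leftSol a am μ v x) Ω := by
  intro c hc
  obtain ⟨r, hr, hsub, C, g, b, hdat⟩ := h.exists_volterraData hc
  have hmu := h.diff_mu.mono hsub
  have hB : DifferentiableOn ℂ (fun lam => am lam - μ lam • (1 : V →L[ℂ] V)) (Metric.ball c r) :=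
    (h.diff_am.mono hsub).sub (hmu.smul_const _)
  have hd := differentiableOn_volterraSol Metric.isOpen_ball (fun lam hlam => (hdat lam hlam).1) hB
    (fun t => ((h.diff t).sub h.diff_am).mono hsub) (h.diff_v.mono hsub)
    (fun lam hlam => (hdat lam hlam).2) x
  exact (((hmu.mul_const _).cexp.smul hd).differentiableAt
    (Metric.ball_mem_nhds c hr)).differentiableWithinAt

lemma exists_norm_leftSol_le (h : LeftEnd Ω a am μ v) {c : ℂ} (hc : c ∈ Ω) :
    ∃ r > 0, Metric.ball c r ⊆ Ω ∧ ∀ X : ℝ, ∃ K, 0 ≤ K ∧ ∀ lam ∈ Metric.ball c r, ∀ x ≤ X,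
      ‖leftSol a am μ v x lam‖ ≤ K * Real.exp ((μ lam).re * x) := by
  obtain ⟨r, hr, hsub, C, g, b, hdat⟩ := h.exists_volterraData hc
  have hb : 0 ≤ b := (norm_nonneg _).trans (hdat c (Metric.mem_ball_self hr)).2
  refine ⟨r, hr, hsub, fun X => ⟨2 * b * weight C g X, ?_, fun lam hlam x hx => ?_⟩⟩
  · have := weight_pos (C := C) (g := g) X
    positivity
  obtain ⟨hd, hvb⟩ := hdat lam hlam
  rw [leftSol, norm_smul, norm_exp_mul, mul_comm]
  refine mul_le_mul_of_nonneg_right ((hd.norm_volterraSol_le _ x).trans ?_) (Real.exp_pos _).le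
  have := weight_mono hd.C_nonneg hd.g_nonneg hd.integrable hx
  have := weight_pos (C := C) (g := g) x
  gcongr

end LeftEnd

end LeftEnd

/-! ### Families of curves depending holomorphically on the spectral parameter -/

section Family

variable {V W : Type*} [NormedAddCommGroup V] [NormedSpace ℂ V] [NormedAddCommGroup W]
  [NormedSpace ℂ W] {Ω : Set ℂ}

/-- By Cauchy's estimate, a bound for holomorphic functions that is uniform for parameters near `c`
passes to their derivatives, with the same dependence `ρ` on `x`. -/
lemma exists_norm_deriv_le (hΩ : IsOpen Ω) {F : ℝ → ℂ → V} (hF : ∀ x, DifferentiableOn ℂ (F x) Ω)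
    {c : ℂ} (hc : c ∈ Ω) {S : Set ℝ} {ρ : ℝ → ℝ}
    (h : ∃ K, ∀ᶠ lam in 𝓝 c, ∀ x ∈ S, ‖F x lam‖ ≤ K * ρ x) :
    ∃ K, ∀ᶠ lam in 𝓝 c, ∀ x ∈ S, ‖deriv (F x) lam‖ ≤ K * ρ x := by
  obtain ⟨K, hK⟩ := h
  obtain ⟨r, hr, hball⟩ := Metric.eventually_nhds_iff_ball.1 (hK.and (hΩ.mem_nhds hc))
  refine ⟨K / (r / 3), ?_⟩
  filter_upwards [Metric.ball_mem_nhds c (by positivity : 0 < r / 3)] with lam hlam x hx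
  have hsub : Metric.closedBall lam (r / 3) ⊆ Metric.ball c r := by
    intro w hw
    rw [Metric.mem_ball] at hlam ⊢
    rw [Metric.mem_closedBall] at hw
    calc dist w c ≤ dist w lam + dist lam c := dist_triangle _ _ _
      _ < r := by linarith
  rw [div_mul_eq_mul_div]
  refine Complex.norm_deriv_le_of_forall_mem_sphere_norm_le (by positivity) ?_ fun w hw =>
    (hball w (hsub (Metric.sphere_subset_closedBall hw))).1 x hx
  refine ((hF x).mono ?_).diffContOnCl
  rw [closure_ball lam (by positivity)]
  exact fun w hw => (hball w (hsub hw)).2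

/-- A family of functions of `x ∈ ℝ` that is holomorphic in `λ ∈ Ω` for each `x` and bounded for
bounded `x`, locally uniformly in `λ`. -/
structure HolFamily (Ω : Set ℂ) (F : ℝ → ℂ → V) : Prop where
  diff : ∀ x, DifferentiableOn ℂ (F x) Ω
  /-- The bound is written `K * 1` to match `exists_norm_deriv_le` with constant `ρ`. -/
  bdd : ∀ c ∈ Ω, ∀ X : ℝ, ∃ K, ∀ᶠ lam in 𝓝 c, ∀ x ∈ Icc (-X) X, ‖F x lam‖ ≤ K * 1

namespace HolFamily

variable {F G : ℝ → ℂ → V}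

lemma deriv [CompleteSpace V] (hΩ : IsOpen Ω) (hF : HolFamily Ω F) :
    HolFamily Ω fun x => deriv (F x) :=
  ⟨fun x => (hF.diff x).deriv hΩ,
    fun c hc X => exists_norm_deriv_le hΩ hF.diff hc (ρ := fun _ => 1) (hF.bdd c hc X)⟩

lemma clm_apply {a : ℝ → ℂ → V →L[ℂ] W} (ha : HolFamily Ω a) (hF : HolFamily Ω F) :
    HolFamily Ω fun x lam => a x lam (F x lam) := by
  refine ⟨fun x => (ha.diff x).clm_apply (hF.diff x), fun c hc X => ?_⟩
  obtain ⟨K₁, h₁⟩ := ha.bdd c hc X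
  obtain ⟨K₂, h₂⟩ := hF.bdd c hc X
  refine ⟨K₁ * K₂, ?_⟩
  filter_upwards [h₁, h₂] with lam h₁ h₂ x hx
  have h3 := h₁ x hx
  have h4 := h₂ x hx
  rw [mul_one] at *
  exact (ContinuousLinearMap.le_opNorm _ _).trans
    (mul_le_mul h3 h4 (norm_nonneg _) ((norm_nonneg _).trans h3))

lemma neg (hF : HolFamily Ω F) : HolFamily Ω fun x lam => -F x lam := by
  refine ⟨fun x => (hF.diff x).fun_neg, fun c hc X => ?_⟩
  simpa using hF.bdd c hc X

lemma comp_neg (hF : HolFamily Ω F) : HolFamily Ω fun x => F (-x) := by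
  refine ⟨fun x => hF.diff (-x), fun c hc X => ?_⟩
  obtain ⟨K, hK⟩ := hF.bdd c hc X
  refine ⟨K, hK.mono fun lam h x hx => h (-x) ⟨?_, ?_⟩⟩
  · linarith [hx.2]
  · linarith [hx.1]

lemma of_continuousOn (hΩ : IsOpen Ω) (hF : ∀ x, DifferentiableOn ℂ (F x) Ω)
    (hcont : ContinuousOn (fun p : ℝ × ℂ => F p.1 p.2) (univ ×ˢ Ω)) : HolFamily Ω F := by
  refine ⟨hF, fun c hc X => ?_⟩
  obtain ⟨R, hR, hsub⟩ := Metric.nhds_basis_closedBall.mem_iff.1 (hΩ.mem_nhds hc)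
  obtain ⟨K, hK⟩ := ((isCompact_Icc (a := -X) (b := X)).prod
    (isCompact_closedBall c R)).exists_bound_of_continuousOn
      (hcont.mono (prod_mono (subset_univ _) hsub))
  refine ⟨K, ?_⟩
  filter_upwards [Metric.closedBall_mem_nhds c hR] with lam hlam x hx
  rw [mul_one]
  exact hK (x, lam) ⟨hx, hlam⟩

/-- Mixed partial derivatives of holomorphic families commute: differentiate Cauchy's formula for
`∂F/∂λ` under the integral sign. -/
lemma hasDerivAt_deriv [CompleteSpace V] (hΩ : IsOpen Ω) (hF : HolFamily Ω F) (hG : HolFamily Ω G)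
    (h : ∀ lam ∈ Ω, ∀ x, HasDerivAt (fun y => F y lam) (G x lam) x) {c : ℂ} (hc : c ∈ Ω) (x : ℝ) :
    HasDerivAt (fun y => _root_.deriv (F y) c) (_root_.deriv (G x) c) x := by
  obtain ⟨K, hK⟩ := hG.bdd c hc (|x| + 1)
  obtain ⟨R, hR, hsub⟩ := Metric.nhds_basis_closedBall.mem_iff.1 (hK.and (hΩ.mem_nhds hc))
  have hsubΩ : Metric.closedBall c R ⊆ Ω := fun z hz => (hsub hz).2
  have hmem : ∀ θ : ℝ, circleMap c R θ ∈ Metric.closedBall c R :=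
    circleMap_mem_closedBall c hR.le
  let k : ℝ → ℂ := fun θ => _root_.deriv (circleMap c R) θ * ((circleMap c R θ - c) ^ 2)⁻¹
  have hcircle : ∀ H : ℝ → ℂ → V, (∀ y, DifferentiableOn ℂ (H y) Ω) → ∀ y, _root_.deriv (H y) c
      = (2 * Real.pi * Complex.I : ℂ)⁻¹ •
        ∫ θ in (0 : ℝ)..2 * Real.pi, k θ • H y (circleMap c R θ) := by
    intro H hH y
    rw [← Complex.two_pi_I_inv_smul_circleIntegral_sub_sq_inv_smul_of_differentiable hΩ hsubΩ (hH y)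
      (Metric.mem_ball_self hR)]
    simp only [circleIntegral, smul_smul, k]
  have hne : ∀ θ, (circleMap c R θ - c) ^ 2 ≠ 0 := fun θ =>
    pow_ne_zero 2 (sub_ne_zero.2 (circleMap_ne_center hR.ne'))
  have hk : Continuous k := by
    have h1 : Continuous (_root_.deriv (circleMap c R)) := by
      have : _root_.deriv (circleMap c R) = fun θ => circleMap 0 R θ * Complex.I :=
        funext fun θ => deriv_circleMap c R θ
      rw [this]
      exact (continuous_circleMap 0 R).mul_const _
    exact h1.mul ((((continuous_circleMap c R).sub continuous_const).pow 2).inv₀ hne)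
  have hcontH : ∀ H : ℝ → ℂ → V, (∀ y, DifferentiableOn ℂ (H y) Ω) → ∀ y,
      Continuous fun θ => k θ • H y (circleMap c R θ) := fun H hH y =>
    hk.smul ((hH y).continuousOn.comp_continuous (continuous_circleMap c R)
      fun θ => hsubΩ (hmem θ))
  have key := intervalIntegral.hasDerivAt_integral_of_dominated_loc_of_deriv_le
    (𝕜 := ℝ) (μ := volume) (a := 0) (b := 2 * Real.pi) (x₀ := x)
    (F := fun y θ => k θ • F y (circleMap c R θ)) (F' := fun y θ => k θ • G y (circleMap c R θ))
    (bound := fun θ => ‖k θ‖ * K) (Ioo_mem_nhds (by linarith : x - 1 < x) (by linarith : x < x + 1))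
    (Eventually.of_forall fun y => (hcontH F hF.diff y).aestronglyMeasurable)
    ((hcontH F hF.diff x).intervalIntegrable _ _) (hcontH G hG.diff x).aestronglyMeasurable
    (Eventually.of_forall fun θ _ y hy => by
      rw [norm_smul]
      refine mul_le_mul_of_nonneg_left ?_ (norm_nonneg _)
      have h1 := (hsub (hmem θ)).1 y ⟨by linarith [hy.1, neg_abs_le x],
        by linarith [hy.2, le_abs_self x]⟩
      rwa [mul_one] at h1)
    ((hk.norm.mul_const K).intervalIntegrable _ _)
    (Eventually.of_forall fun θ _ y _ => (h _ (hsubΩ (hmem θ)) y).const_smul (k θ))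
  rw [funext fun y => hcircle F hF.diff y, hcircle G hG.diff x]
  exact key.2.const_smul _

/-- The `λ`-derivative of a family of solutions of a linear system solves the linearized system. -/
lemma hasDerivAt_deriv_of_linear [CompleteSpace V] (hΩ : IsOpen Ω) {a : ℝ → ℂ → V →L[ℂ] V}
    (ha : HolFamily Ω a) (hF : HolFamily Ω F)
    (h : ∀ lam ∈ Ω, ∀ x, HasDerivAt (fun y => F y lam) (a x lam (F x lam)) x) {c : ℂ} (hc : c ∈ Ω)
    (x : ℝ) : HasDerivAt (fun y => _root_.deriv (F y) c)
      (_root_.deriv (a x) c (F x c) + a x c (_root_.deriv (F x) c)) x := by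
  refine (hasDerivAt_deriv hΩ hF (ha.clm_apply hF) h hc x).congr_deriv ?_
  exact (((ha.diff x).differentiableAt (hΩ.mem_nhds hc)).hasDerivAt.clm_apply
    ((hF.diff x).differentiableAt (hΩ.mem_nhds hc)).hasDerivAt).deriv

/-- The second `λ`-derivative of a family of solutions of a linear system solves the twice
linearized system. -/
lemma hasDerivAt_deriv_deriv_of_linear [CompleteSpace V] (hΩ : IsOpen Ω) {a : ℝ → ℂ → V →L[ℂ] V}
    (ha : HolFamily Ω a) (hF : HolFamily Ω F)
    (h : ∀ lam ∈ Ω, ∀ x, HasDerivAt (fun y => F y lam) (a x lam (F x lam)) x) {c : ℂ} (hc : c ∈ Ω)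
    (x : ℝ) : HasDerivAt (fun y => _root_.deriv (_root_.deriv (F y)) c)
      (_root_.deriv (_root_.deriv (a x)) c (F x c)
        + (2 : ℂ) • _root_.deriv (a x) c (_root_.deriv (F x) c)
        + a x c (_root_.deriv (_root_.deriv (F x)) c)) x := by
  have hF' := hF.deriv hΩ
  have ha' := ha.deriv hΩ
  have hG : HolFamily Ω fun x lam => _root_.deriv (a x) lam (F x lam)
      + a x lam (_root_.deriv (F x) lam) := by
    refine ⟨fun y => ((ha'.diff y).clm_apply (hF.diff y)).add
      ((ha.diff y).clm_apply (hF'.diff y)), fun c hc X => ?_⟩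
    obtain ⟨K₁, h₁⟩ := (ha'.clm_apply hF).bdd c hc X
    obtain ⟨K₂, h₂⟩ := (ha.clm_apply hF').bdd c hc X
    refine ⟨K₁ + K₂, ?_⟩
    filter_upwards [h₁, h₂] with lam h₁ h₂ y hy
    rw [add_mul]
    exact (norm_add_le _ _).trans (add_le_add (h₁ y hy) (h₂ y hy))
  refine (hasDerivAt_deriv hΩ hF' hG
    (fun lam hlam y => hasDerivAt_deriv_of_linear hΩ ha hF h hlam y) hc x).congr_deriv ?_
  have hd : ∀ {X : Type _} [NormedAddCommGroup X] [NormedSpace ℂ X] {f : ℂ → X},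
      DifferentiableOn ℂ f Ω → HasDerivAt f (_root_.deriv f c) c := fun hf =>
    (hf.differentiableAt (hΩ.mem_nhds hc)).hasDerivAt
  refine (((hd (ha'.diff x)).clm_apply (hd (hF.diff x))).add
    ((hd (ha.diff x)).clm_apply (hd (hF'.diff x)))).deriv.trans ?_
  module

end HolFamily

end Family

/-- A family that converges locally uniformly as `x → -∞` is bounded on `(-∞, 0]`, locally uniformly
in the parameter. -/
lemma exists_norm_le_of_tendsto {V : Type*} [NormedAddCommGroup V] {Ω : Set ℂ}
    (hΩ : IsOpen Ω) {f : ℝ → ℂ → V} {fm : ℂ → V}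
    (hcont : ContinuousOn (fun p : ℝ × ℂ => f p.1 p.2) (univ ×ˢ Ω)) (hfm : ContinuousOn fm Ω)
    (hlim : TendstoLocallyUniformlyOn f fm atBot Ω) {c : ℂ} (hc : c ∈ Ω) :
    ∃ K, ∀ᶠ lam in 𝓝 c, ∀ x ∈ Iic (0 : ℝ), ‖f x lam‖ ≤ K * 1 := by
  obtain ⟨R, hR, hsub⟩ := Metric.nhds_basis_closedBall.mem_iff.1 (hΩ.mem_nhds hc)
  have hu := (tendstoLocallyUniformlyOn_iff_forall_isCompact hΩ).1 hlim _ hsub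
    (isCompact_closedBall c R)
  obtain ⟨X, hX⟩ := eventually_atBot.1 (Metric.tendstoUniformlyOn_iff.1 hu 1 one_pos)
  obtain ⟨K₁, hK₁⟩ := (isCompact_closedBall c R).exists_bound_of_continuousOn (hfm.mono hsub)
  obtain ⟨K₂, hK₂⟩ := ((isCompact_Icc (a := X) (b := 0)).prod
    (isCompact_closedBall c R)).exists_bound_of_continuousOn
      (hcont.mono (prod_mono (subset_univ _) hsub))
  refine ⟨max (1 + K₁) K₂, ?_⟩
  filter_upwards [Metric.closedBall_mem_nhds c hR] with lam hlam x hx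
  rw [mul_one]
  rcases le_total x X with hxX | hxX
  · refine le_max_of_le_left ?_
    have h1 := hX x hxX lam hlam
    have h2 := hK₁ lam hlam
    rw [dist_comm, dist_eq_norm] at h1
    have h3 : ‖f x lam‖ ≤ ‖f x lam - fm lam‖ + ‖fm lam‖ := by
      simpa using norm_add_le (f x lam - fm lam) (fm lam)
    linarith
  · exact le_max_of_le_right (hK₂ (x, lam) ⟨⟨hxX, hx⟩, hlam⟩)

namespace LeftEnd

variable {V : Type*} [NormedAddCommGroup V] [NormedSpace ℂ V] [CompleteSpace V]
  {Ω : Set ℂ} {a : ℝ → ℂ → V →L[ℂ] V} {am : ℂ → V →L[ℂ] V} {μ : ℂ → ℂ} {v : ℂ → V}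

lemma holFamily_leftSol (h : LeftEnd Ω a am μ v) : HolFamily Ω (leftSol a am μ v) := by
  refine ⟨h.differentiableOn_leftSol, fun c hc X => ?_⟩
  obtain ⟨r, hr, -, hK⟩ := h.exists_norm_leftSol_le hc
  obtain ⟨K, hK0, hK⟩ := hK X
  have hmu : ∀ᶠ lam in 𝓝 c, ‖μ lam‖ < ‖μ c‖ + 1 :=
    ((h.diff_mu.continuousOn.continuousAt (h.isOpen.mem_nhds hc)).norm).eventually_lt_const
      (by simp)
  refine ⟨K * Real.exp ((‖μ c‖ + 1) * |X|), ?_⟩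
  filter_upwards [Metric.ball_mem_nhds c hr, hmu] with lam hlam hm x hx
  rw [mul_one]
  refine (hK lam hlam x hx.2).trans (mul_le_mul_of_nonneg_left (Real.exp_le_exp.2 ?_) hK0)
  have h1 : |x| ≤ |X| := (abs_le.2 hx).trans (le_abs_self X)
  calc (μ lam).re * x ≤ |(μ lam).re| * |x| := by rw [← abs_mul]; exact le_abs_self _
    _ ≤ (‖μ c‖ + 1) * |X| := by
      have := (Complex.abs_re_le_norm (μ lam)).trans hm.le
      gcongr

/-- As the eigenvalue `μ` is continuous, an arbitrarily small loss in the exponent makes the growth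
bound for the selected solutions uniform in the parameter, so that it passes to their
`λ`-derivatives. -/
lemma exists_growth (h : LeftEnd Ω a am μ v) {c : ℂ} (hc : c ∈ Ω) {ε : ℝ} (hε : 0 < ε) :
    ∃ K, ∀ᶠ lam in 𝓝 c, ∀ x ∈ Iic (0 : ℝ),
      ‖leftSol a am μ v x lam‖ ≤ K * Real.exp (((μ c).re - ε) * x) := by
  obtain ⟨r, hr, -, hK⟩ := h.exists_norm_leftSol_le hc
  obtain ⟨K, hK0, hK⟩ := hK 0
  have hmu : ∀ᶠ lam in 𝓝 c, (μ c).re - ε < (μ lam).re :=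
    (Complex.continuous_re.continuousAt.comp
      (h.diff_mu.continuousOn.continuousAt (h.isOpen.mem_nhds hc))).eventually_const_lt
      (by simpa using hε)
  refine ⟨K, ?_⟩
  filter_upwards [Metric.ball_mem_nhds c hr, hmu] with lam hlam hm x hx
  refine (hK lam hlam x hx).trans (mul_le_mul_of_nonneg_left (Real.exp_le_exp.2 ?_) hK0)
  exact mul_le_mul_of_nonpos_right hm.le hx

end LeftEnd

/-! ### Exponential decay for perturbed systems -/

section Decay

variable {W : Type*} [NormedAddCommGroup W] [NormedSpace ℂ W] [CompleteSpace W]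

/-- Let `e^{tN}` decay exponentially. Then solutions of `Z' = -N Z + k` decay exponentially at `-∞`
if `k` is a sum of a term that is small compared with `Z` and an exponentially decaying one. -/
lemma exists_exp_decay {N : W →L[ℂ] W} {C α : ℝ} (hα : 0 < α)
    (hflow : ∀ t, 0 ≤ t → ‖expFlow N t‖ ≤ C * Real.exp (-(α * t))) {Z k : ℝ → W}
    (hZ : ∀ x, HasDerivAt Z (-(N (Z x)) + k x) x) {δ : ℝ → ℝ} (hδ : Tendsto δ atBot (𝓝 0))
    {H γ : ℝ} (hγ : 0 < γ) (hk : ∀ x ≤ 0, ‖k x‖ ≤ δ x * ‖Z x‖ + H * Real.exp (γ * x)) :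
    ∃ β > 0, ∃ K, ∀ x ≤ 0, ‖Z x‖ ≤ K * Real.exp (β * x) := by
  have hC : 0 ≤ C := by
    have := (norm_nonneg _).trans (hflow 0 le_rfl)
    simpa using this
  have hZc : Continuous Z := continuous_iff_continuousAt.2 fun x => (hZ x).continuousAt
  -- the rate `β` lies below both the decay rate of the flow and that of the forcing
  set β := min α γ / 2 with hβ
  have hmin : 0 < min α γ := lt_min hα hγ
  have hβ0 : 0 < β := by positivity
  have hβα : β ≤ α / 2 := by have := min_le_left α γ; rw [hβ]; linarith
  have hβγ : β ≤ γ := by have := min_le_right α γ; rw [hβ]; linarith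
  -- with this bound on `δ`, the maximum `S` below satisfies `S ≤ K₁ + S / 2`
  set δ₀ := α / (4 * (C + 1)) with hδ₀
  have hδ₀0 : 0 < δ₀ := by positivity
  have hCδ : C * δ₀ ≤ α / 4 := by
    rw [hδ₀, mul_div_assoc', div_le_div_iff₀ (by positivity) (by norm_num)]
    nlinarith
  obtain ⟨X, hX0, hX⟩ : ∃ X ≤ 0, ∀ x ≤ X, δ x ≤ δ₀ := by
    obtain ⟨X, hX⟩ := eventually_atBot.1 (hδ.eventually_lt_const hδ₀0)
    exact ⟨min X 0, min_le_right _ _, fun x hx => (hX x (hx.trans (min_le_left _ _))).le⟩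
  set q : ℝ → ℝ := fun t => Real.exp (-(β * t)) * ‖Z t‖ with hq
  have hqc : Continuous q := by fun_prop
  have hZq : ∀ t, ‖Z t‖ = q t * Real.exp (β * t) := by
    intro t
    rw [hq]
    simp only
    rw [mul_right_comm, ← Real.exp_add, neg_add_cancel, Real.exp_zero, one_mul]
  set K₁ := C * q X + 2 * C * |H| / α with hK₁
  -- the maximum of `q` on `[x₁, X]` is bounded independently of `x₁`
  have hleft : ∀ x₁ ≤ X, q x₁ ≤ 2 * K₁ := by
    intro x₁ hx₁
    obtain ⟨x, hx, hmax⟩ := (isCompact_Icc (a := x₁) (b := X)).exists_isMaxOn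
      ⟨x₁, left_mem_Icc.2 hx₁⟩ hqc.continuousOn
    set S := q x with hS
    have hS0 : 0 ≤ S := by positivity
    have hqS : ∀ t ∈ Icc x X, q t ≤ S := fun t ht => hmax ⟨hx.1.trans ht.1, ht.2⟩
    -- variation of constants on `[x, X]`, in the form of a mean value inequality
    set f : ℝ → W := fun t => expFlow N (t - x) (Z t) with hf
    have hfd : ∀ t, HasDerivAt f (expFlow N (t - x) (k t)) t := by
      intro t
      have h1 : HasDerivAt (fun s => expFlow N (s - x)) (N * expFlow N (t - x)) t :=
        (hasDerivAt_expFlow N (t - x)).comp_sub_const t x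
      refine (hasDerivAt_real_clm_apply h1 (hZ t)).congr_deriv ?_
      rw [map_add, (commute_expFlow N (t - x)).eq]
      simp
    set A := C * (δ₀ * S + |H|) with hA
    have hA0 : 0 ≤ A := by positivity
    set D : ℝ → ℝ := fun t => -(A / (α - β)) * Real.exp (α * x - (α - β) * t) with hD
    have hαβ : 0 < α - β := by linarith
    have hDd : ∀ t, HasDerivAt D (A * Real.exp (α * x - (α - β) * t)) t := by
      intro t
      have h1 : HasDerivAt (fun s => α * x - (α - β) * s) (-((α - β) * 1)) t :=
        ((hasDerivAt_id t).const_mul (α - β)).const_sub (α * x)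
      refine (h1.exp.const_mul (-(A / (α - β)))).congr_deriv ?_
      field_simp
    have hbound : ∀ t ∈ Ico x X,
        ‖expFlow N (t - x) (k t)‖ ≤ A * Real.exp (α * x - (α - β) * t) := by
      intro t ht
      have ht0 : t ≤ 0 := ht.2.le.trans hX0
      have h1 := hflow (t - x) (by linarith [ht.1])
      have h2 : ‖k t‖ ≤ (δ₀ * S + |H|) * Real.exp (β * t) := by
        have h3 : δ t * ‖Z t‖ ≤ δ₀ * (S * Real.exp (β * t)) := by
          rw [hZq t]
          have := hqS t ⟨ht.1, ht.2.le⟩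
          have hq0 : 0 ≤ q t := by positivity
          have := hX t ht.2.le
          calc _ ≤ δ₀ * (q t * Real.exp (β * t)) := by gcongr
            _ ≤ _ := by gcongr
        have h4 : H * Real.exp (γ * t) ≤ |H| * Real.exp (β * t) :=
          mul_le_mul (le_abs_self H) (Real.exp_le_exp.2 (mul_le_mul_of_nonpos_right hβγ ht0))
            (Real.exp_pos _).le (abs_nonneg _)
        calc _ ≤ _ := hk t ht0
          _ ≤ δ₀ * (S * Real.exp (β * t)) + |H| * Real.exp (β * t) := add_le_add h3 h4
          _ = _ := by ring
      calc _ ≤ ‖expFlow N (t - x)‖ * ‖k t‖ := ContinuousLinearMap.le_opNorm _ _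
        _ ≤ (C * Real.exp (-(α * (t - x)))) * ((δ₀ * S + |H|) * Real.exp (β * t)) :=
          mul_le_mul h1 h2 (norm_nonneg _) (by positivity)
        _ = A * (Real.exp (-(α * (t - x))) * Real.exp (β * t)) := by rw [hA]; ring
        _ = _ := by rw [← Real.exp_add]; congr 2; ring
    have hmv := image_norm_le_of_norm_deriv_right_le_deriv_boundary' (f := fun t => f t - f x)
      (a := x) (b := X) (B := fun t => D t - D x)
      (fun t _ => ((hfd t).sub_const _).continuousAt.continuousWithinAt)
      (fun t _ => ((hfd t).sub_const _).hasDerivWithinAt) (by simp)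
      (fun t _ => ((hDd t).sub_const _).continuousAt.continuousWithinAt)
      (fun t _ => ((hDd t).sub_const _).hasDerivWithinAt) hbound (right_mem_Icc.2 hx.2)
    have hDX : D X - D x ≤ 2 / α * A * Real.exp (β * x) := by
      have h1 : D X ≤ 0 := by
        have : 0 ≤ A / (α - β) := by positivity
        have := Real.exp_pos (α * x - (α - β) * X)
        simp only [hD]
        nlinarith
      have h2 : D x = -(A / (α - β) * Real.exp (β * x)) := by
        simp only [hD]
        rw [neg_mul]
        congr 3
        ring
      have h3 : A / (α - β) ≤ 2 / α * A := by
        rw [div_mul_eq_mul_div, div_le_div_iff₀ hαβ hα]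
        nlinarith
      have := mul_le_mul_of_nonneg_right h3 (Real.exp_pos (β * x)).le
      linarith
    have hfX : ‖f X‖ ≤ C * q X * Real.exp (β * x) := by
      have h1 := hflow (X - x) (by linarith [hx.2])
      have h2 : Real.exp (-(α * (X - x))) ≤ Real.exp (-(β * (X - x))) := by
        refine Real.exp_le_exp.2 (neg_le_neg (mul_le_mul_of_nonneg_right (by linarith) ?_))
        linarith [hx.2]
      calc ‖f X‖ ≤ ‖expFlow N (X - x)‖ * ‖Z X‖ := ContinuousLinearMap.le_opNorm _ _
        _ ≤ (C * Real.exp (-(β * (X - x)))) * (q X * Real.exp (β * X)) := by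
          rw [← hZq]
          gcongr
          exact h1.trans (mul_le_mul_of_nonneg_left h2 hC)
        _ = C * q X * (Real.exp (-(β * (X - x))) * Real.exp (β * X)) := by ring
        _ = _ := by rw [← Real.exp_add]; congr 2; ring
    have hfx : f x = Z x := by simp [hf]
    have htri : ‖Z x‖ ≤ ‖f X‖ + ‖f X - f x‖ := by
      rw [← hfx, norm_sub_rev]
      simpa using norm_add_le (f X) (f x - f X)
    have hSle : S * Real.exp (β * x) ≤ (C * q X + 2 / α * A) * Real.exp (β * x) := by
      rw [hS, ← hZq x, add_mul]
      linarith
    have hS' := le_of_mul_le_mul_right hSle (Real.exp_pos _)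
    have hA' : 2 / α * A ≤ S / 2 + 2 * C * |H| / α := by
      have : 2 / α * A = 2 / α * (C * δ₀) * S + 2 * C * |H| / α := by rw [hA]; ring
      rw [this]
      have h1 : 2 / α * (C * δ₀) ≤ 1 / 2 := by
        rw [div_mul_eq_mul_div, div_le_div_iff₀ hα two_pos]
        linarith
      nlinarith
    have : q x₁ ≤ S := hmax (left_mem_Icc.2 hx₁)
    rw [hK₁]
    linarith
  obtain ⟨K₂, hK₂⟩ := (isCompact_Icc (a := X) (b := 0)).exists_bound_of_continuousOn
    hqc.continuousOn
  refine ⟨β, hβ0, max (2 * K₁) K₂, fun x hx => ?_⟩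
  rw [hZq x]
  refine mul_le_mul_of_nonneg_right ?_ (Real.exp_pos _).le
  rcases le_total x X with hxX | hxX
  · exact le_max_of_le_left (hleft x hxX)
  · exact le_max_of_le_right ((le_abs_self _).trans (hK₂ x ⟨hxX, hx⟩))

end Decay

/-- An antiderivative that decays exponentially at `-∞` computes the integral over `(-∞, 0]`. -/
lemma integral_Iic_of_exp_decay {f f' : ℝ → ℂ} (hf : ∀ x, HasDerivAt f (f' x) x) {β K K' : ℝ}
    (hβ : 0 < β) (hle : ∀ x ≤ 0, ‖f x‖ ≤ K * Real.exp (β * x))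
    (hle' : ∀ x ≤ 0, ‖f' x‖ ≤ K' * Real.exp (β * x)) :
    IntegrableOn f' (Iic 0) ∧ ∫ x in Iic (0 : ℝ), f' x = f 0 := by
  have hderiv : f' = deriv f := funext fun x => (hf x).deriv.symm
  have hint : IntegrableOn f' (Iic 0) := by
    refine Integrable.mono' ((integrableOn_exp_mul_Iic hβ 0).const_mul K') ?_ ?_
    · rw [hderiv]
      exact (measurable_deriv f).aestronglyMeasurable
    · filter_upwards [ae_restrict_mem measurableSet_Iic] with x hx using hle' x hx
  refine ⟨hint, ?_⟩
  have hlim : Tendsto f atBot (𝓝 0) := by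
    have h0 : Tendsto (fun x : ℝ => K * Real.exp (β * x)) atBot (𝓝 0) := by
      have := (Real.tendsto_exp_atBot.comp (tendsto_id.const_mul_atBot hβ)).const_mul K
      simpa using! this
    refine squeeze_zero_norm' ?_ h0
    filter_upwards [eventually_le_atBot 0] with x hx using hle x hx
  have := integral_Iic_of_hasDerivAt_of_tendsto' (fun x _ => hf x) hint hlim
  rwa [sub_zero] at this

/-! ### The adjoint system and the contribution of a half-line -/

section Adjoint

variable {V W : Type*} [NormedAddCommGroup V] [NormedSpace ℂ V] [NormedAddCommGroup W]
  [NormedSpace ℂ W]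

lemma hasDerivAt_pair (pair : V →L[ℂ] W →L[ℂ] ℂ) {p : ℝ → V} {q : ℝ → W} {p' : V} {q' : W} {x : ℝ}
    (hp : HasDerivAt p p' x) (hq : HasDerivAt q q' x) :
    HasDerivAt (fun y => pair (p y) (q y)) (pair (p x) q' + pair p' (q x)) x :=
  (pair.bilinearRestrictScalars ℝ).hasDerivAt_of_bilinear (fun _ => hp) fun _ => hq

lemma hasDerivAt_pair_complex (pair : V →L[ℂ] W →L[ℂ] ℂ) {p : ℂ → V} {q : ℂ → W} {p' : V} {q' : W}
    {z : ℂ} (hp : HasDerivAt p p' z) (hq : HasDerivAt q q' z) :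
    HasDerivAt (fun y => pair (p y) (q y)) (pair (p z) q' + pair p' (q z)) z :=
  pair.hasDerivAt_of_bilinear (fun _ => hp) fun _ => hq

/-- For a system `y' = a(x;λ) y` satisfying `LeftEnd`, a family `ζ` of solutions of the adjoint
system `ζ' = -b(x;λ) ζ`. The last field says that the operator `bₘ(c) - μ(c)`, with its eigenvalue
`0` moved to the left by a rank one operator, generates an exponentially decaying flow. -/
structure AdjointFamily (pair : V →L[ℂ] W →L[ℂ] ℂ) (Ω : Set ℂ) (a : ℝ → ℂ → V →L[ℂ] V) (μ : ℂ → ℂ)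
    (v : ℂ → V) (b : ℝ → ℂ → W →L[ℂ] W) (bm : ℂ → W →L[ℂ] W) (ζ : ℝ → ℂ → W) (c : ℂ) :
    Prop where
  adj : ∀ x lam p q, pair (a x lam p) q = pair p (b x lam q)
  cont : ContinuousOn (fun p : ℝ × ℂ => b p.1 p.2) (univ ×ˢ Ω)
  diff : ∀ x, DifferentiableOn ℂ (b x) Ω
  lim : TendstoLocallyUniformlyOn b bm atBot Ω
  sol : ∀ lam ∈ Ω, ∀ x, HasDerivAt (fun y => ζ y lam) (-(b x lam (ζ x lam))) x
  fam : HolFamily Ω ζ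
  hurwitz : ∃ (w : W) (N : W →L[ℂ] W) (C α : ℝ), 0 < α ∧
    (∀ t, 0 ≤ t → ‖expFlow N t‖ ≤ C * Real.exp (-(α * t))) ∧
    ∀ q, bm c q = N q + μ c • q + pair (v c) q • w

variable {pair : V →L[ℂ] W →L[ℂ] ℂ} {Ω : Set ℂ} {a : ℝ → ℂ → V →L[ℂ] V} {am : ℂ → V →L[ℂ] V}
  {μ : ℂ → ℂ} {v : ℂ → V} {b : ℝ → ℂ → W →L[ℂ] W} {bm : ℂ → W →L[ℂ] W} {ζ : ℝ → ℂ → W} {c : ℂ}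

namespace AdjointFamily

/-- The pairing `η ∧ 𝒴̃` does not depend on `x`. -/
lemma pair_eq (h : AdjointFamily pair Ω a μ v b bm ζ c) {lam : ℂ} (hlam : lam ∈ Ω) {y : ℝ → V}
    (hy : ∀ x, HasDerivAt y (a x lam (y x)) x) (x : ℝ) :
    pair (y x) (ζ x lam) = pair (y 0) (ζ 0 lam) := by
  have hd : ∀ x, HasDerivAt (fun s => pair (y s) (ζ s lam)) 0 x := fun x => by
    refine (hasDerivAt_pair pair (hy x) (h.sol lam hlam x)).congr_deriv ?_
    rw [h.adj, map_neg, neg_add_cancel]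
  exact is_const_of_deriv_eq_zero (fun x => (hd x).differentiableAt) (fun x => (hd x).deriv) x 0

/-- Bound for the pairing of a curve of size `e^{(μ-β/2)x}` with one of size `e^{(β-μ)x}`. -/
lemma norm_pair_le {m β K₁ K₂ : ℝ} {p : V} {q : W} {x : ℝ}
    (hp : ‖p‖ ≤ K₁ * Real.exp ((m - β / 2) * x)) (hq : ‖q‖ ≤ K₂ * Real.exp ((β - m) * x)) :
    ‖pair p q‖ ≤ ‖pair‖ * K₁ * K₂ * Real.exp (β / 2 * x) := by
  calc ‖pair p q‖ ≤ ‖pair‖ * ‖p‖ * ‖q‖ := pair.le_opNorm₂ p q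
    _ ≤ ‖pair‖ * (K₁ * Real.exp ((m - β / 2) * x)) * (K₂ * Real.exp ((β - m) * x)) := by
      have := (norm_nonneg _).trans hp
      gcongr
    _ = ‖pair‖ * K₁ * K₂ * (Real.exp ((m - β / 2) * x) * Real.exp ((β - m) * x)) := by ring
    _ = _ := by rw [← Real.exp_add]; congr 2; ring

/-- The pairing is adjoint for the `λ`-derivatives of the coefficients, too. -/
lemma adj_deriv (h : AdjointFamily pair Ω a μ v b bm ζ c) (hL : LeftEnd Ω a am μ v) (hc : c ∈ Ω)
    (x : ℝ) (p : V) (q : W) : pair (deriv (a x) c p) q = pair p (deriv (b x) c q) := by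
  have ha := ((hL.diff x).differentiableAt (hL.isOpen.mem_nhds hc)).hasDerivAt
  have hb := ((h.diff x).differentiableAt (hL.isOpen.mem_nhds hc)).hasDerivAt
  have h1 := hasDerivAt_pair_complex pair (ha.clm_apply (hasDerivAt_const c p))
    (hasDerivAt_const c q)
  have h2 := hasDerivAt_pair_complex pair (hasDerivAt_const c p)
    (hb.clm_apply (hasDerivAt_const c q))
  have h3 := h1.deriv
  simp only [h.adj] at h3
  simpa using h3.symm.trans h2.deriv

/-- A solution `z` of the inhomogeneous adjoint system whose pairing with the selected solution `y`
decays is smaller than the generic size `e^{-μ x}` at `-∞` by an exponential factor. With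
`Z = e^{μ x} z` and `u = e^{-μ x} y → v`, the component `v · Z` of `Z` that need not decay equals
`(v - u) · Z` up to an exponentially small term, and so acts as a small perturbation. -/
lemma exists_decay [CompleteSpace W] (h : AdjointFamily pair Ω a μ v b bm ζ c) (hc : c ∈ Ω)
    {y : ℝ → V} (hy : IsLeftSol a μ v c y) {z f : ℝ → W}
    (hz : ∀ x, HasDerivAt z (-(b x c (z x)) + f x) x) {γ H : ℝ} (hγ : 0 < γ)
    (hf : ∀ x ≤ 0, ‖f x‖ ≤ H * Real.exp ((γ - (μ c).re) * x))
    (hpair : ∀ x ≤ 0, ‖pair (y x) (z x)‖ ≤ H * Real.exp (γ * x)) :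
    ∃ β > 0, ∃ K, ∀ x ≤ 0, ‖z x‖ ≤ K * Real.exp ((β - (μ c).re) * x) := by
  obtain ⟨w, N, C, α, hα, hflow, hbm⟩ := h.hurwitz
  set e : ℝ → ℂ := fun x => Complex.exp (μ c * x) with he
  set u : ℝ → V := fun x => Complex.exp (-(μ c * x)) • y x with hu
  have heu : ∀ x, e x • u x = y x := by
    intro x
    simp only [he, hu]
    rw [smul_smul, ← Complex.exp_add, add_neg_cancel, Complex.exp_zero, one_smul]
  set Z : ℝ → W := fun x => e x • z x with hZ
  set k : ℝ → W := fun x => -((b x c - bm c) (Z x)) - pair (v c - u x) (Z x) • w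
    - pair (y x) (z x) • w + e x • f x with hk
  have hpu : ∀ x, pair (u x) (Z x) = pair (y x) (z x) := by
    intro x
    rw [← heu x, hZ]
    simp
  have hZd : ∀ x, HasDerivAt Z (-(N (Z x)) + k x) x := by
    intro x
    refine ((hasDerivAt_exp_mul (μ c) x).smul (hz x)).congr_deriv ?_
    simp only [hk]
    rw [← hpu x, map_sub, sub_apply, sub_apply, hbm]
    simp only [hZ, he, map_smul]
    module
  set δ : ℝ → ℝ := fun x => ‖b x c - bm c‖ + ‖pair‖ * ‖v c - u x‖ * ‖w‖ with hδ
  have hδ0 : Tendsto δ atBot (𝓝 0) := by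
    have h1 : Tendsto (fun x => ‖b x c - bm c‖) atBot (𝓝 0) := by
      have h2 := h.lim.tendsto_at hc
      exact tendsto_iff_norm_sub_tendsto_zero.1 h2
    have h3 : Tendsto (fun x => ‖v c - u x‖) atBot (𝓝 0) := by
      have h4 := tendsto_iff_norm_sub_tendsto_zero.1 hy.2
      simpa only [norm_sub_rev (v c)] using h4
    have := h1.add ((h3.const_mul ‖pair‖).mul_const ‖w‖)
    simpa using this
  have hkle : ∀ x ≤ 0, ‖k x‖ ≤ δ x * ‖Z x‖ + (H * ‖w‖ + H) * Real.exp (γ * x) := by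
    intro x hx
    have h1 : ‖(b x c - bm c) (Z x)‖ ≤ ‖b x c - bm c‖ * ‖Z x‖ :=
      ContinuousLinearMap.le_opNorm _ _
    have h2 : ‖pair (v c - u x) (Z x) • w‖ ≤ ‖pair‖ * ‖v c - u x‖ * ‖Z x‖ * ‖w‖ := by
      rw [norm_smul]
      exact mul_le_mul_of_nonneg_right (pair.le_opNorm₂ _ _) (norm_nonneg _)
    have h3 : ‖pair (y x) (z x) • w‖ ≤ H * Real.exp (γ * x) * ‖w‖ := by
      rw [norm_smul]
      exact mul_le_mul_of_nonneg_right (hpair x hx) (norm_nonneg _)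
    have h4 : ‖e x • f x‖ ≤ H * Real.exp (γ * x) := by
      rw [norm_smul, he, norm_exp_mul]
      calc _ ≤ Real.exp ((μ c).re * x) * (H * Real.exp ((γ - (μ c).re) * x)) :=
            mul_le_mul_of_nonneg_left (hf x hx) (Real.exp_pos _).le
        _ = H * (Real.exp ((μ c).re * x) * Real.exp ((γ - (μ c).re) * x)) := by ring
        _ = _ := by rw [← Real.exp_add]; congr 2; ring
    have h5 : ‖k x‖ ≤ ‖(b x c - bm c) (Z x)‖ + ‖pair (v c - u x) (Z x) • w‖
        + ‖pair (y x) (z x) • w‖ + ‖e x • f x‖ := by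
      refine (norm_add_le _ _).trans (add_le_add_left ((norm_sub_le _ _).trans
        (add_le_add_left ((norm_sub_le _ _).trans ?_) _)) _)
      rw [norm_neg]
    calc _ ≤ _ := h5
      _ ≤ ‖b x c - bm c‖ * ‖Z x‖ + ‖pair‖ * ‖v c - u x‖ * ‖Z x‖ * ‖w‖
          + H * Real.exp (γ * x) * ‖w‖ + H * Real.exp (γ * x) := by gcongr
      _ = _ := by rw [hδ]; ring
  obtain ⟨β, hβ, K, hK⟩ := exists_exp_decay hα hflow hZd hδ0 hγ hkle
  refine ⟨β, hβ, K, fun x hx => ?_⟩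
  have h1 : ‖z x‖ = Real.exp (-((μ c).re * x)) * ‖Z x‖ := by
    rw [hZ, norm_smul, he, norm_exp_mul, ← mul_assoc, ← Real.exp_add, neg_add_cancel, Real.exp_zero,
      one_mul]
  rw [h1]
  calc _ ≤ Real.exp (-((μ c).re * x)) * (K * Real.exp (β * x)) :=
        mul_le_mul_of_nonneg_left (hK x hx) (Real.exp_pos _).le
    _ = K * (Real.exp (-((μ c).re * x)) * Real.exp (β * x)) := by ring
    _ = _ := by rw [← Real.exp_add]; congr 2; ring

/-- The `λ`-derivative of `ζ` solves the adjoint system with the forcing `-b_λ ζ`. -/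
lemma hasDerivAt_deriv_adjoint [CompleteSpace W] (h : AdjointFamily pair Ω a μ v b bm ζ c)
    (hΩ : IsOpen Ω) (hc : c ∈ Ω) (x : ℝ) : HasDerivAt (fun y => deriv (ζ y) c)
      (-(b x c (deriv (ζ x) c)) + -(deriv (b x) c (ζ x c))) x := by
  have hb := (HolFamily.of_continuousOn hΩ h.diff h.cont).neg
  refine (HolFamily.hasDerivAt_deriv_of_linear hΩ hb h.fam
    (fun lam hlam y => by simpa using h.sol lam hlam y) hc x).congr_deriv ?_
  rw [deriv.fun_neg]
  simp only [neg_apply]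
  abel

end AdjointFamily

variable [CompleteSpace V]

/-- The growth bound for the selected solution and its first two `λ`-derivatives at one
parameter. -/
lemma LeftEnd.exists_growth_at (hL : LeftEnd Ω a am μ v) (hc : c ∈ Ω) {ε : ℝ} (hε : 0 < ε) :
    ∃ K, 0 ≤ K ∧ ∀ x ≤ 0,
      ‖leftSol a am μ v x c‖ ≤ K * Real.exp (((μ c).re - ε) * x) ∧
      ‖deriv (leftSol a am μ v x) c‖ ≤ K * Real.exp (((μ c).re - ε) * x) ∧
      ‖deriv (deriv (leftSol a am μ v x)) c‖ ≤ K * Real.exp (((μ c).re - ε) * x) := by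
  have hf := hL.holFamily_leftSol
  have h0 := hL.exists_growth hc hε
  have h1 := exists_norm_deriv_le hL.isOpen hf.diff hc h0
  have h2 := exists_norm_deriv_le hL.isOpen (hf.deriv hL.isOpen).diff hc h1
  obtain ⟨K₀, h0⟩ := h0
  obtain ⟨K₁, h1⟩ := h1
  obtain ⟨K₂, h2⟩ := h2
  refine ⟨|K₀| + |K₁| + |K₂|, by positivity, fun x hx => ⟨?_, ?_, ?_⟩⟩
  · refine (h0.self_of_nhds x hx).trans (mul_le_mul_of_nonneg_right ?_ (Real.exp_pos _).le)
    linarith [le_abs_self K₀, abs_nonneg K₁, abs_nonneg K₂]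
  · refine (h1.self_of_nhds x hx).trans (mul_le_mul_of_nonneg_right ?_ (Real.exp_pos _).le)
    linarith [le_abs_self K₁, abs_nonneg K₀, abs_nonneg K₂]
  · refine (h2.self_of_nhds x hx).trans (mul_le_mul_of_nonneg_right ?_ (Real.exp_pos _).le)
    linarith [le_abs_self K₂, abs_nonneg K₁, abs_nonneg K₀]

lemma exists_norm_deriv_coeff_le {X : Type*} [NormedAddCommGroup X] [NormedSpace ℂ X]
    [CompleteSpace X] {f : ℝ → ℂ → X} {fm : ℂ → X} (hΩ : IsOpen Ω)
    (hcont : ContinuousOn (fun p : ℝ × ℂ => f p.1 p.2) (univ ×ˢ Ω))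
    (hdiff : ∀ x, DifferentiableOn ℂ (f x) Ω) (hlim : TendstoLocallyUniformlyOn f fm atBot Ω)
    (hc : c ∈ Ω) : ∃ K, 0 ≤ K ∧ ∀ x ≤ 0, ‖deriv (f x) c‖ ≤ K := by
  have hfm := (hlim.differentiableOn (Eventually.of_forall hdiff) hΩ).continuousOn
  obtain ⟨K, hK⟩ := exists_norm_deriv_le hΩ hdiff hc (ρ := fun _ => 1)
    (exists_norm_le_of_tendsto hΩ hcont hfm hlim hc)
  refine ⟨K, ?_, fun x hx => ?_⟩
  · simpa using (norm_nonneg _).trans (hK.self_of_nhds 0 self_mem_Iic)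
  · simpa using hK.self_of_nhds x hx

namespace AdjointFamily

/-- If the pairing `D(c)` vanishes, `ζ` is smaller than its generic size at `-∞`. -/
lemma exists_decay_sol [CompleteSpace W] (h : AdjointFamily pair Ω a μ v b bm ζ c)
    (hL : LeftEnd Ω a am μ v)
    (hc : c ∈ Ω) (hD : pair (leftSol a am μ v 0 c) (ζ 0 c) = 0) :
    ∃ β > 0, ∃ K, 0 ≤ K ∧ ∀ x ≤ 0, ‖ζ x c‖ ≤ K * Real.exp ((β - (μ c).re) * x) := by
  have hsol := hL.isLeftSol_leftSol hc
  obtain ⟨β, hβ, K, hK⟩ := h.exists_decay hc hsol (z := fun x => ζ x c) (f := 0) (H := 0)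
    (γ := 1) (fun x => by simpa using h.sol c hc x) one_pos (fun x _ => by simp) fun x _ => by
      rw [h.pair_eq hc hsol.1, hD]
      simp
  exact ⟨β, hβ, |K|, abs_nonneg K, fun x hx =>
    (hK x hx).trans (mul_le_mul_of_nonneg_right (le_abs_self K) (Real.exp_pos _).le)⟩

lemma hasDerivAt_pair_deriv_sol (h : AdjointFamily pair Ω a μ v b bm ζ c)
    (hL : LeftEnd Ω a am μ v) (hc : c ∈ Ω) (x : ℝ) :
    HasDerivAt (fun y => pair (deriv (leftSol a am μ v y) c) (ζ y c))
      (pair (deriv (a x) c (leftSol a am μ v x c)) (ζ x c)) x := by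
  have ha := HolFamily.of_continuousOn hL.isOpen hL.diff hL.cont
  have h1 := HolFamily.hasDerivAt_deriv_of_linear hL.isOpen ha hL.holFamily_leftSol
    (fun lam hlam => (hL.isLeftSol_leftSol hlam).1) hc x
  refine (hasDerivAt_pair pair h1 (h.sol c hc x)).congr_deriv ?_
  rw [map_neg, map_add, add_apply, h.adj]
  ring

/-- The contribution of `(-∞, 0]` to the first derivative of the Evans function: the integrand is
the `x`-derivative of `η_λ ∧ 𝒴̃`, which vanishes at `-∞`. -/
lemma integral_first [CompleteSpace W] (h : AdjointFamily pair Ω a μ v b bm ζ c)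
    (hL : LeftEnd Ω a am μ v)
    (hc : c ∈ Ω) (hD : pair (leftSol a am μ v 0 c) (ζ 0 c) = 0) :
    IntegrableOn (fun x => pair (deriv (a x) c (leftSol a am μ v x c)) (ζ x c)) (Iic 0) ∧
      ∫ x in Iic (0 : ℝ), pair (deriv (a x) c (leftSol a am μ v x c)) (ζ x c)
        = pair (deriv (leftSol a am μ v 0) c) (ζ 0 c) := by
  obtain ⟨β, hβ, K, hK0, hK⟩ := h.exists_decay_sol hL hc hD
  obtain ⟨K₁, hK₁0, hK₁⟩ := hL.exists_growth_at hc (half_pos hβ)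
  obtain ⟨K₂, hK₂0, hK₂⟩ := exists_norm_deriv_coeff_le hL.isOpen hL.cont hL.diff hL.lim hc
  refine integral_Iic_of_exp_decay (h.hasDerivAt_pair_deriv_sol hL hc) (half_pos hβ)
    (fun x hx => norm_pair_le (hK₁ x hx).2.1 (hK x hx))
    (fun x hx => norm_pair_le (K₁ := K₂ * K₁) ?_ (hK x hx))
  refine (ContinuousLinearMap.le_opNorm _ _).trans ?_
  rw [mul_assoc]
  exact mul_le_mul (hK₂ x hx) (hK₁ x hx).1 (norm_nonneg _) hK₂0

lemma hasDerivAt_pair_leftSol (h : AdjointFamily pair Ω a μ v b bm ζ c) (hL : LeftEnd Ω a am μ v)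
    {lam : ℂ} (hlam : lam ∈ Ω) (x : ℝ) :
    HasDerivAt (fun l => pair (leftSol a am μ v x l) (ζ x l))
      (pair (leftSol a am μ v x lam) (deriv (ζ x) lam)
        + pair (deriv (leftSol a am μ v x) lam) (ζ x lam)) lam :=
  hasDerivAt_pair_complex pair
    ((hL.differentiableOn_leftSol x).differentiableAt (hL.isOpen.mem_nhds hlam)).hasDerivAt
    ((h.fam.diff x).differentiableAt (hL.isOpen.mem_nhds hlam)).hasDerivAt

/-- If `D(c)` and `D'(c)` vanish, the `λ`-derivative of `ζ` is smaller than its generic size at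
`-∞`, too. -/
lemma exists_decay_deriv [CompleteSpace W] (h : AdjointFamily pair Ω a μ v b bm ζ c)
    (hL : LeftEnd Ω a am μ v)
    (hc : c ∈ Ω) (hD : pair (leftSol a am μ v 0 c) (ζ 0 c) = 0)
    (hD' : pair (leftSol a am μ v 0 c) (deriv (ζ 0) c)
      + pair (deriv (leftSol a am μ v 0) c) (ζ 0 c) = 0) :
    ∃ β > 0, ∃ K, 0 ≤ K ∧ ∀ x ≤ 0, ‖ζ x c‖ ≤ K * Real.exp ((β - (μ c).re) * x) ∧
      ‖deriv (ζ x) c‖ ≤ K * Real.exp ((β - (μ c).re) * x) := by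
  have hsol := hL.isLeftSol_leftSol hc
  obtain ⟨β₁, hβ₁, K, hK0, hK⟩ := h.exists_decay_sol hL hc hD
  obtain ⟨K₁, hK₁0, hK₁⟩ := hL.exists_growth_at hc (half_pos hβ₁)
  obtain ⟨K₂, hK₂0, hK₂⟩ := exists_norm_deriv_coeff_le hL.isOpen h.cont h.diff h.lim hc
  -- `D'(c) = 0` may be read off at every `x`, because the pairing does not depend on `x`
  have hpair : ∀ x, pair (leftSol a am μ v x c) (deriv (ζ x) c)
      = -pair (deriv (leftSol a am μ v x) c) (ζ x c) := by
    intro x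
    have heq : (fun l => pair (leftSol a am μ v x l) (ζ x l))
        =ᶠ[𝓝 c] fun l => pair (leftSol a am μ v 0 l) (ζ 0 l) := by
      filter_upwards [hL.isOpen.mem_nhds hc] with l hl
      exact h.pair_eq hl (hL.isLeftSol_leftSol hl).1 x
    have := (h.hasDerivAt_pair_leftSol hL hc x).unique
      ((h.hasDerivAt_pair_leftSol hL hc 0).congr_of_eventuallyEq heq)
    rw [hD'] at this
    exact eq_neg_of_add_eq_zero_left this
  have hmono : ∀ {β β' x m : ℝ}, β' ≤ β → x ≤ 0 →
      Real.exp ((β - m) * x) ≤ Real.exp ((β' - m) * x) := fun h1 h2 =>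
    Real.exp_le_exp.2 (mul_le_mul_of_nonpos_right (by linarith) h2)
  obtain ⟨β₂, hβ₂, K₃, hK₃⟩ := h.exists_decay hc hsol (z := fun x => deriv (ζ x) c)
    (f := fun x => -(deriv (b x) c (ζ x c))) (γ := β₁ / 2) (H := K₂ * K + ‖pair‖ * K₁ * K)
    (h.hasDerivAt_deriv_adjoint hL.isOpen hc) (half_pos hβ₁)
    (fun x hx => by
      rw [norm_neg]
      have h1 := hK₂ x hx
      have h2 := hK x hx
      have h3 : Real.exp ((β₁ - (μ c).re) * x) ≤ Real.exp ((β₁ / 2 - (μ c).re) * x) :=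
        hmono (by linarith) hx
      calc _ ≤ ‖deriv (b x) c‖ * ‖ζ x c‖ := ContinuousLinearMap.le_opNorm _ _
        _ ≤ K₂ * (K * Real.exp ((β₁ / 2 - (μ c).re) * x)) := by
          refine mul_le_mul h1 (h2.trans ?_) (norm_nonneg _) hK₂0
          gcongr
        _ ≤ _ := by
          rw [← mul_assoc]
          refine mul_le_mul_of_nonneg_right ?_ (Real.exp_pos _).le
          have : 0 ≤ ‖pair‖ * K₁ * K := by positivity
          linarith)
    (fun x hx => by
      rw [hpair x, norm_neg]
      refine (norm_pair_le (hK₁ x hx).2.1 (hK x hx)).trans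
        (mul_le_mul_of_nonneg_right ?_ (Real.exp_pos _).le)
      have : 0 ≤ K₂ * K := by positivity
      linarith)
  refine ⟨min β₁ β₂, lt_min hβ₁ hβ₂, K + |K₃|, by positivity, fun x hx => ⟨?_, ?_⟩⟩
  · refine (hK x hx).trans (mul_le_mul ?_ (hmono (min_le_left _ _) hx) (Real.exp_pos _).le
      (by positivity))
    linarith [abs_nonneg K₃]
  · refine (hK₃ x hx).trans (mul_le_mul ?_ (hmono (min_le_right _ _) hx) (Real.exp_pos _).le
      (by positivity))
    linarith [le_abs_self K₃]

/-- The contribution of `(-∞, 0]` to the second derivative of the Evans function. With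
`a_λλ = 0`, the `x`-derivative of `η_λλ ∧ 𝒴̃` is `2 (a_λ η_λ) ∧ 𝒴̃`, and that of `η_λ ∧ 𝒴̃_λ` is
`(a_λ η) ∧ 𝒴̃_λ - (a_λ η_λ) ∧ 𝒴̃`; both products vanish at `-∞`. -/
lemma integral_second [CompleteSpace W] (h : AdjointFamily pair Ω a μ v b bm ζ c)
    (hL : LeftEnd Ω a am μ v)
    (hc : c ∈ Ω) (ha2 : ∀ x, deriv (deriv (a x)) c = 0)
    (hD : pair (leftSol a am μ v 0 c) (ζ 0 c) = 0)
    (hD' : pair (leftSol a am μ v 0 c) (deriv (ζ 0) c)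
      + pair (deriv (leftSol a am μ v 0) c) (ζ 0 c) = 0) :
    IntegrableOn (fun x => pair (deriv (a x) c (deriv (leftSol a am μ v x) c)) (ζ x c)) (Iic 0) ∧
    IntegrableOn (fun x => pair (deriv (a x) c (leftSol a am μ v x c)) (deriv (ζ x) c)) (Iic 0) ∧
    2 * ∫ x in Iic (0 : ℝ), pair (deriv (a x) c (deriv (leftSol a am μ v x) c)) (ζ x c)
      = pair (deriv (deriv (leftSol a am μ v 0)) c) (ζ 0 c) ∧
    (∫ x in Iic (0 : ℝ), pair (deriv (a x) c (leftSol a am μ v x c)) (deriv (ζ x) c))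
      - ∫ x in Iic (0 : ℝ), pair (deriv (a x) c (deriv (leftSol a am μ v x) c)) (ζ x c)
      = pair (deriv (leftSol a am μ v 0) c) (deriv (ζ 0) c) := by
  obtain ⟨β, hβ, K, hK0, hK⟩ := h.exists_decay_deriv hL hc hD hD'
  obtain ⟨K₁, hK₁0, hK₁⟩ := hL.exists_growth_at hc (half_pos hβ)
  obtain ⟨K₂, hK₂0, hK₂⟩ := exists_norm_deriv_coeff_le hL.isOpen hL.cont hL.diff hL.lim hc
  have ha := HolFamily.of_continuousOn hL.isOpen hL.diff hL.cont
  have hcoeff : ∀ x ≤ 0, ∀ p : V, ‖p‖ ≤ K₁ * Real.exp (((μ c).re - β / 2) * x) →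
      ‖deriv (a x) c p‖ ≤ K₂ * K₁ * Real.exp (((μ c).re - β / 2) * x) := by
    intro x hx p hp
    refine (ContinuousLinearMap.le_opNorm _ _).trans ?_
    rw [mul_assoc]
    exact mul_le_mul (hK₂ x hx) hp (norm_nonneg _) hK₂0
  have hd1 := HolFamily.hasDerivAt_deriv_of_linear hL.isOpen ha hL.holFamily_leftSol
    (fun lam hlam => (hL.isLeftSol_leftSol hlam).1) hc
  have hd2 := HolFamily.hasDerivAt_deriv_deriv_of_linear hL.isOpen ha hL.holFamily_leftSol
    (fun lam hlam => (hL.isLeftSol_leftSol hlam).1) hc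
  have hF := integral_Iic_of_exp_decay
    (f := fun x => pair (deriv (deriv (leftSol a am μ v x)) c) (ζ x c))
    (f' := fun x => 2 * pair (deriv (a x) c (deriv (leftSol a am μ v x) c)) (ζ x c))
    (K' := 2 * (‖pair‖ * (K₂ * K₁) * K))
    (fun x => by
      refine (hasDerivAt_pair pair (hd2 x) (h.sol c hc x)).congr_deriv ?_
      rw [ha2, zero_apply, zero_add, map_neg, map_add, add_apply, h.adj, map_smul, smul_apply,
        smul_eq_mul]
      ring)
    (half_pos hβ) (fun x hx => norm_pair_le (hK₁ x hx).2.2 (hK x hx).1)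
    (fun x hx => by
      rw [norm_mul, Complex.norm_ofNat, mul_assoc]
      exact mul_le_mul_of_nonneg_left
        (norm_pair_le (hcoeff x hx _ (hK₁ x hx).2.1) (hK x hx).1) zero_le_two)
  have hG := integral_Iic_of_exp_decay
    (f := fun x => pair (deriv (leftSol a am μ v x) c) (deriv (ζ x) c))
    (f' := fun x => pair (deriv (a x) c (leftSol a am μ v x c)) (deriv (ζ x) c)
      - pair (deriv (a x) c (deriv (leftSol a am μ v x) c)) (ζ x c))
    (K' := ‖pair‖ * (K₂ * K₁) * K + ‖pair‖ * (K₂ * K₁) * K)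
    (fun x => by
      refine (hasDerivAt_pair pair (hd1 x)
        (h.hasDerivAt_deriv_adjoint hL.isOpen hc x)).congr_deriv ?_
      rw [map_add, map_add, map_neg, map_neg, add_apply, h.adj, h.adj_deriv hL hc x (deriv _ c)]
      ring)
    (half_pos hβ) (fun x hx => norm_pair_le (hK₁ x hx).2.1 (hK x hx).2)
    (fun x hx => by
      rw [add_mul]
      exact (norm_sub_le _ _).trans (add_le_add
        (norm_pair_le (hcoeff x hx _ (hK₁ x hx).1) (hK x hx).2)
        (norm_pair_le (hcoeff x hx _ (hK₁ x hx).2.1) (hK x hx).1)))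
  have hFi : IntegrableOn
      (fun x => pair (deriv (a x) c (deriv (leftSol a am μ v x) c)) (ζ x c)) (Iic 0) := by
    refine (hF.1.const_mul (1 / 2 : ℂ)).congr (Eventually.of_forall fun x => ?_)
    simp only
    ring
  have hGi : IntegrableOn
      (fun x => pair (deriv (a x) c (leftSol a am μ v x c)) (deriv (ζ x) c)) (Iic 0) := by
    refine (hG.1.add hFi).congr (Eventually.of_forall fun x => ?_)
    simp
  refine ⟨hFi, hGi, ?_, ?_⟩
  · rw [← hF.2, integral_const_mul]
  · rw [← hG.2, integral_sub hGi hFi]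

end AdjointFamily

end Adjoint

/-! ### Matrices as operators -/

section MatrixOperators

variable {n : ℕ}

/-- A matrix as a continuous linear operator on column vectors. -/
noncomputable def matOp : Matrix (Fin n) (Fin n) ℂ →ₗ[ℂ] ((Fin n → ℂ) →L[ℂ] (Fin n → ℂ)) :=
  LinearMap.toContinuousLinearMap.toLinearMap ∘ₗ Matrix.toLin'.toLinearMap

@[simp]
lemma matOp_apply (M : Matrix (Fin n) (Fin n) ℂ) (y : Fin n → ℂ) : matOp M y = M.mulVec y := rfl

lemma matOp_one : matOp (1 : Matrix (Fin n) (Fin n) ℂ) = 1 := by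
  ext1 y
  simp

lemma continuous_matOp : Continuous (matOp (n := n)) :=
  LinearMap.continuous_of_finiteDimensional _

lemma entrySum_nonneg (M : Matrix (Fin n) (Fin n) ℂ) : 0 ≤ entrySum M :=
  Finset.sum_nonneg fun _ _ => Finset.sum_nonneg fun _ _ => norm_nonneg _

lemma norm_matOp_le (M : Matrix (Fin n) (Fin n) ℂ) : ‖matOp M‖ ≤ entrySum M := by
  refine ContinuousLinearMap.opNorm_le_bound _ (entrySum_nonneg M) fun y => ?_
  rw [matOp_apply, pi_norm_le_iff_of_nonneg (mul_nonneg (entrySum_nonneg M) (norm_nonneg _))]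
  intro i
  calc ‖M.mulVec y i‖ ≤ ∑ j, ‖M i j * y j‖ := norm_sum_le Finset.univ fun j => M i j * y j
    _ ≤ ∑ j, ‖M i j‖ * ‖y‖ := by
      refine Finset.sum_le_sum fun j _ => ?_
      rw [norm_mul]
      exact mul_le_mul_of_nonneg_left (norm_le_pi_norm y j) (norm_nonneg _)
    _ = (∑ j, ‖M i j‖) * ‖y‖ := by rw [Finset.sum_mul]
    _ ≤ entrySum M * ‖y‖ := by
      refine mul_le_mul_of_nonneg_right ?_ (norm_nonneg _)
      exact Finset.single_le_sum (f := fun i => ∑ j, ‖M i j‖)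
        (fun i _ => Finset.sum_nonneg fun j _ => norm_nonneg _) (Finset.mem_univ i)

lemma matOp_eq_sum (M : Matrix (Fin n) (Fin n) ℂ) :
    matOp M = ∑ i, ∑ j, M i j • matOp (Matrix.single i j 1) := by
  conv_lhs => rw [Matrix.matrix_eq_sum_single M]
  simp only [map_sum]
  refine Finset.sum_congr rfl fun i _ => Finset.sum_congr rfl fun j _ => ?_
  rw [← map_smul, Matrix.smul_single, smul_eq_mul, mul_one]

lemma hasDerivAt_matOp {M : ℂ → Matrix (Fin n) (Fin n) ℂ} {M' : Matrix (Fin n) (Fin n) ℂ} {z : ℂ}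
    (h : ∀ i j, HasDerivAt (fun l => M l i j) (M' i j) z) :
    HasDerivAt (fun l => matOp (M l)) (matOp M') z := by
  have h1 : (fun l => matOp (M l)) = fun l => ∑ i, ∑ j, M l i j • matOp (Matrix.single i j 1) :=
    funext fun l => matOp_eq_sum (M l)
  rw [h1, matOp_eq_sum M']
  exact HasDerivAt.fun_sum fun i _ => HasDerivAt.fun_sum fun j _ =>
    (h i j).smul_const (matOp (Matrix.single i j 1))

lemma differentiableOn_matOp {M : ℂ → Matrix (Fin n) (Fin n) ℂ} {Ω : Set ℂ} (hΩ : IsOpen Ω)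
    (h : ∀ i j, DifferentiableOn ℂ (fun l => M l i j) Ω) :
    DifferentiableOn ℂ (fun l => matOp (M l)) Ω := fun z hz =>
  (hasDerivAt_matOp (M' := Matrix.of fun i j => deriv (fun l => M l i j) z) fun i j =>
    ((h i j).differentiableAt (hΩ.mem_nhds hz)).hasDerivAt).differentiableAt.differentiableWithinAt

lemma tendstoLocallyUniformlyOn_matOp {A : ℝ → ℂ → Matrix (Fin n) (Fin n) ℂ}
    {Am : ℂ → Matrix (Fin n) (Fin n) ℂ} {Ω : Set ℂ} {l : Filter ℝ} (hΩ : IsOpen Ω)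
    (h : ∀ K ⊆ Ω, IsCompact K → ∀ i j,
      TendstoUniformlyOn (fun x lam => A x lam i j) (fun lam => Am lam i j) l K) :
    TendstoLocallyUniformlyOn (fun x lam => matOp (A x lam)) (fun lam => matOp (Am lam)) l Ω := by
  rw [tendstoLocallyUniformlyOn_iff_forall_isCompact hΩ]
  intro K hK hKc
  rw [Metric.tendstoUniformlyOn_iff]
  intro ε hε
  set ε' := ε / (n * n + 1) with hε'
  have hε'0 : 0 < ε' := by positivity
  have hall : ∀ᶠ x in l, ∀ i j, ∀ lam ∈ K, dist (Am lam i j) (A x lam i j) < ε' :=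
    eventually_all.2 fun i => eventually_all.2 fun j =>
      Metric.tendstoUniformlyOn_iff.1 (h K hK hKc i j) ε' hε'0
  filter_upwards [hall] with x hx lam hlam
  rw [dist_eq_norm, ← map_sub]
  calc _ ≤ entrySum (Am lam - A x lam) := norm_matOp_le _
    _ ≤ ∑ i : Fin n, ∑ j : Fin n, ε' := by
      refine Finset.sum_le_sum fun i _ => Finset.sum_le_sum fun j _ => ?_
      have := (hx i j lam hlam).le
      rwa [dist_eq_norm] at this
    _ = n * n * ε' := by simp [mul_assoc]
    _ < ε := by
      rw [hε', mul_div_assoc', div_lt_iff₀ (by positivity)]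
      nlinarith

/-- An algebraically simple eigenvalue has a one-dimensional eigenspace. -/
lemma exists_smul_eq_of_simple {M : Matrix (Fin n) (Fin n) ℂ} {m : ℂ} {v y : Fin n → ℂ}
    (hs : M.charpoly.rootMultiplicity m = 1) (hv : M.mulVec v = m • v) (hv0 : v ≠ 0)
    (hy : M.mulVec y = m • y) : ∃ k : ℂ, k • v = y := by
  set f : Module.End ℂ (Fin n → ℂ) := Matrix.toLin' M with hf
  have hmem : ∀ p : Fin n → ℂ, M.mulVec p = m • p → p ∈ f.eigenspace m := fun p hp => by
    rw [Module.End.mem_eigenspace_iff, hf, Matrix.toLin'_apply, hp]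
  have hle : Module.finrank ℂ (f.eigenspace m) ≤ 1 := by
    have := LinearMap.finrank_eigenspace_le f m
    rwa [hf, Matrix.charpoly_toLin', hs] at this
  let v' : f.eigenspace m := ⟨v, hmem v hv⟩
  have hv' : v' ≠ 0 := fun h => hv0 (congrArg Subtype.val h)
  have hone : Module.finrank ℂ (f.eigenspace m) = 1 :=
    le_antisymm hle (Module.finrank_pos_iff_exists_ne_zero.2 ⟨v', hv'⟩)
  obtain ⟨k, hk⟩ := (finrank_eq_one_iff_of_nonzero' v' hv').1 hone ⟨y, hmem y hy⟩
  exact ⟨k, congrArg Subtype.val hk⟩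

lemma mem_spectrum_of_mulVec {M : Matrix (Fin n) (Fin n) ℂ} {m : ℂ} {y : Fin n → ℂ}
    (hy : M.mulVec y = m • y) (hy0 : y ≠ 0) : m ∈ spectrum ℂ M := by
  rw [← Matrix.spectrum_toLin', ← Module.End.hasEigenvalue_iff_mem_spectrum]
  exact Module.End.hasEigenvalue_of_hasEigenvector
    ⟨Module.End.mem_eigenspace_iff.2 (by rw [Matrix.toLin'_apply, hy]), hy0⟩

/-- The matrix `M - μ - v w` obtained from `M - μ` by moving the eigenvalue `0` to `-1`. -/
noncomputable def deflated (M : Matrix (Fin n) (Fin n) ℂ) (m : ℂ) (v w : Fin n → ℂ) :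
    Matrix (Fin n) (Fin n) ℂ :=
  M - m • 1 - Matrix.vecMulVec v w

lemma vecMulVec_mulVec_eq (v w y : Fin n → ℂ) :
    (Matrix.vecMulVec v w).mulVec y = (w ⬝ᵥ y) • v := by
  rw [Matrix.vecMulVec_mulVec]
  ext i
  simp [mul_comm]

namespace AssumptionC

variable {Ω : Set ℂ} {M : ℂ → Matrix (Fin n) (Fin n) ℂ} {μ : ℂ → ℂ} {v w : ℂ → Fin n → ℂ}

lemma ne_zero (h : AssumptionC Ω M μ v w) {lam : ℂ} (hlam : lam ∈ Ω) : v lam ≠ 0 := by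
  intro h0
  have := h.normalized lam hlam
  simp [h0] at this

/-- All eigenvalues of the deflated matrix have negative real part. -/
lemma re_neg_of_eigenvector (h : AssumptionC Ω M μ v w) {lam : ℂ} (hlam : lam ∈ Ω) {ν : ℂ}
    {y : Fin n → ℂ} (hy0 : y ≠ 0)
    (hy : matOp (deflated (M lam) (μ lam) (v lam) (w lam)) y = ν • y) : ν.re < 0 := by
  rw [matOp_apply, deflated, Matrix.sub_mulVec, Matrix.sub_mulVec, Matrix.smul_mulVec,
    Matrix.one_mulVec, vecMulVec_mulVec_eq] at hy
  have hw : w lam ⬝ᵥ (M lam).mulVec y = μ lam * (w lam ⬝ᵥ y) := by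
    rw [Matrix.dotProduct_mulVec, h.left_eigenvector lam hlam, smul_dotProduct, smul_eq_mul]
  -- the left eigenvector separates the moved eigenvalue from the others
  have hsplit : (ν + 1) * (w lam ⬝ᵥ y) = 0 := by
    have h1 := congrArg (fun p => w lam ⬝ᵥ p) hy
    simp only [dotProduct_sub, dotProduct_smul, smul_eq_mul, hw, h.normalized lam hlam] at h1
    linear_combination -h1
  rcases mul_eq_zero.1 hsplit with hν | hwy
  · rw [eq_neg_of_add_eq_zero_left hν]
    simp
  · rw [hwy, zero_smul, sub_zero] at hy
    have hM : (M lam).mulVec y = (μ lam + ν) • y := by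
      rw [add_smul, ← hy]
      abel
    have hν0 : ν ≠ 0 := by
      rintro rfl
      rw [add_zero] at hM
      obtain ⟨k, hk⟩ := exists_smul_eq_of_simple (h.simple lam hlam)
        (h.right_eigenvector lam hlam) (h.ne_zero hlam) hM
      rw [← hk, dotProduct_smul, h.normalized lam hlam, smul_eq_mul, mul_one] at hwy
      rw [hwy, zero_smul] at hk
      exact hy0 hk.symm
    have := h.dominant lam hlam _ (mem_spectrum_of_mulVec hM hy0) (by simpa using hν0)
    simpa using this

/-- The flow of the deflated matrix decays exponentially, with the same constants for all nearby
operators. -/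
lemma exists_flow_deflated_le [Nontrivial (Fin n → ℂ)] (h : AssumptionC Ω M μ v w) {lam : ℂ}
    (hlam : lam ∈ Ω) : ∃ C α : ℝ, 0 < α ∧
      ∀ᶠ N in 𝓝 (matOp (deflated (M lam) (μ lam) (v lam) (w lam))), ∀ t : ℝ, 0 ≤ t →
        ‖expFlow N t‖ ≤ C * Real.exp (-(α * t)) := by
  obtain ⟨k, hk, hlt⟩ := exists_norm_expFlow_lt_one
    fun ν y hy0 hy => h.re_neg_of_eigenvector hlam hy0 hy
  exact eventually_norm_expFlow_le hk hlt

/-- On the range of the projection `v w` the flow of `M - μ` is constant, and on the complement it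
agrees with the flow of the deflated matrix, so it is bounded in positive time. -/
lemma exists_flow_le [Nontrivial (Fin n → ℂ)] (h : AssumptionC Ω M μ v w)
    (hM : ContinuousOn (fun lam => matOp (M lam)) Ω) (hΩ : IsOpen Ω) {c : ℂ} (hc : c ∈ Ω) :
    ∃ C, ∀ᶠ lam in 𝓝 c, ∀ t, 0 ≤ t → ‖expFlow (matOp (M lam) - μ lam • 1) t‖ ≤ C := by
  obtain ⟨C, α, hα, hN⟩ := h.exists_flow_deflated_le hc
  set P : ℂ → (Fin n → ℂ) →L[ℂ] (Fin n → ℂ) := fun lam =>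
    matOp (Matrix.vecMulVec (v lam) (w lam)) with hP
  have hPc : ContinuousAt P c := by
    refine continuous_matOp.continuousAt.comp (f := fun lam => Matrix.vecMulVec (v lam) (w lam)) ?_
    have hv := (h.analytic_right c hc).continuousAt
    have hw := (h.analytic_left c hc).continuousAt
    exact tendsto_pi_nhds.2 fun i => tendsto_pi_nhds.2 fun j =>
      (tendsto_pi_nhds.1 hv i).mul (tendsto_pi_nhds.1 hw j)
  have hdefl : ∀ lam, matOp (deflated (M lam) (μ lam) (v lam) (w lam))
      = matOp (M lam) - μ lam • 1 - P lam := fun lam => by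
    rw [deflated, map_sub, map_sub, map_smul, matOp_one]
  have hNc : ContinuousAt (fun lam => matOp (M lam) - μ lam • 1 - P lam) c :=
    ((hM.continuousAt (hΩ.mem_nhds hc)).sub
      (((h.analytic_eigenvalue c hc).continuousAt).smul continuousAt_const)).sub hPc
  rw [hdefl c] at hN
  have hC : 0 ≤ C := by
    have := (norm_nonneg _).trans (hN.self_of_nhds 0 le_rfl)
    simpa using this
  refine ⟨‖P c‖ + 1 + C * (‖(1 : (Fin n → ℂ) →L[ℂ] (Fin n → ℂ))‖ + (‖P c‖ + 1)), ?_⟩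
  filter_upwards [hNc.eventually hN, hPc.norm.eventually_lt_const (lt_add_one ‖P c‖),
    hΩ.mem_nhds hc] with lam hflow hPlam hlam t ht
  set B := matOp (M lam) - μ lam • (1 : (Fin n → ℂ) →L[ℂ] (Fin n → ℂ)) with hB
  have hBP : B * P lam = 0 := by
    ext1 y
    simp only [hB, hP, mul_apply_eq_comp, matOp_apply, vecMulVec_mulVec_eq, sub_apply, smul_apply,
      one_apply_eq_self, Matrix.mulVec_smul, h.right_eigenvector lam hlam, zero_apply]
    rw [smul_comm, sub_self]
  have hPB : P lam * B = 0 := by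
    ext1 y
    simp only [hB, hP, mul_apply_eq_comp, matOp_apply, vecMulVec_mulVec_eq, sub_apply, smul_apply,
      one_apply_eq_self, zero_apply, dotProduct_sub, dotProduct_smul, Matrix.dotProduct_mulVec,
      h.left_eigenvector lam hlam, smul_dotProduct, sub_self, zero_smul]
  have hPP : P lam * P lam = P lam := by
    ext1 y
    simp only [hP, mul_apply_eq_comp, matOp_apply, vecMulVec_mulVec_eq, dotProduct_smul,
      h.normalized lam hlam, smul_eq_mul, mul_one]
  have h1 : expFlow B t * P lam = P lam := by
    have := expFlow_mul_eq_of_mul_eq (a := B) (b := 0) (q := P lam) (by rw [hBP, zero_mul])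
      (Commute.zero_left _) t
    rw [this]
    simp [expFlow]
  have h2 : expFlow B t * (1 - P lam) = expFlow (B - P lam) t * (1 - P lam) := by
    refine expFlow_mul_eq_of_mul_eq ?_ ?_ t
    · rw [sub_mul B, mul_sub (P lam), hPP, mul_one, sub_self, sub_zero]
    · change (B - P lam) * (1 - P lam) = (1 - P lam) * (B - P lam)
      simp only [sub_mul, mul_sub, hBP, hPB, one_mul, mul_one]
      abel
  have h3 : expFlow B t = P lam + expFlow (B - P lam) t * (1 - P lam) := by
    rw [← h2, mul_sub, h1, mul_one]
    abel
  have h4 : ‖expFlow (B - P lam) t‖ ≤ C :=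
    (hflow t ht).trans (mul_le_of_le_one_right hC (Real.exp_le_one_iff.2 (by
      have := mul_nonneg hα.le ht
      linarith)))
  rw [h3]
  calc _ ≤ ‖P lam‖ + ‖expFlow (B - P lam) t‖ * ‖1 - P lam‖ :=
        (norm_add_le _ _).trans (add_le_add_right (norm_mul_le _ _) _)
    _ ≤ (‖P c‖ + 1) + C * (‖(1 : (Fin n → ℂ) →L[ℂ] (Fin n → ℂ))‖ + (‖P c‖ + 1)) := by
      have := norm_sub_le (1 : (Fin n → ℂ) →L[ℂ] (Fin n → ℂ)) (P lam)
      gcongr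
      linarith

/-- The transposed matrices have the left and right eigenvectors interchanged. -/
lemma transpose (h : AssumptionC Ω M μ v w) :
    AssumptionC Ω (fun lam => (M lam).transpose) μ w v where
  simple lam hlam := by rw [Matrix.charpoly_transpose]; exact h.simple lam hlam
  dominant lam hlam ν hν hne := by
    rw [Matrix.mem_spectrum_iff_isRoot_charpoly, Matrix.charpoly_transpose,
      ← Matrix.mem_spectrum_iff_isRoot_charpoly] at hν
    exact h.dominant lam hlam ν hν hne
  analytic_eigenvalue := h.analytic_eigenvalue
  analytic_right := h.analytic_left
  analytic_left := h.analytic_right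
  right_eigenvector lam hlam := by rw [Matrix.mulVec_transpose, h.left_eigenvector lam hlam]
  left_eigenvector lam hlam := by rw [Matrix.vecMul_transpose, h.right_eigenvector lam hlam]
  normalized lam hlam := by rw [dotProduct_comm, h.normalized lam hlam]

end AssumptionC

end MatrixOperators

/-! ### The two ends of the system -/

section Ends

variable {n : ℕ}

/-- The hypotheses on a matrix system at the end `x = -∞`, with `∫ |A - A₋| dx` over `(-∞, 0]` only
bounded on compact sets of parameters. -/
structure MatrixLeftEnd (Ω : Set ℂ) (A : ℝ → ℂ → Matrix (Fin n) (Fin n) ℂ)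
    (Am : ℂ → Matrix (Fin n) (Fin n) ℂ) (μ : ℂ → ℂ) (v w : ℂ → Fin n → ℂ) : Prop where
  isOpen : IsOpen Ω
  cont : ContinuousOn (fun p : ℝ × ℂ => A p.1 p.2) (univ ×ˢ Ω)
  diff : ∀ x i j, DifferentiableOn ℂ (fun lam => A x lam i j) Ω
  lim : ∀ K ⊆ Ω, IsCompact K → ∀ i j,
    TendstoUniformlyOn (fun x lam => A x lam i j) (fun lam => Am lam i j) atBot K
  eig : AssumptionC Ω Am μ v w
  integrable : ∀ lam ∈ Ω, IntegrableOn (fun x => entrySum (A x lam - Am lam)) (Iic 0)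
  bounded : ∀ K ⊆ Ω, IsCompact K →
    ∃ M, ∀ lam ∈ K, ∫ x in Iic (0 : ℝ), entrySum (A x lam - Am lam) ≤ M

/-- The family of operators of a family of matrices. -/
noncomputable def opFam (A : ℝ → ℂ → Matrix (Fin n) (Fin n) ℂ) (x : ℝ) (lam : ℂ) :
    (Fin n → ℂ) →L[ℂ] (Fin n → ℂ) :=
  matOp (A x lam)

lemma MatrixLeftEnd.leftEnd [Nontrivial (Fin n → ℂ)] {Ω : Set ℂ}
    {A : ℝ → ℂ → Matrix (Fin n) (Fin n) ℂ} {Am : ℂ → Matrix (Fin n) (Fin n) ℂ} {μ : ℂ → ℂ}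
    {v w : ℂ → Fin n → ℂ} (h : MatrixLeftEnd Ω A Am μ v w) :
    LeftEnd Ω (opFam A) (fun lam => matOp (Am lam)) μ v := by
  have hcont : ContinuousOn (fun p : ℝ × ℂ => opFam A p.1 p.2) (univ ×ˢ Ω) :=
    continuous_matOp.comp_continuousOn h.cont
  have hdiff : ∀ x, DifferentiableOn ℂ (opFam A x) Ω := fun x =>
    differentiableOn_matOp h.isOpen (h.diff x)
  have hlim := tendstoLocallyUniformlyOn_matOp h.isOpen h.lim
  have hAm : ContinuousOn (fun lam => matOp (Am lam)) Ω :=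
    (hlim.differentiableOn (Eventually.of_forall hdiff) h.isOpen).continuousOn
  have hE : ∀ lam ∈ Ω, Continuous fun x => opFam A x lam - matOp (Am lam) := fun lam hlam =>
    (hcont.comp_continuous (continuous_id.prodMk continuous_const)
      fun x => ⟨mem_univ _, hlam⟩).sub continuous_const
  have hle : ∀ x lam, ‖opFam A x lam - matOp (Am lam)‖ ≤ entrySum (A x lam - Am lam) :=
    fun x lam => by
      rw [opFam, ← map_sub]
      exact norm_matOp_le _
  have hint : ∀ lam ∈ Ω, IntegrableOn (fun x => opFam A x lam - matOp (Am lam)) (Iic 0) :=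
    fun lam hlam => (h.integrable lam hlam).mono' (hE lam hlam).aestronglyMeasurable
      (Eventually.of_forall fun x => hle x lam)
  refine ⟨h.isOpen, hcont, hdiff, hlim, hint, fun K hK hKc => ?_,
    h.eig.analytic_eigenvalue.differentiableOn, h.eig.analytic_right.differentiableOn,
    fun lam hlam => by rw [matOp_apply, h.eig.right_eigenvector lam hlam],
    fun c hc => h.eig.exists_flow_le hAm h.isOpen hc⟩
  obtain ⟨M, hM⟩ := h.bounded K hK hKc
  exact ⟨M, fun lam hlam => (integral_mono (hint lam (hK hlam)).norm
    (h.integrable lam (hK hlam)) fun x => hle x lam).trans (hM lam hlam)⟩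

/-- The reflected transposed system: if `ζ' = -A(x)ᵀ ζ`, then `s ↦ ζ(-s)` solves the system with
coefficients `A(-s)ᵀ`. It interchanges the two ends. -/
def reflect (A : ℝ → ℂ → Matrix (Fin n) (Fin n) ℂ) (x : ℝ) (lam : ℂ) : Matrix (Fin n) (Fin n) ℂ :=
  (A (-x) lam).transpose

lemma reflect_reflect (A : ℝ → ℂ → Matrix (Fin n) (Fin n) ℂ) : reflect (reflect A) = A := by
  funext x lam
  simp [reflect]

lemma entrySum_transpose (M : Matrix (Fin n) (Fin n) ℂ) : entrySum M.transpose = entrySum M :=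
  Finset.sum_comm

lemma continuous_entrySum : Continuous (entrySum (n := n)) :=
  continuous_finsetSum _ fun i _ => continuous_finsetSum _ fun j _ =>
    ((continuous_apply j).comp (continuous_apply i)).norm

/-- Uniform smallness of the tails of an integral gives local uniform boundedness of the integral
over the half-line `(-∞, 0]`. -/
lemma exists_integral_Iic_le {K : Set ℂ} (hK : IsCompact K) {f e : ℝ → ℂ → ℝ}
    (hf : ContinuousOn (fun p : ℝ × ℂ => f p.1 p.2) (univ ×ˢ K))
    (hfe : ∀ x < 0, ∀ lam, f x lam = e x lam) (he0 : ∀ x lam, 0 ≤ e x lam)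
    (he : ∀ lam ∈ K, Integrable fun x => e x lam)
    (hR : ∃ R : ℝ, ∀ lam ∈ K, ∫ x in {x : ℝ | R < |x|}, e x lam < 1) :
    (∀ lam ∈ K, IntegrableOn (fun x => f x lam) (Iic 0)) ∧
      ∃ M, ∀ lam ∈ K, ∫ x in Iic (0 : ℝ), f x lam ≤ M := by
  have hint : ∀ lam ∈ K, IntegrableOn (fun x => f x lam) (Iic 0) := by
    intro lam hlam
    rw [integrableOn_Iic_iff_integrableOn_Iio]
    exact (he lam hlam).integrableOn.congr_fun (fun x hx => (hfe x hx lam).symm) measurableSet_Iio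
  refine ⟨hint, ?_⟩
  obtain ⟨R, hR⟩ := hR
  set S := max R 0 with hS
  obtain ⟨C, hC⟩ := ((isCompact_Icc (a := -S) (b := 0)).prod hK).exists_bound_of_continuousOn
    (hf.mono (prod_mono (subset_univ _) subset_rfl))
  refine ⟨1 + C * volume.real (Icc (-S) 0), fun lam hlam => ?_⟩
  have hS0 : -S ≤ 0 := by simp [hS]
  have hdisj : Disjoint (Iio (-S)) (Icc (-S) 0) :=
    disjoint_left.2 fun x hx hx' => not_lt.2 hx'.1 hx
  have hi := hint lam hlam
  rw [← Iio_union_Icc_eq_Iic hS0] at hi ⊢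
  rw [setIntegral_union hdisj measurableSet_Icc hi.left_of_union hi.right_of_union]
  refine add_le_add ?_ ?_
  · rw [setIntegral_congr_fun (g := fun x => e x lam) measurableSet_Iio
      fun x hx => hfe x (lt_of_lt_of_le hx hS0) lam]
    refine (setIntegral_mono_set (he lam hlam).integrableOn
      (Eventually.of_forall fun x => he0 x lam) (LE.le.eventuallyLE fun x hx => ?_)).trans
        (hR lam hlam).le
    have hx' : x < -S := hx
    have h1 : R ≤ S := le_max_left _ _
    change R < |x|
    rw [abs_of_neg (by linarith)]
    linarith
  · refine (le_abs_self _).trans (norm_setIntegral_le_of_norm_le_const measure_Icc_lt_top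
      fun x hx => hC (x, lam) ⟨hx, hlam⟩)

variable {I : Set ℝ} {Ω : Set ℂ} {A : ℝ → ℂ → Matrix (Fin n) (Fin n) ℂ}
  {Am Ap : ℂ → Matrix (Fin n) (Fin n) ℂ} {μm μp : ℂ → ℂ} {vm wm vp wp : ℂ → Fin n → ℂ}

/-- Continuity in both variables of the entries of `A(x;λ) - A₋(λ)`. -/
lemma continuousOn_entrySum_sub (hΩ : IsOpen Ω)
    (hcont : ContinuousOn (fun p : ℝ × ℂ => A p.1 p.2) (univ ×ˢ Ω))
    (hdiff : ∀ x i j, DifferentiableOn ℂ (fun lam => A x lam i j) Ω) {l : Filter ℝ} [l.NeBot]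
    (hlim : ∀ K ⊆ Ω, IsCompact K → ∀ i j,
      TendstoUniformlyOn (fun x lam => A x lam i j) (fun lam => Am lam i j) l K) :
    ContinuousOn (fun p : ℝ × ℂ => entrySum (A p.1 p.2 - Am p.2)) (univ ×ˢ Ω) := by
  have hAm : ContinuousOn Am Ω := continuousOn_pi.2 fun i => continuousOn_pi.2 fun j =>
    (((tendstoLocallyUniformlyOn_iff_forall_isCompact hΩ).2
      fun K hK hKc => hlim K hK hKc i j).differentiableOn
        (Eventually.of_forall fun x => hdiff x i j) hΩ).continuousOn
  exact continuous_entrySum.comp_continuousOn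
    (hcont.sub (hAm.comp continuousOn_snd fun p hp => hp.2))

lemma matrixLeftEnd_minus (hA : AssumptionA I Ω A) (hB : AssumptionB Ω A Am Ap)
    (hC : AssumptionC Ω Am μm vm wm) (hD : AssumptionD Ω A Am Ap) :
    MatrixLeftEnd Ω A Am μm vm wm := by
  have hdiff : ∀ x i j, DifferentiableOn ℂ (fun lam => A x lam i j) Ω := fun x i j =>
    (hA.analytic x i j).differentiableOn
  have hcont := continuousOn_entrySum_sub hA.domain_open hA.continuous hdiff hB.atMinus
  have key : ∀ K ⊆ Ω, IsCompact K → _ := fun K hK hKc =>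
    exists_integral_Iic_le (f := fun x lam => entrySum (A x lam - Am lam))
      (e := fun x lam => entrySum (deviation A Am Ap x lam)) hKc
      (hcont.mono (prod_mono subset_rfl hK)) (fun x hx lam => by simp [deviation, hx])
      (fun x lam => entrySum_nonneg _) (fun lam hlam => hD.finite lam (hK hlam))
      (hD.uniform K hK hKc 1 one_pos)
  exact ⟨hA.domain_open, hA.continuous, hdiff, hB.atMinus, hC,
    fun lam hlam => (key {lam} (singleton_subset_iff.2 hlam) isCompact_singleton).1 lam rfl,
    fun K hK hKc => (key K hK hKc).2⟩

lemma matrixLeftEnd_plus (hA : AssumptionA I Ω A) (hB : AssumptionB Ω A Am Ap)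
    (hC : AssumptionC Ω Ap μp vp wp) (hD : AssumptionD Ω A Am Ap) :
    MatrixLeftEnd Ω (reflect A) (fun lam => (Ap lam).transpose) μp wp vp := by
  have hdiff : ∀ x i j, DifferentiableOn ℂ (fun lam => reflect A x lam i j) Ω := fun x i j =>
    (hA.analytic (-x) j i).differentiableOn
  have hcontA : ContinuousOn (fun p : ℝ × ℂ => reflect A p.1 p.2) (univ ×ˢ Ω) := by
    have h1 : ContinuousOn (fun p : ℝ × ℂ => A (-p.1) p.2) (univ ×ˢ Ω) :=
      hA.continuous.comp (f := fun p : ℝ × ℂ => (-p.1, p.2)) (by fun_prop)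
        fun p hp => ⟨mem_univ _, hp.2⟩
    exact (continuous_id.matrix_transpose).comp_continuousOn h1
  have hlim : ∀ K ⊆ Ω, IsCompact K → ∀ i j, TendstoUniformlyOn (fun x lam => reflect A x lam i j)
      (fun lam => (Ap lam).transpose i j) atBot K := fun K hK hKc i j => by
    have h1 := hB.atPlus K hK hKc j i
    rw [Metric.tendstoUniformlyOn_iff] at h1 ⊢
    exact fun ε hε => tendsto_neg_atBot_atTop.eventually (h1 ε hε)
  have hcont := continuousOn_entrySum_sub hA.domain_open hcontA hdiff hlim
  have key : ∀ K ⊆ Ω, IsCompact K → _ := fun K hK hKc =>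
    exists_integral_Iic_le
      (f := fun x lam => entrySum (reflect A x lam - (Ap lam).transpose))
      (e := fun x lam => entrySum (deviation A Am Ap (-x) lam)) hKc
      (hcont.mono (prod_mono subset_rfl hK))
      (fun x hx lam => by
        have hx' : ¬(-x < 0) := by linarith
        rw [deviation, if_neg hx', reflect, ← Matrix.transpose_sub, entrySum_transpose])
      (fun x lam => entrySum_nonneg _) (fun lam hlam => (hD.finite lam (hK hlam)).comp_neg)
      (by
        obtain ⟨R, hR⟩ := hD.uniform K hK hKc 1 one_pos
        refine ⟨R, fun lam hlam => ?_⟩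
        have hmeas : MeasurableSet {x : ℝ | R < |x|} :=
          measurableSet_lt measurable_const measurable_norm
        have h1 := hR lam hlam
        rw [← integral_indicator hmeas, ← integral_neg_eq_self] at h1
        rw [← integral_indicator hmeas]
        convert! h1 using 3 with x
        simp [indicator])
  exact ⟨hA.domain_open, hcontA, hdiff, hlim, hC.transpose,
    fun lam hlam => (key {lam} (singleton_subset_iff.2 hlam) isCompact_singleton).1 lam rfl,
    fun K hK hKc => (key K hK hKc).2⟩

end Ends

/-! ### Forms of degree `n - 1` as row vectors -/

section Covector

variable {n : ℕ}

/-- The row vector `ζ` that represents the `(n-1)`-form `𝒱`, that is, `v ∧ 𝒱 = ζ v`. Its inverse is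
`tildeVector`. -/
noncomputable def covector : (Fin n → ℂ) ≃L[ℂ] (Fin n → ℂ) :=
  LinearEquiv.toContinuousLinearEquiv
    { toFun := fun V i => (-1 : ℂ) ^ (i : ℕ) * V i.rev
      invFun := tildeVector
      map_add' := fun V V' => by ext i; simp [mul_add]
      map_smul' := fun k V => by
        ext i
        simp only [Pi.smul_apply, smul_eq_mul, RingHom.id_apply]
        ring
      left_inv := fun V => by
        ext i
        simp only [tildeVector, Fin.rev_rev]
        rw [← mul_assoc, ← mul_pow]
        simp
      right_inv := fun w => by
        ext i
        simp only [tildeVector, Fin.rev_rev]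
        rw [← mul_assoc, ← mul_pow]
        simp }

lemma covector_apply (V : Fin n → ℂ) (i : Fin n) : covector V i = (-1 : ℂ) ^ (i : ℕ) * V i.rev :=
  rfl

lemma covector_tildeVector (w : Fin n → ℂ) : covector (tildeVector w) = w :=
  covector.apply_symm_apply w

/-- The bilinear pairing of row and column vectors. -/
noncomputable def dotPair : (Fin n → ℂ) →L[ℂ] (Fin n → ℂ) →L[ℂ] ℂ :=
  (dotProductBilin ℂ ℂ).toContinuousBilinearMap

lemma dotPair_apply (p q : Fin n → ℂ) : dotPair p q = p ⬝ᵥ q := rfl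

lemma dotPair_comm (p q : Fin n → ℂ) : dotPair p q = dotPair q p := dotProduct_comm p q

lemma wedge_eq_dotPair (v V : Fin n → ℂ) : wedge v V = dotPair v (covector V) := by
  rw [dotPair_apply, wedge, dotProduct]
  refine Finset.sum_congr rfl fun i _ => ?_
  rw [covector_apply]
  ring

lemma dotPair_matOp (M : Matrix (Fin n) (Fin n) ℂ) (p q : Fin n → ℂ) :
    dotPair (matOp M p) q = dotPair p (matOp M.transpose q) := by
  rw [dotPair_apply, dotPair_apply, matOp_apply, matOp_apply, Matrix.mulVec_transpose,
    dotProduct_comm, Matrix.dotProduct_mulVec, dotProduct_comm]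

/-- On row vectors the matrix `Ã` acts as `-Aᵀ`. -/
lemma covector_tildeMatrix_mulVec (M : Matrix (Fin n) (Fin n) ℂ) (V : Fin n → ℂ) :
    covector ((tildeMatrix M).mulVec V) = -(matOp M.transpose (covector V)) := by
  ext i
  rw [covector_apply, Pi.neg_apply, matOp_apply, Matrix.mulVec, Matrix.mulVec, dotProduct,
    dotProduct, Finset.mul_sum, ← Equiv.sum_comp Fin.revPerm, ← Finset.sum_neg_distrib]
  refine Finset.sum_congr rfl fun j _ => ?_
  simp only [Fin.revPerm_apply, tildeMatrix, Matrix.of_apply, Fin.rev_rev, Matrix.transpose_apply,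
    covector_apply]
  have hsign : (-1 : ℂ) ^ (i : ℕ) * (-1) ^ ((i.rev : ℕ) + (j.rev : ℕ) + 1) = -(-1) ^ (j : ℕ) := by
    have hi : (i : ℕ) + i.rev = j + j.rev := by
      rw [Fin.val_rev, Fin.val_rev]
      omega
    have he : (i : ℕ) + ((i.rev : ℕ) + (j.rev : ℕ) + 1) = j + 1 + (j.rev + j.rev) := by omega
    rw [← pow_add, he, pow_add _ _ ((j.rev : ℕ) + j.rev), Even.neg_one_pow ⟨_, rfl⟩, mul_one,
      pow_succ]
    ring
  rw [← mul_assoc, ← mul_assoc, hsign]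
  ring

/-- Passing to row vectors and reflecting `x` turns the solutions selected at `+∞` into solutions
selected at `-∞`. -/
lemma isYTildePlus_iff (A : ℝ → ℂ → Matrix (Fin n) (Fin n) ℂ) (μ : ℂ → ℂ) (w : ℂ → Fin n → ℂ)
    (lam : ℂ) (Y : ℝ → Fin n → ℂ) : IsYTildePlus A μ w lam Y ↔
      IsLeftSol (opFam (reflect A)) μ w lam fun s => covector (Y (-s)) := by
  refine and_congr ⟨fun h x => ?_, fun h x => ?_⟩ ?_
  · have h1 := ((covector.toContinuousLinearMap.restrictScalars ℝ).hasFDerivAt.comp_hasDerivAt (-x)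
      (h (-x))).scomp x (hasDerivAt_neg x)
    refine h1.congr_deriv ?_
    rw [neg_smul, one_smul]
    change -covector ((tildeMatrix (A (-x) lam)).mulVec (Y (-x))) = _
    rw [covector_tildeMatrix_mulVec, neg_neg]
    rfl
  · have h1 := ((covector.symm.toContinuousLinearMap.restrictScalars ℝ).hasFDerivAt.comp_hasDerivAt
      (-x) (h (-x))).scomp x (hasDerivAt_neg x)
    have h2 : (fun s => covector.symm (covector (Y (- -s)))) = Y := by
      funext s
      rw [neg_neg, ContinuousLinearEquiv.symm_apply_apply]
    have h3 : HasDerivAt (fun s => covector.symm (covector (Y (- -s))))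
      ((-1 : ℝ) • covector.symm (opFam (reflect A) (-x) lam (covector (Y (- -x))))) x := h1
    rw [h2] at h3
    refine h3.congr_deriv ?_
    rw [neg_smul, one_smul, neg_neg, ← map_neg, ContinuousLinearEquiv.symm_apply_eq,
      covector_tildeMatrix_mulVec, opFam, reflect, neg_neg]
  · have h0 : (fun s : ℝ => Complex.exp (-(μ lam * s)) • covector (Y (-s)))
        = fun s => covector ((fun x : ℝ => Complex.exp (μ lam * x) • Y x) (-s)) := by
      funext s
      rw [map_smul]
      push_cast
      rw [mul_neg]
    rw [h0]
    constructor
    · intro h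
      have h1 := (covector.continuous.tendsto _).comp (h.comp tendsto_neg_atBot_atTop)
      rwa [covector_tildeVector] at h1
    · intro h
      have h1 := (covector.symm.continuous.tendsto _).comp (h.comp tendsto_neg_atTop_atBot)
      refine h1.congr fun x => ?_
      simp only [Function.comp_apply, ContinuousLinearEquiv.symm_apply_apply, neg_neg]

end Covector

/-! ### The derivatives of the Evans function -/

section Evans

variable {n : ℕ} {Ω : Set ℂ} {A : ℝ → ℂ → Matrix (Fin n) (Fin n) ℂ}
  {Am Bm : ℂ → Matrix (Fin n) (Fin n) ℂ} {μm μp : ℂ → ℂ} {vm wm vp wp : ℂ → Fin n → ℂ}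

/-- The solutions selected at `+∞`, written as row vectors, form an adjoint family for the system at
the end `-∞`. -/
lemma MatrixLeftEnd.adjointFamily [Nontrivial (Fin n → ℂ)] (hm : MatrixLeftEnd Ω A Am μm vm wm)
    (hp : MatrixLeftEnd Ω (reflect A) Bm μp wp vp) {c : ℂ} (hc : c ∈ Ω) :
    AdjointFamily dotPair Ω (opFam A) μm vm (fun x lam => matOp (A x lam).transpose)
      (fun lam => matOp (Am lam).transpose)
      (fun x => leftSol (opFam (reflect A)) (fun lam => matOp (Bm lam)) μp wp (-x)) c where
  adj x lam p q := dotPair_matOp _ p q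
  cont := (continuous_matOp.comp continuous_id.matrix_transpose).comp_continuousOn hm.cont
  diff x := differentiableOn_matOp hm.isOpen fun i j => hm.diff x j i
  lim := tendstoLocallyUniformlyOn_matOp hm.isOpen fun K hK hKc i j => hm.lim K hK hKc j i
  sol lam hlam x := by
    have h1 := ((hp.leftEnd.isLeftSol_leftSol hlam).1 (-x)).scomp x (hasDerivAt_neg x)
    refine h1.congr_deriv ?_
    rw [neg_smul, one_smul, opFam, reflect, neg_neg]
  fam := hp.leftEnd.holFamily_leftSol.comp_neg
  hurwitz := by
    obtain ⟨C, α, hα, hflow⟩ := hm.eig.transpose.exists_flow_deflated_le hc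
    refine ⟨wm c, _, C, α, hα, hflow.self_of_nhds, fun q => ?_⟩
    rw [deflated, map_sub, map_sub, map_smul, matOp_one, sub_apply, sub_apply, smul_apply,
      one_apply_eq_self, matOp_apply (Matrix.vecMulVec _ _), vecMulVec_mulVec_eq, dotPair_apply]
    abel

lemma deriv_opFam (hΩ : IsOpen Ω) (h : ∀ x i j, DifferentiableOn ℂ (fun lam => A x lam i j) Ω)
    (x : ℝ) {lam : ℂ} (hlam : lam ∈ Ω) : deriv (opFam A x) lam = matOp (dLam A x lam) :=
  (hasDerivAt_matOp fun i j => ((h x i j).differentiableAt (hΩ.mem_nhds hlam)).hasDerivAt).deriv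

lemma deriv_deriv_opFam (hΩ : IsOpen Ω)
    (h : ∀ x i j, DifferentiableOn ℂ (fun lam => A x lam i j) Ω) (x : ℝ) {lam : ℂ}
    (hlam : lam ∈ Ω) : deriv (deriv (opFam A x)) lam = matOp (dLam (dLam A) x lam) := by
  have h1 : deriv (opFam A x) =ᶠ[𝓝 lam] opFam (dLam A) x := by
    filter_upwards [hΩ.mem_nhds hlam] with l hl using deriv_opFam hΩ h x hl
  rw [h1.deriv_eq, deriv_opFam (A := dLam A) hΩ (fun x i j => (h x i j).deriv hΩ) x hlam]

/-- The integral over `ℝ` from the integrals of `F(x)` and `F(-x)` over `(-∞, 0]`. -/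
lemma integrable_of_halves {F G : ℝ → ℂ} (hFG : ∀ x, G x = F (-x)) (h1 : IntegrableOn F (Iic 0))
    (h2 : IntegrableOn G (Iic 0)) :
    Integrable F ∧ ∫ x, F x = (∫ x in Iic (0 : ℝ), F x) + ∫ x in Iic (0 : ℝ), G x := by
  have hG : G = fun x => F (-x) := funext hFG
  have h3 : IntegrableOn F (Ioi 0) := by
    have h4 : IntegrableOn G (Iio 0) := h2.mono_set Iio_subset_Iic_self
    rw [← neg_zero] at h4
    have h5 := h4.comp_neg_Ioi
    rw [hG] at h5
    simpa using h5
  refine ⟨?_, ?_⟩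
  · rw [← integrableOn_univ, ← Iic_union_Ioi (a := (0 : ℝ))]
    exact h1.union h3
  · rw [hG, integral_comp_neg_Iic, neg_zero, intervalIntegral.integral_Iic_add_Ioi h1 h3]

namespace MatrixLeftEnd

variable [Nontrivial (Fin n → ℂ)]

lemma existsUnique_isEtaMinus (hm : MatrixLeftEnd Ω A Am μm vm wm) {lam : ℂ} (hlam : lam ∈ Ω) :
    ∃! y, IsEtaMinus A μm vm lam y :=
  ⟨_, hm.leftEnd.isLeftSol_leftSol hlam, fun _ hy => hm.leftEnd.eq_leftSol hlam hy⟩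

lemma etaMinus_eq (hm : MatrixLeftEnd Ω A Am μm vm wm) {lam : ℂ} (hlam : lam ∈ Ω) (x : ℝ) :
    etaMinus A μm vm x lam = leftSol (opFam A) (fun lam => matOp (Am lam)) μm vm x lam :=
  congrFun (hm.leftEnd.eq_leftSol hlam
    (Classical.epsilon_spec (hm.existsUnique_isEtaMinus hlam).exists)) x

lemma existsUnique_isYTildePlus (hp : MatrixLeftEnd Ω (reflect A) Bm μp wp vp) {lam : ℂ}
    (hlam : lam ∈ Ω) : ∃! Y, IsYTildePlus A μp wp lam Y := by
  have hsol := hp.leftEnd.isLeftSol_leftSol hlam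
  refine ⟨fun x => covector.symm (leftSol (opFam (reflect A)) (fun lam => matOp (Bm lam)) μp wp (-x)
    lam), ?_, fun Y hY => ?_⟩
  · refine (isYTildePlus_iff _ _ _ _ _).2 ?_
    simpa using hsol
  · have h1 := hp.leftEnd.eq_leftSol hlam ((isYTildePlus_iff _ _ _ _ _).1 hY)
    funext x
    have h2 := congrFun h1 (-x)
    simp only [neg_neg] at h2
    rw [← h2, ContinuousLinearEquiv.symm_apply_apply]

lemma yTildePlus_eq (hp : MatrixLeftEnd Ω (reflect A) Bm μp wp vp) {lam : ℂ} (hlam : lam ∈ Ω)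
    (x : ℝ) : yTildePlus A μp wp x lam = covector.symm
      (leftSol (opFam (reflect A)) (fun lam => matOp (Bm lam)) μp wp (-x) lam) := by
  have h1 := hp.leftEnd.eq_leftSol hlam ((isYTildePlus_iff _ _ _ _ _).1
    (Classical.epsilon_spec (hp.existsUnique_isYTildePlus hlam).exists))
  have h2 := congrFun h1 (-x)
  simp only [neg_neg] at h2
  rw [← h2, ContinuousLinearEquiv.symm_apply_apply]
  rfl

lemma deriv_etaMinus (hm : MatrixLeftEnd Ω A Am μm vm wm) {c : ℂ} (hc : c ∈ Ω) (x : ℝ) :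
    deriv (etaMinus A μm vm x) c
      = deriv (leftSol (opFam A) (fun lam => matOp (Am lam)) μm vm x) c := by
  refine EventuallyEq.deriv_eq ?_
  filter_upwards [hm.isOpen.mem_nhds hc] with l hl using hm.etaMinus_eq hl x

lemma deriv_yTildePlus (hp : MatrixLeftEnd Ω (reflect A) Bm μp wp vp) {c : ℂ} (hc : c ∈ Ω) (x : ℝ) :
    deriv (yTildePlus A μp wp x) c = covector.symm
      (deriv (leftSol (opFam (reflect A)) (fun lam => matOp (Bm lam)) μp wp (-x)) c) := by
  have h1 : yTildePlus A μp wp x =ᶠ[𝓝 c] fun l => covector.symm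
      (leftSol (opFam (reflect A)) (fun lam => matOp (Bm lam)) μp wp (-x) l) := by
    filter_upwards [hp.isOpen.mem_nhds hc] with l hl using hp.yTildePlus_eq hl x
  rw [h1.deriv_eq]
  exact (covector.symm.toContinuousLinearMap.hasFDerivAt.comp_hasDerivAt c
    ((hp.leftEnd.differentiableOn_leftSol (-x)).differentiableAt
      (hp.isOpen.mem_nhds hc)).hasDerivAt).deriv

/-- The Evans function as a pairing of row and column vectors, at any `x`. -/
lemma wedge_eq (hm : MatrixLeftEnd Ω A Am μm vm wm) (hp : MatrixLeftEnd Ω (reflect A) Bm μp wp vp)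
    {lam : ℂ} (hlam : lam ∈ Ω) (x : ℝ) :
    wedge (etaMinus A μm vm x lam) (yTildePlus A μp wp x lam)
      = dotPair (leftSol (opFam A) (fun lam => matOp (Am lam)) μm vm x lam)
        (leftSol (opFam (reflect A)) (fun lam => matOp (Bm lam)) μp wp (-x) lam) := by
  rw [wedge_eq_dotPair, hm.etaMinus_eq hlam, hp.yTildePlus_eq hlam,
    ContinuousLinearEquiv.apply_symm_apply]

end MatrixLeftEnd

end Evans

end EvansODE

theorem mainTheorem6 (n : ℕ) (hn : 2 ≤ n) (I : Set ℝ) (hI0 : (0 : ℝ) ∈ I) (Ω : Set ℂ)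
    (A : ℝ → ℂ → Matrix (Fin n) (Fin n) ℂ)
    (Am Ap : ℂ → Matrix (Fin n) (Fin n) ℂ)
    (μm μp : ℂ → ℂ) (vm wm vp wp : ℂ → Fin n → ℂ)
    (hA : EvansODE.AssumptionA I Ω A)
    (hB : EvansODE.AssumptionB Ω A Am Ap)
    (hCm : EvansODE.AssumptionC Ω Am μm vm wm)
    (hCp : EvansODE.AssumptionC Ω Ap μp vp wp)
    (hD : EvansODE.AssumptionD Ω A Am Ap)
    (hA2 : ∀ x : ℝ, EvansODE.dLam (EvansODE.dLam A) x 0 = 0) :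
    -- the objects in the formulas are well defined and analytic in the spectral parameter
    (∀ lam ∈ Ω, ∃! y : ℝ → Fin n → ℂ, EvansODE.IsEtaMinus A μm vm lam y) ∧
    (∀ lam ∈ Ω, ∃! Y : ℝ → Fin n → ℂ, EvansODE.IsYTildePlus A μp wp lam Y) ∧
    (∀ x : ℝ, AnalyticOnNhd ℂ (EvansODE.etaMinus A μm vm x) Ω) ∧
    (∀ x : ℝ, AnalyticOnNhd ℂ (EvansODE.yTildePlus A μp wp x) Ω) ∧
    (∀ lam ∈ Ω, ∀ x : ℝ,
      EvansODE.wedge (EvansODE.etaMinus A μm vm x lam) (EvansODE.yTildePlus A μp wp x lam)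
        = EvansODE.evans A μm μp vm wp lam) ∧
    AnalyticOnNhd ℂ (EvansODE.evans A μm μp vm wp) Ω ∧
    -- the formulas for the first and second derivative
    (EvansODE.evans A μm μp vm wp 0 = 0 →
      (Integrable (fun x : ℝ => EvansODE.wedge
          ((EvansODE.dLam A x 0).mulVec (EvansODE.etaMinus A μm vm x 0))
          (EvansODE.yTildePlus A μp wp x 0)) ∧
        deriv (EvansODE.evans A μm μp vm wp) 0 =
          ∫ x : ℝ, EvansODE.wedge
            ((EvansODE.dLam A x 0).mulVec (EvansODE.etaMinus A μm vm x 0))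
            (EvansODE.yTildePlus A μp wp x 0)) ∧
      (deriv (EvansODE.evans A μm μp vm wp) 0 = 0 →
        Integrable (fun x : ℝ => EvansODE.wedge
          ((EvansODE.dLam A x 0).mulVec (deriv (EvansODE.etaMinus A μm vm x) 0))
          (EvansODE.yTildePlus A μp wp x 0)) ∧
        Integrable (fun x : ℝ => EvansODE.wedge
          ((EvansODE.dLam A x 0).mulVec (EvansODE.etaMinus A μm vm x 0))
          (deriv (EvansODE.yTildePlus A μp wp x) 0)) ∧
        deriv (deriv (EvansODE.evans A μm μp vm wp)) 0 =
          (∫ x : ℝ, EvansODE.wedge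
            ((EvansODE.dLam A x 0).mulVec (deriv (EvansODE.etaMinus A μm vm x) 0))
            (EvansODE.yTildePlus A μp wp x 0)) +
          ∫ x : ℝ, EvansODE.wedge
            ((EvansODE.dLam A x 0).mulVec (EvansODE.etaMinus A μm vm x 0))
            (deriv (EvansODE.yTildePlus A μp wp x) 0))) := by
  have : NeZero n := ⟨by omega⟩
  have h0 : (0 : ℂ) ∈ Ω := by simpa using hA.interval_subset 0 hI0
  have hm := EvansODE.matrixLeftEnd_minus hA hB hCm hD
  have hp := EvansODE.matrixLeftEnd_plus hA hB hCp hD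
  have hΩ := hA.domain_open
  have hL := hm.leftEnd
  have hR := hp.leftEnd
  -- `η` is the selected column solution, `ξ` the selected row solution in the variable `-x`
  set η := EvansODE.leftSol (EvansODE.opFam A) (fun lam => EvansODE.matOp (Am lam)) μm vm with hη
  set ξ := EvansODE.leftSol (EvansODE.opFam (EvansODE.reflect A))
    (fun lam => EvansODE.matOp (Ap lam).transpose) μp wp with hξ
  have hadj : ∀ {c}, c ∈ Ω → _ := fun hc => hm.adjointFamily hp hc
  have hconst : ∀ lam ∈ Ω, ∀ x : ℝ,
      EvansODE.wedge (EvansODE.etaMinus A μm vm x lam) (EvansODE.yTildePlus A μp wp x lam)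
        = EvansODE.evans A μm μp vm wp lam := by
    intro lam hlam x
    rw [EvansODE.evans, hm.wedge_eq hp hlam, hm.wedge_eq hp hlam]
    exact (hadj hlam).pair_eq hlam (hL.isLeftSol_leftSol hlam).1 x
  have hDeq : ∀ lam ∈ Ω, EvansODE.evans A μm μp vm wp lam
      = EvansODE.dotPair (η 0 lam) (ξ (-0) lam) := fun lam hlam => hm.wedge_eq hp hlam 0
  have hder1 : ∀ lam ∈ Ω, HasDerivAt (EvansODE.evans A μm μp vm wp)
      (EvansODE.dotPair (η 0 lam) (deriv (ξ (-0)) lam)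
        + EvansODE.dotPair (deriv (η 0) lam) (ξ (-0) lam)) lam := by
    intro lam hlam
    refine ((hadj hlam).hasDerivAt_pair_leftSol hL hlam 0).congr_of_eventuallyEq ?_
    filter_upwards [hΩ.mem_nhds hlam] with l hl using hDeq l hl
  have hhol : ∀ {f : ℂ → Fin n → ℂ}, DifferentiableOn ℂ f Ω →
      HasDerivAt f (deriv f 0) 0 := fun hf => (hf.differentiableAt (hΩ.mem_nhds h0)).hasDerivAt
  have hηd := hL.differentiableOn_leftSol
  have hξd := hR.differentiableOn_leftSol
  have hder2 : deriv (deriv (EvansODE.evans A μm μp vm wp)) 0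
      = EvansODE.dotPair (deriv (deriv (η 0)) 0) (ξ (-0) 0)
        + 2 * EvansODE.dotPair (deriv (η 0) 0) (deriv (ξ (-0)) 0)
        + EvansODE.dotPair (η 0 0) (deriv (deriv (ξ (-0))) 0) := by
    have h1 : deriv (EvansODE.evans A μm μp vm wp) =ᶠ[𝓝 0] fun lam =>
        EvansODE.dotPair (η 0 lam) (deriv (ξ (-0)) lam)
          + EvansODE.dotPair (deriv (η 0) lam) (ξ (-0) lam) := by
      filter_upwards [hΩ.mem_nhds h0] with l hl using (hder1 l hl).deriv
    rw [h1.deriv_eq]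
    refine ((EvansODE.hasDerivAt_pair_complex _ (hhol (hηd 0))
      (hhol ((hξd (-0)).deriv hΩ))).add (EvansODE.hasDerivAt_pair_complex _
        (hhol ((hηd 0).deriv hΩ)) (hhol (hξd (-0))))).deriv.trans ?_
    ring
  refine ⟨fun lam hlam => hm.existsUnique_isEtaMinus hlam,
    fun lam hlam => hp.existsUnique_isYTildePlus hlam, fun x => ?_, fun x => ?_, hconst, ?_, ?_⟩
  · exact DifferentiableOn.analyticOnNhd
      ((hηd x).congr fun lam hlam => hm.etaMinus_eq hlam x) hΩ
  · exact DifferentiableOn.analyticOnNhd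
      ((EvansODE.covector.symm.toContinuousLinearMap.differentiable.comp_differentiableOn
        (hξd (-x))).congr fun lam hlam => hp.yTildePlus_eq hlam x) hΩ
  · exact DifferentiableOn.analyticOnNhd
      (fun lam hlam => (hder1 lam hlam).differentiableAt.differentiableWithinAt) hΩ
  intro hD0
  -- the reflected system, whose adjoint family is `η(-x)`, accounts for the half-line `(0, ∞)`
  have hmr : EvansODE.MatrixLeftEnd Ω (EvansODE.reflect (EvansODE.reflect A)) Am μm vm wm := by
    rwa [EvansODE.reflect_reflect]
  have hadjL := hm.adjointFamily hp h0
  have hadjR := hp.adjointFamily hmr h0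
  rw [EvansODE.reflect_reflect] at hadjR
  have hdL : ∀ x, deriv (EvansODE.opFam A x) 0 = EvansODE.matOp (EvansODE.dLam A x 0) :=
    fun x => EvansODE.deriv_opFam hΩ hm.diff x h0
  have hdR : ∀ x, deriv (EvansODE.opFam (EvansODE.reflect A) x) 0
      = EvansODE.matOp (EvansODE.dLam A (-x) 0).transpose :=
    fun x => EvansODE.deriv_opFam hΩ hp.diff x h0
  have hswap : ∀ (x : ℝ) (p q : Fin n → ℂ),
      EvansODE.dotPair (deriv (EvansODE.opFam (EvansODE.reflect A) x) 0 p) q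
        = EvansODE.dotPair (deriv (EvansODE.opFam A (-x)) 0 q) p := by
    intro x p q
    rw [hdR, hdL, EvansODE.dotPair_matOp, Matrix.transpose_transpose, EvansODE.dotPair_comm]
  rw [hDeq 0 h0] at hD0
  have hD0R : EvansODE.dotPair (ξ 0 0) (η (-0) 0) = 0 := by
    rw [neg_zero] at hD0 ⊢
    rw [EvansODE.dotPair_comm, hD0]
  have hFeq : ∀ x, EvansODE.wedge ((EvansODE.dLam A x 0).mulVec (EvansODE.etaMinus A μm vm x 0))
      (EvansODE.yTildePlus A μp wp x 0)
        = EvansODE.dotPair (deriv (EvansODE.opFam A x) 0 (η x 0)) (ξ (-x) 0) := by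
    intro x
    rw [EvansODE.wedge_eq_dotPair, hm.etaMinus_eq h0, hp.yTildePlus_eq h0, hdL,
      ContinuousLinearEquiv.apply_symm_apply, EvansODE.matOp_apply]
  have hF1eq : ∀ x, EvansODE.wedge
      ((EvansODE.dLam A x 0).mulVec (deriv (EvansODE.etaMinus A μm vm x) 0))
      (EvansODE.yTildePlus A μp wp x 0)
        = EvansODE.dotPair (deriv (EvansODE.opFam A x) 0 (deriv (η x) 0)) (ξ (-x) 0) := by
    intro x
    rw [EvansODE.wedge_eq_dotPair, hm.deriv_etaMinus h0, hp.yTildePlus_eq h0, hdL,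
      ContinuousLinearEquiv.apply_symm_apply, EvansODE.matOp_apply]
  have hG1eq : ∀ x, EvansODE.wedge ((EvansODE.dLam A x 0).mulVec (EvansODE.etaMinus A μm vm x 0))
      (deriv (EvansODE.yTildePlus A μp wp x) 0)
        = EvansODE.dotPair (deriv (EvansODE.opFam A x) 0 (η x 0)) (deriv (ξ (-x)) 0) := by
    intro x
    rw [EvansODE.wedge_eq_dotPair, hm.etaMinus_eq h0, hp.deriv_yTildePlus h0, hdL,
      ContinuousLinearEquiv.apply_symm_apply, EvansODE.matOp_apply]
  simp only [hFeq, hF1eq, hG1eq]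
  refine ⟨?_, fun hD1 => ?_⟩
  · obtain ⟨hi1, he1⟩ := hadjL.integral_first hL h0 hD0
    obtain ⟨hi2, he2⟩ := hadjR.integral_first hR h0 hD0R
    obtain ⟨hi, he⟩ := EvansODE.integrable_of_halves
      (fun x => by rw [hswap, neg_neg]) hi1 hi2
    refine ⟨hi, ?_⟩
    rw [he, he1, he2, (hder1 0 h0).deriv, neg_zero, EvansODE.dotPair_comm (deriv (ξ 0) 0)]
    ring
  · rw [(hder1 0 h0).deriv] at hD1
    have hD1R : EvansODE.dotPair (ξ 0 0) (deriv (η (-0)) 0)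
        + EvansODE.dotPair (deriv (ξ 0) 0) (η (-0) 0) = 0 := by
      rw [neg_zero] at hD1 ⊢
      rw [EvansODE.dotPair_comm, EvansODE.dotPair_comm (deriv (ξ 0) 0), add_comm, hD1]
    obtain ⟨hF, hG, hFe, hGe⟩ := hadjL.integral_second hL h0
      (fun x => by rw [EvansODE.deriv_deriv_opFam hΩ hm.diff x h0, hA2, map_zero]) hD0 hD1
    obtain ⟨hF', hG', hFe', hGe'⟩ := hadjR.integral_second hR h0
      (fun x => by
        have h1 : EvansODE.dLam (EvansODE.dLam (EvansODE.reflect A)) x 0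
            = (EvansODE.dLam (EvansODE.dLam A) (-x) 0).transpose := rfl
        rw [EvansODE.deriv_deriv_opFam hΩ hp.diff x h0, h1, hA2, Matrix.transpose_zero, map_zero])
      hD0R hD1R
    -- reflection and transposition interchange the two integrands
    obtain ⟨hi1, he1⟩ := EvansODE.integrable_of_halves
      (fun x => by rw [hswap, neg_neg]) hF hG'
    obtain ⟨hi2, he2⟩ := EvansODE.integrable_of_halves
      (fun x => by rw [hswap, neg_neg]) hG hF'
    refine ⟨hi1, hi2, ?_⟩
    rw [hder2, he1, he2]
    rw [neg_zero] at hFe hGe hFe' hGe' ⊢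
    rw [EvansODE.dotPair_comm (deriv (deriv (ξ 0)) 0)] at hFe'
    rw [EvansODE.dotPair_comm (deriv (ξ 0) 0)] at hGe'
    linear_combination -hFe - hGe - hFe' - hGe'
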